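/- Let $d\in\mathbb N$ and $1<p<\infty$. There is a constant $C=C(p,d)$ such that the following holds. Let $T\ge 0$, let $b\in L^1([0,T];W^{1,p}(\mathbb R^d;\mathbb R^d))$, and let $X:[0,T]\times\mathbb R^d\to\mathbb R^d$ be a regular Lagrangian flow of $b$ with compressibility constant $L>0$. This means that each $X_t$ is measurable; that for almost every $x$ the function $s\mapsto b_s(X_s(x))$ is integrable on $[0,T]$ and $$X_t(x)=x+\int_0^t b_s(X_s(x))\,ds\qquad\text{for all } t\in[0,T];$$ and that $(X_t)_\#\mathcal L^d\le L\,\mathcal L^d$ for all $t\in[0,T]$, where $\mathcal L^d$ is the Lebesgue measure. Then there is a measurable function $g:[0,T]\times\mathbb R^d\to[0,+\infty]$, $g_t(x)=g(t,x)$, such that $$e^{-g_t(x)-g_t(y)}\le\frac{|X_t(x)-X_t(y)|}{|x-y|}\le e^{g_t(x)+g_t(y)}\qquad\text{for all }t\in[0,T]\text{ and all }x\ne y\text{ in }\mathbb R^d$$ (with $e^{-\infty}=0$, $e^{+\infty}=+\infty$), and $$\|g_t\|_{L^p(\mathbb R^d)}\le C\,L\int_0^t\|\nabla b_s\|_{L^p(\mathbb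 R^d)}\,ds\qquad\text{for all }t\in[0,T].$$ Moreover, if $b$ is divergence-free (that is, $\operatorname{div} b_t=0$ in the sense of distributions for almost every $t\in[0,T]$), then one can take $L=1$: $X$ has compressibility constant $1$, i.e. $(X_t)_\#\mathcal L^d\le\mathcal L^d$ for all $t\in[0,T]$, and $\|g_t\|_{L^p(\mathbb R^d)}\le C\int_0^t\|\nabla b_s\|_{L^p(\mathbb R^d)}\,ds$ for all $t\in[0,T]$. -/

import Mathlib

open MeasureTheory Set
open scoped ENNReal NNReal

namespace LagrangianFlow

/-- `φ` is a test function: real-valued, smooth and compactly supported on `ℝ^d`. -/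
def IsTestFunction {d : ℕ} (φ : EuclideanSpace ℝ (Fin d) → ℝ) : Prop :=
  ContDiff ℝ ((⊤ : ℕ∞) : WithTop ℕ∞) φ ∧ HasCompactSupport φ

/-- `G` is the weak (distributional) gradient of the vector field `f` on `ℝ^d`:
both are locally integrable and `∫ (∂_v φ) f = - ∫ φ G v` for all test functions `φ` and all
directions `v`. -/
structure HasWeakGradient {d : ℕ} (f : EuclideanSpace ℝ (Fin d) → EuclideanSpace ℝ (Fin d))
    (G : EuclideanSpace ℝ (Fin d) → EuclideanSpace ℝ (Fin d) →L[ℝ] EuclideanSpace ℝ (Fin d)) :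
    Prop where
  locallyIntegrable : LocallyIntegrable f volume
  locallyIntegrable_grad : LocallyIntegrable G volume
  integral_eq : ∀ φ : EuclideanSpace ℝ (Fin d) → ℝ, IsTestFunction φ →
    ∀ v : EuclideanSpace ℝ (Fin d),
      ∫ x, (fderiv ℝ φ x v) • f x = - ∫ x, φ x • G x v

/-- The locally integrable vector field `f` is divergence-free in the sense of distributions:
`∫ f · ∇φ = 0` for all test functions `φ`. -/
def IsDivergenceFree {d : ℕ} (f : EuclideanSpace ℝ (Fin d) → EuclideanSpace ℝ (Fin d)) : Prop :=
  LocallyIntegrable f volume ∧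
    ∀ φ : EuclideanSpace ℝ (Fin d) → ℝ, IsTestFunction φ → ∫ x, fderiv ℝ φ x (f x) = 0

/-- `b ∈ L¹([0,T]; W^{1,p}(ℝ^d; ℝ^d))`, with spatial weak gradient `∇b_t = D t`.
Neither `b` nor `D` is required to be a particular representative.  (The norm
`‖f‖_p + ‖∇f‖_p` is equivalent to `(‖f‖_p^p + ‖∇f‖_p^p)^{1/p}`.) -/
structure MemL1Sobolev {d : ℕ} (T : ℝ) (p : ℝ≥0∞)
    (b : ℝ → EuclideanSpace ℝ (Fin d) → EuclideanSpace ℝ (Fin d))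
    (D : ℝ → EuclideanSpace ℝ (Fin d) →
      EuclideanSpace ℝ (Fin d) →L[ℝ] EuclideanSpace ℝ (Fin d)) : Prop where
  aestronglyMeasurable : AEStronglyMeasurable
    (fun z : ℝ × EuclideanSpace ℝ (Fin d) => b z.1 z.2)
    ((volume.restrict (Icc 0 T)).prod volume)
  aestronglyMeasurable_grad : AEStronglyMeasurable
    (fun z : ℝ × EuclideanSpace ℝ (Fin d) => D z.1 z.2)
    ((volume.restrict (Icc 0 T)).prod volume)
  hasWeakGradient : ∀ᵐ t ∂(volume.restrict (Icc 0 T)), HasWeakGradient (b t) (D t)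
  lintegral_norm_lt_top :
    ∫⁻ t in Icc 0 T, (eLpNorm (b t) p volume + eLpNorm (D t) p volume) < ∞

/-- `X_t` is (Lebesgue) measurable and `(X_t)_# 𝓛^d ≤ L 𝓛^d`, for every `t ∈ [0,T]`. -/
def HasCompressibility {d : ℕ} (T : ℝ)
    (X : ℝ → EuclideanSpace ℝ (Fin d) → EuclideanSpace ℝ (Fin d)) (L : ℝ) : Prop :=
  ∀ t ∈ Icc 0 T, AEMeasurable (X t) volume ∧
    Measure.map (X t) volume ≤ ENNReal.ofReal L • volume

/-- `X` is a regular Lagrangian flow of `b` on `[0,T]` with compressibility constant `L`.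
The integrability of `s ↦ b_s(X_s(x))` says that the integral is meaningful. -/
structure IsRegularLagrangianFlow {d : ℕ} (T : ℝ)
    (b X : ℝ → EuclideanSpace ℝ (Fin d) → EuclideanSpace ℝ (Fin d)) (L : ℝ) : Prop where
  integral_eq : ∀ᵐ x : EuclideanSpace ℝ (Fin d), ∀ t ∈ Icc 0 T,
    IntervalIntegrable (fun s => b s (X s x)) volume 0 t ∧
      X t x = x + ∫ s in (0 : ℝ)..t, b s (X s x)
  pos : 0 < L
  compressibility : HasCompressibility T X L

end LagrangianFlow

/-!
Two trajectories `X_s x`, `X_s y` separate with velocity `b_s (X_s x) - b_s (X_s y)`. A Sobolev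
field satisfies, at points where its mollifications converge to it, the Lipschitz-type inequality
`|b u - b v| ≤ C |u - v| (M|∇b| u + M|∇b| v)` with `M` the maximal function
(`HasWeakGradient.enorm_sub_le_maximal`). Since the flow maps Lebesgue measure to a measure with
bounded density, almost every trajectory sits at such points at almost all times
(`exists_isMeasurableVersion`). Hence `log |X_s x - X_s y|` changes at rate at most
`C (M|∇b_s| (X_s x) + M|∇b_s| (X_s y))`, which is the two-sided bound with
`g_t x = C ∫₀ᵗ M|∇b_s| (X_s x) ds` and `g_t = ∞` on the exceptional null set
(`growth`, `IsMeasurableVersion.exp_growth_bounds`). The `L^p` bound on `g_t` follows from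
Minkowski's integral inequality, the compressibility of the flow and the maximal theorem for `p > 1`
(`exists_eLpNorm_growth_le`); the power `L^{1/p}` this gives is at most `L` because the flow at time
`0` is the identity, which forces `L ≥ 1`.

For a divergence-free field one has to see that the flow does not compress Lebesgue measure, knowing
only that it does so at most by the factor `L`. Let `ρ^A_t`, `ρ^B_t ≤ L` be the densities of the
images under `X_t` of Lebesgue measure on `A` and on `B`. With a mollifier `η_n`, the pairing
`∬_{A × B} η_n(X_t x - X_t y) dx dy` has time derivative
`∬ ∇η_n(u - v) · (b_t u - b_t v) ρ^A_t(u) ρ^B_t(v) du dv`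
(`IsMeasurableVersion.integral_mollifier_flow_sub`). This commutator is bounded uniformly in `n` by
the `L^p` norm of `∇b_t` and the `L^q` norm of the weights, `q` the conjugate exponent
(`exists_lintegral_enorm_commutator_le`), and for weights that are test functions it tends to
`∫ b_t · ∇(ρ^A ρ^B) = 0`, so by density it tends to `0` (`tendsto_commutatorForm`). Letting `n → ∞`,
`∫ ρ^A_t ρ^B_t = |A ∩ B|` is conserved. For `A ⊆ B` this reads `∫_A ρ^B_t(X_t x) dx = |A|`, so
`ρ^B_t = 1` almost everywhere with respect to the image measure itself, which is therefore dominated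
by Lebesgue measure (`IsMeasurableVersion.map_restrict_le`, `HasBoundedDensity.le_volume`).
Exhausting the space by such `B` gives compressibility constant `1`.
-/

namespace LagrangianFlow

open Metric Module Filter Topology

open scoped Convolution InnerProductSpace

/-! ### The Hardy–Littlewood maximal function -/

section Maximal

variable {E : Type*} [NormedAddCommGroup E] [NormedSpace ℝ E] [FiniteDimensional ℝ E]
  [MeasurableSpace E] [BorelSpace E] (μ : Measure E) [μ.IsAddHaarMeasure]

/-- The Hardy–Littlewood maximal function of `f ≥ 0`, with averages over closed balls of dyadic
radius; up to a dimensional factor this is the usual one. -/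
noncomputable def maximal (f : E → ℝ≥0∞) (x : E) : ℝ≥0∞ :=
  ⨆ k : ℤ, (μ (closedBall x ((2 : ℝ) ^ k)))⁻¹ * ∫⁻ y in closedBall x ((2 : ℝ) ^ k), f y ∂μ

omit [NormedSpace ℝ E] [FiniteDimensional ℝ E] [BorelSpace E] in
theorem measure_closedBall_zpow_ne_zero (x : E) (k : ℤ) : μ (closedBall x ((2 : ℝ) ^ k)) ≠ 0 :=
  (measure_closedBall_pos μ x (by positivity)).ne'

omit [BorelSpace E] in
theorem measure_closedBall_ne_top (x : E) (r : ℝ) : μ (closedBall x r) ≠ ∞ :=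
  (isCompact_closedBall x r).measure_lt_top.ne

theorem measurable_maximal_uncurry {S : Type*} [MeasurableSpace S] {f : S → E → ℝ≥0∞}
    (hf : Measurable (Function.uncurry f)) :
    Measurable fun z : S × E => maximal μ (f z.1) z.2 := by
  unfold maximal
  refine Measurable.iSup fun k => Measurable.mul ?_ ?_
  · simp only [Measure.addHaar_closedBall_center]
    exact measurable_const
  · have h : (fun z : S × E => ∫⁻ y in closedBall z.2 ((2 : ℝ) ^ k), f z.1 y ∂μ) =
        fun z : S × E => ∫⁻ y, {w : (S × E) × E | dist w.2 w.1.2 ≤ (2 : ℝ) ^ k}.indicator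
          (fun w => f w.1.1 w.2) (z, y) ∂μ := by
      funext z
      rw [← lintegral_indicator measurableSet_closedBall]
      rfl
    rw [h]
    refine Measurable.lintegral_prod_right' (Measurable.indicator ?_ ?_)
    · exact hf.comp ((measurable_fst.comp measurable_fst).prodMk measurable_snd)
    · exact measurableSet_le (by fun_prop) measurable_const

theorem measurable_maximal {f : E → ℝ≥0∞} (hf : Measurable f) : Measurable (maximal μ f) :=
  Measurable.comp (g := fun z : Unit × E => maximal μ f z.2)
    (measurable_maximal_uncurry μ (f := fun _ => f) (hf.comp measurable_snd))
    (f := fun x => ((), x)) (by fun_prop)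

/-- Covering step of the weak-type bound, with radii bounded by `2 ^ K` so that the Vitali covering
lemma applies. -/
theorem mul_measure_exists_le (f : E → ℝ≥0∞) (c : ℝ≥0∞) (K : ℤ) :
    c * μ {x | ∃ k ≤ K, c < (μ (closedBall x ((2 : ℝ) ^ k)))⁻¹ *
      ∫⁻ y in closedBall x ((2 : ℝ) ^ k), f y ∂μ} ≤ 5 ^ finrank ℝ E * ∫⁻ y, f y ∂μ := by
  let t : Set (E × ℤ) := {a | a.2 ≤ K ∧ c < (μ (closedBall a.1 ((2 : ℝ) ^ a.2)))⁻¹ *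
      ∫⁻ y in closedBall a.1 ((2 : ℝ) ^ a.2), f y ∂μ}
  obtain ⟨u, hut, hdisj, hcov⟩ := Vitali.exists_disjoint_subfamily_covering_enlargement_closedBall
    t (fun a => a.1) (fun a => (2 : ℝ) ^ a.2) (2 ^ K)
    (fun a ha => zpow_le_zpow_right₀ one_le_two ha.1) 5 (by norm_num)
  have hucount : u.Countable := by
    refine hdisj.countable_of_nonempty_interior fun a _ => ?_
    refine ⟨a.1, ball_subset_interior_closedBall (mem_ball_self (by positivity))⟩
  have hball : ∀ a ∈ u, c * μ (closedBall a.1 (5 * (2 : ℝ) ^ a.2)) ≤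
      5 ^ finrank ℝ E * ∫⁻ y in closedBall a.1 ((2 : ℝ) ^ a.2), f y ∂μ := by
    intro a ha
    have h1 : μ (closedBall a.1 (5 * (2 : ℝ) ^ a.2)) =
        5 ^ finrank ℝ E * μ (closedBall a.1 ((2 : ℝ) ^ a.2)) := by
      rw [Measure.addHaar_closedBall_mul μ _ (by norm_num) (by positivity),
        Measure.addHaar_closedBall_center μ a.1]
      simp [ENNReal.ofReal_pow]
    have h2 := (hut ha).2.le
    rw [h1, mul_left_comm]
    gcongr
    rwa [← ENNReal.le_div_iff_mul_le (Or.inl (measure_closedBall_zpow_ne_zero μ _ _))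
      (Or.inl (measure_closedBall_ne_top μ _ _)), ENNReal.div_eq_inv_mul]
  have hsub : {x | ∃ k ≤ K, c < (μ (closedBall x ((2 : ℝ) ^ k)))⁻¹ *
      ∫⁻ y in closedBall x ((2 : ℝ) ^ k), f y ∂μ} ⊆
      ⋃ a ∈ u, closedBall a.1 (5 * (2 : ℝ) ^ a.2) := by
    rintro x ⟨k, hk, hx⟩
    obtain ⟨b, hb, hsub⟩ := hcov (x, k) ⟨hk, hx⟩
    exact mem_biUnion hb (hsub (mem_closedBall_self (by positivity)))
  have := hucount.to_subtype
  calc _ ≤ c * ∑' a : u, μ (closedBall a.1.1 (5 * (2 : ℝ) ^ a.1.2)) := by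
        gcongr
        exact (measure_mono hsub).trans (measure_biUnion_le μ hucount _)
    _ = ∑' a : u, c * μ (closedBall a.1.1 (5 * (2 : ℝ) ^ a.1.2)) := ENNReal.tsum_mul_left.symm
    _ ≤ ∑' a : u, 5 ^ finrank ℝ E * ∫⁻ y in closedBall a.1.1 ((2 : ℝ) ^ a.1.2), f y ∂μ :=
        ENNReal.tsum_le_tsum fun a => hball a a.2
    _ = 5 ^ finrank ℝ E * ∫⁻ y in ⋃ a ∈ u, closedBall a.1 ((2 : ℝ) ^ a.2), f y ∂μ := by
        rw [ENNReal.tsum_mul_left, lintegral_biUnion hucount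
          (fun a _ => measurableSet_closedBall) hdisj]
    _ ≤ _ := by gcongr; exact Measure.restrict_le_self

/-- Weak-type `(1,1)` bound for the maximal function. -/
theorem mul_measure_lt_maximal_le (f : E → ℝ≥0∞) (c : ℝ≥0∞) :
    c * μ {x | c < maximal μ f x} ≤ 5 ^ finrank ℝ E * ∫⁻ y, f y ∂μ := by
  have hU : {x | c < maximal μ f x} = ⋃ K : ℤ, {x | ∃ k ≤ K,
      c < (μ (closedBall x ((2 : ℝ) ^ k)))⁻¹ * ∫⁻ y in closedBall x ((2 : ℝ) ^ k), f y ∂μ} := by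
    ext x
    simp only [mem_ofPred_eq, maximal, lt_iSup_iff, mem_iUnion]
    exact ⟨fun ⟨k, hk⟩ => ⟨k, k, le_rfl, hk⟩, fun ⟨_, k, _, hk⟩ => ⟨k, hk⟩⟩
  rw [hU, Monotone.measure_iUnion, ENNReal.mul_iSup]
  · exact iSup_le fun K => mul_measure_exists_le μ f c K
  · exact fun K K' h x ⟨k, hk, hx⟩ => ⟨k, hk.trans h, hx⟩

/-- Weak-type bound seeing only the large values of `f`: the part of `f` below `c / 2` raises the
maximal function by at most `c / 2`. -/
theorem mul_measure_lt_maximal_le_setLIntegral {f : E → ℝ≥0∞} (hf : Measurable f) (c : ℝ≥0∞) :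
    c * μ {x | c < maximal μ f x} ≤ 2 * 5 ^ finrank ℝ E * ∫⁻ y in {y | c < 2 * f y}, f y ∂μ := by
  have hm : MeasurableSet {y | c < 2 * f y} := measurableSet_lt measurable_const (hf.const_mul 2)
  have hle : ∀ x, maximal μ f x ≤ maximal μ ({y | c < 2 * f y}.indicator f) x + c / 2 := by
    intro x
    refine iSup_le fun k => ?_
    have h1 : ∫⁻ y in closedBall x ((2 : ℝ) ^ k), f y ∂μ ≤
        ∫⁻ y in closedBall x ((2 : ℝ) ^ k), {y | c < 2 * f y}.indicator f y ∂μ +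
          c / 2 * μ (closedBall x ((2 : ℝ) ^ k)) := by
      rw [← setLIntegral_const, ← lintegral_add_right _ measurable_const]
      refine lintegral_mono fun y => ?_
      by_cases hy : c < 2 * f y
      · rw [indicator_of_mem (by exact hy)]
        exact le_self_add
      · rw [indicator_of_notMem (by exact hy), zero_add,
          ENNReal.le_div_iff_mul_le (by simp) (by simp), mul_comm]
        exact not_lt.1 hy
    calc _ ≤ (μ (closedBall x ((2 : ℝ) ^ k)))⁻¹ *
          (∫⁻ y in closedBall x ((2 : ℝ) ^ k), {y | c < 2 * f y}.indicator f y ∂μ +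
          c / 2 * μ (closedBall x ((2 : ℝ) ^ k))) := by gcongr
      _ ≤ _ := by
        rw [mul_add]
        gcongr
        · exact le_iSup (fun k : ℤ => (μ (closedBall x ((2 : ℝ) ^ k)))⁻¹ *
            ∫⁻ y in closedBall x ((2 : ℝ) ^ k), {y | c < 2 * f y}.indicator f y ∂μ) k
        · rw [mul_left_comm, ENNReal.inv_mul_cancel (measure_closedBall_zpow_ne_zero μ _ _)
            (measure_closedBall_ne_top μ _ _), mul_one]
  have hsub : {x | c < maximal μ f x} ⊆
      {x | c / 2 < maximal μ ({y | c < 2 * f y}.indicator f) x} := by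
    intro x hx
    by_contra h
    have h3 := (hle x).trans (add_le_add_left (not_lt.1 h) (c / 2))
    rw [ENNReal.add_halves] at h3
    exact absurd hx (not_lt.2 h3)
  calc c * μ {x | c < maximal μ f x}
      = 2 * (c / 2 * μ {x | c < maximal μ f x}) := by
        rw [← mul_assoc, ENNReal.mul_div_cancel (by simp) (by simp)]
    _ ≤ 2 * (c / 2 * μ {x | c / 2 < maximal μ ({y | c < 2 * f y}.indicator f) x}) := by gcongr
    _ ≤ 2 * (5 ^ finrank ℝ E * ∫⁻ y, {y | c < 2 * f y}.indicator f y ∂μ) := by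
        gcongr 2 * ?_
        exact mul_measure_lt_maximal_le μ _ _
    _ = _ := by rw [lintegral_indicator hm, mul_assoc]

end Maximal

/-- The layer-cake identity `a ^ r = ∫₀^a r t ^ (r - 1) dt` for extended nonnegative `a`. -/
theorem rpow_eq_lintegral_Ioi (a : ℝ≥0∞) {r : ℝ} (hr : 0 < r) :
    a ^ r = ENNReal.ofReal r * ∫⁻ t in Ioi (0 : ℝ),
      {t : ℝ | ENNReal.ofReal t < a}.indicator (fun t => ENNReal.ofReal (t ^ (r - 1))) t := by
  have hreal : ∀ b : ℝ≥0, (b : ℝ≥0∞) ^ r = ENNReal.ofReal r * ∫⁻ t in Ioi (0 : ℝ),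
      {t : ℝ | ENNReal.ofReal t < b}.indicator (fun t => ENNReal.ofReal (t ^ (r - 1))) t := by
    intro b
    have h := lintegral_rpow_eq_lintegral_meas_lt_mul (Measure.dirac ()) (f := fun _ => (b : ℝ))
      (Eventually.of_forall fun _ => b.2) aemeasurable_const hr
    rw [lintegral_const, measure_univ, mul_one,
      ← ENNReal.ofReal_rpow_of_nonneg (NNReal.coe_nonneg b) hr.le,
      ENNReal.ofReal_coe_nnreal] at h
    rw [h]
    congr 1
    refine setLIntegral_congr_fun measurableSet_Ioi fun t ht => ?_
    have ht : (0 : ℝ) < t := ht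
    by_cases htb : t < b
    · have h2 : ENNReal.ofReal t < b := by
        rw [← ENNReal.ofReal_coe_nnreal]
        exact (ENNReal.ofReal_lt_ofReal_iff (ht.trans htb)).2 htb
      simp [htb, h2]
    · have h2 : ¬ ENNReal.ofReal t < b := by
        rw [← ENNReal.ofReal_coe_nnreal, not_lt]
        exact ENNReal.ofReal_le_ofReal (not_lt.1 htb)
      simp [htb, h2]
  induction a with
  | coe b => exact hreal b
  | top =>
    rw [ENNReal.top_rpow_of_pos hr]
    refine (ENNReal.eq_top_of_forall_nnreal_le fun b => ?_).symm
    have hb : ((b ^ (1 / r) : ℝ≥0) : ℝ≥0∞) ^ r = b := by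
      rw [← ENNReal.coe_rpow_of_nonneg _ hr.le, ← NNReal.rpow_mul, one_div_mul_cancel hr.ne',
        NNReal.rpow_one]
    rw [← hb, hreal]
    gcongr
    exact le_top

/-- Marcinkiewicz interpolation between the weak-type bound and the trivial `L^∞` bound, in the form
that applies to the maximal function. -/
theorem lintegral_rpow_le_of_weak_type {α : Type*} [MeasurableSpace α] {μ : Measure α} [SFinite μ]
    {F f : α → ℝ≥0∞} (hF : Measurable F) (hf : Measurable f) {C : ℝ≥0∞} {r : ℝ} (hr : 1 < r)
    (h : ∀ c : ℝ≥0∞, c * μ {x | c < F x} ≤ C * ∫⁻ y in {y | c < 2 * f y}, f y ∂μ) :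
    ∫⁻ x, F x ^ r ∂μ ≤ ENNReal.ofReal r * C * (ENNReal.ofReal (r - 1))⁻¹ * 2 ^ (r - 1) *
      ∫⁻ x, f x ^ r ∂μ := by
  have hr0 : 0 < r := by linarith
  have hr1 : 0 < r - 1 := by linarith
  have hmeas : ∀ {G : α → ℝ≥0∞} (_ : Measurable G) (s : ℝ), Measurable (fun w : α × ℝ =>
      {w : α × ℝ | ENNReal.ofReal w.2 < G w.1}.indicator
        (fun w => ENNReal.ofReal (w.2 ^ s)) w) := by
    intro G hG s
    exact Measurable.indicator (by fun_prop) (measurableSet_lt (by fun_prop) (by fun_prop))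
  calc ∫⁻ x, F x ^ r ∂μ
      = ENNReal.ofReal r * ∫⁻ x, (∫⁻ t in Ioi (0 : ℝ), {t : ℝ | ENNReal.ofReal t < F x}.indicator
          (fun t => ENNReal.ofReal (t ^ (r - 1))) t) ∂μ := by
        simp_rw [rpow_eq_lintegral_Ioi _ hr0]
        rw [lintegral_const_mul' _ _ ENNReal.ofReal_ne_top]
    _ = ENNReal.ofReal r * ∫⁻ t in Ioi (0 : ℝ), ∫⁻ x, {t : ℝ | ENNReal.ofReal t < F x}.indicator
          (fun t => ENNReal.ofReal (t ^ (r - 1))) t ∂μ := by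
        rw [lintegral_lintegral_swap (hmeas hF (r - 1)).aemeasurable]
    _ ≤ ENNReal.ofReal r * ∫⁻ t in Ioi (0 : ℝ), C * ∫⁻ x, f x *
          {t : ℝ | ENNReal.ofReal t < 2 * f x}.indicator
          (fun t => ENNReal.ofReal (t ^ (r - 1 - 1))) t ∂μ := by
        gcongr 1
        refine setLIntegral_mono' measurableSet_Ioi fun t ht => ?_
        have ht : (0 : ℝ) < t := ht
        have e1 : ∫⁻ x, {t : ℝ | ENNReal.ofReal t < F x}.indicator
            (fun t => ENNReal.ofReal (t ^ (r - 1))) t ∂μ =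
            ENNReal.ofReal (t ^ (r - 1)) * μ {x | ENNReal.ofReal t < F x} := by
          rw [← lintegral_indicator_const (measurableSet_lt measurable_const hF)]
          rfl
        have e2 : ∫⁻ x, f x * {t : ℝ | ENNReal.ofReal t < 2 * f x}.indicator
            (fun t => ENNReal.ofReal (t ^ (r - 1 - 1))) t ∂μ =
            ENNReal.ofReal (t ^ (r - 1 - 1)) *
              ∫⁻ y in {y | ENNReal.ofReal t < 2 * f y}, f y ∂μ := by
          rw [← lintegral_const_mul _ hf,
            ← lintegral_indicator (measurableSet_lt measurable_const (hf.const_mul 2))]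
          refine lintegral_congr fun x => ?_
          by_cases hx : ENNReal.ofReal t < 2 * f x <;> simp [indicator, mul_comm]
        have e3 : ENNReal.ofReal (t ^ (r - 1)) =
            ENNReal.ofReal (t ^ (r - 1 - 1)) * ENNReal.ofReal t := by
          rw [← ENNReal.ofReal_mul (by positivity), ← Real.rpow_add_one ht.ne', sub_add_cancel]
        rw [e1, e2, e3, mul_assoc, mul_left_comm C]
        gcongr ENNReal.ofReal (t ^ (r - 1 - 1)) * ?_
        exact h _
    _ = ENNReal.ofReal r * (C * ∫⁻ x, (f x * ∫⁻ t in Ioi (0 : ℝ),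
          {t : ℝ | ENNReal.ofReal t < 2 * f x}.indicator
          (fun t => ENNReal.ofReal (t ^ (r - 1 - 1))) t) ∂μ) := by
        have hm := hmeas (hf.const_mul 2) (r - 1 - 1)
        rw [lintegral_const_mul, lintegral_lintegral_swap]
        · congr 2
          refine lintegral_congr fun x => ?_
          rw [lintegral_const_mul]
          exact hm.comp measurable_prodMk_left
        · exact (((hf.comp measurable_snd).mul (hm.comp measurable_swap))).aemeasurable
        · exact Measurable.lintegral_prod_right'
            (f := fun w : ℝ × α => f w.2 * {t : ℝ | ENNReal.ofReal t < 2 * f w.2}.indicator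
              (fun t => ENNReal.ofReal (t ^ (r - 1 - 1))) w.1)
            ((hf.comp measurable_snd).mul (hm.comp measurable_swap))
    _ = ENNReal.ofReal r * (C * ∫⁻ x, (ENNReal.ofReal (r - 1))⁻¹ * 2 ^ (r - 1) * f x ^ r ∂μ) := by
        congr 2
        refine lintegral_congr fun x => ?_
        have e := rpow_eq_lintegral_Ioi (2 * f x) hr1
        have e' := congrArg ((ENNReal.ofReal (r - 1))⁻¹ * ·) e
        simp only [← mul_assoc] at e'
        rw [ENNReal.inv_mul_cancel (by simpa using hr) ENNReal.ofReal_ne_top, one_mul] at e'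
        have e2 : f x ^ r = f x * f x ^ (r - 1) := by
          conv_lhs => rw [← sub_add_cancel r 1, ENNReal.rpow_add_of_nonneg _ _ hr1.le zero_le_one,
            ENNReal.rpow_one, mul_comm]
        rw [← e', ENNReal.mul_rpow_of_nonneg _ _ hr1.le, e2]
        ring
    _ = _ := by
        rw [lintegral_const_mul _ (hf.pow_const r)]
        ring

/-- The maximal theorem: the maximal function is bounded on `L^r`, `1 < r < ∞`. -/
theorem exists_lintegral_maximal_rpow_le {E : Type*} [NormedAddCommGroup E] [NormedSpace ℝ E]
    [FiniteDimensional ℝ E] [MeasurableSpace E] [BorelSpace E] (μ : Measure E) [μ.IsAddHaarMeasure]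
    {r : ℝ} (hr : 1 < r) :
    ∃ C : ℝ≥0, ∀ f : E → ℝ≥0∞, Measurable f →
      ∫⁻ x, maximal μ f x ^ r ∂μ ≤ C * ∫⁻ x, f x ^ r ∂μ := by
  refine ⟨(ENNReal.ofReal r * (2 * 5 ^ finrank ℝ E) * (ENNReal.ofReal (r - 1))⁻¹ *
    2 ^ (r - 1)).toNNReal, fun f hf => ?_⟩
  rw [ENNReal.coe_toNNReal]
  · exact lintegral_rpow_le_of_weak_type (measurable_maximal μ hf) hf hr
      (mul_measure_lt_maximal_le_setLIntegral μ hf)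
  · have : ENNReal.ofReal (r - 1) ≠ 0 := by simpa using hr
    have h2 : (2 : ℝ≥0∞) ^ (r - 1) ≠ ∞ := ENNReal.rpow_ne_top_of_nonneg (by linarith) (by simp)
    finiteness

/-! ### Pointwise differences and the maximal function -/

section MaximalBounds

variable {E : Type*} [NormedAddCommGroup E] [NormedSpace ℝ E] [FiniteDimensional ℝ E]
  [MeasurableSpace E] [BorelSpace E] (μ : Measure E) [μ.IsAddHaarMeasure]

theorem measure_closedBall_two_mul (x : E) {r : ℝ} (hr : 0 ≤ r) :
    μ (closedBall x (2 * r)) = 2 ^ finrank ℝ E * μ (closedBall x r) := by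
  rw [Measure.addHaar_closedBall_mul μ _ (by norm_num) hr, Measure.addHaar_closedBall_center μ x]
  simp [ENNReal.ofReal_pow]

theorem setLIntegral_closedBall_le_maximal (f : E → ℝ≥0∞) (x : E) {r : ℝ} (hr : 0 < r) :
    ∫⁻ y in closedBall x r, f y ∂μ ≤
      2 ^ finrank ℝ E * μ (closedBall x r) * maximal μ f x := by
  obtain ⟨k, hk, hk'⟩ := exists_mem_Ioc_zpow hr (one_lt_two : (1 : ℝ) < 2)
  calc ∫⁻ y in closedBall x r, f y ∂μ ≤ ∫⁻ y in closedBall x ((2 : ℝ) ^ (k + 1)), f y ∂μ :=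
        lintegral_mono_set (closedBall_subset_closedBall hk')
    _ ≤ maximal μ f x * μ (closedBall x ((2 : ℝ) ^ (k + 1))) := by
        rw [← ENNReal.div_le_iff_le_mul (Or.inl (measure_closedBall_zpow_ne_zero μ _ _))
          (Or.inl (measure_closedBall_ne_top μ _ _)), ENNReal.div_eq_inv_mul]
        exact le_iSup (fun k : ℤ => (μ (closedBall x ((2 : ℝ) ^ k)))⁻¹ *
            ∫⁻ y in closedBall x ((2 : ℝ) ^ k), f y ∂μ) (k + 1)
    _ ≤ maximal μ f x * μ (closedBall x (2 * r)) := by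
        gcongr
        rw [zpow_add_one₀ two_ne_zero, mul_comm]
        gcongr
    _ = _ := by rw [measure_closedBall_two_mul μ x hr.le, mul_comm]

/-- Averaging over balls of a fixed radius does not increase the maximal function by more than a
dimensional factor. -/
theorem maximal_average_le {f : E → ℝ≥0∞} (hf : Measurable f) (x : E) {ρ : ℝ} (hρ : 0 < ρ) :
    maximal μ (fun z => (μ (closedBall (0 : E) ρ))⁻¹ * ∫⁻ y in closedBall z ρ, f y ∂μ) x ≤
      4 ^ finrank ℝ E * maximal μ f x := by
  have h4 : (4 : ℝ≥0∞) ^ finrank ℝ E = 2 ^ finrank ℝ E * 2 ^ finrank ℝ E := by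
    rw [← mul_pow]; norm_num
  have hb0 : μ (closedBall (0 : E) ρ) ≠ 0 := (measure_closedBall_pos μ _ hρ).ne'
  have hbt : μ (closedBall (0 : E) ρ) ≠ ∞ := measure_closedBall_ne_top μ _ _
  refine iSup_le fun k => ?_
  set R : ℝ := (2 : ℝ) ^ k with hR
  have hR0 : 0 < R := by positivity
  have hR0' : μ (closedBall x R) ≠ 0 := (measure_closedBall_pos μ _ hR0).ne'
  have hRt : μ (closedBall x R) ≠ ∞ := measure_closedBall_ne_top μ _ _
  rw [ENNReal.inv_mul_le_iff hR0' hRt]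
  -- Small averages are integrated by Fubini over the ball of radius `2 R`; large ones vary little
  -- over the ball of radius `R` and are bounded one by one.
  rcases le_total ρ R with h | h
  · rw [lintegral_const_mul' _ _ (by simpa using hb0), ENNReal.inv_mul_le_iff hb0 hbt]
    have hset : MeasurableSet {w : E × E | dist w.2 w.1 ≤ ρ} :=
      measurableSet_le (by fun_prop) measurable_const
    calc ∫⁻ z in closedBall x R, ∫⁻ y in closedBall z ρ, f y ∂μ ∂μ
        = ∫⁻ z in closedBall x R, ∫⁻ y, {w : E × E | dist w.2 w.1 ≤ ρ}.indicator
            (fun w => f w.2) (z, y) ∂μ ∂μ := by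
          refine lintegral_congr fun z => ?_
          rw [← lintegral_indicator measurableSet_closedBall]
          rfl
      _ = ∫⁻ y, ∫⁻ z in closedBall x R, {w : E × E | dist w.2 w.1 ≤ ρ}.indicator
            (fun w => f w.2) (z, y) ∂μ ∂μ := by
          rw [lintegral_lintegral_swap]
          exact ((hf.comp measurable_snd).indicator hset).aemeasurable
      _ ≤ ∫⁻ y, (closedBall x (2 * R)).indicator f y * μ (closedBall (0 : E) ρ) ∂μ := by
          refine lintegral_mono fun y => ?_
          by_cases hy : y ∈ closedBall x (2 * R)
          · rw [indicator_of_mem hy, ← Measure.addHaar_closedBall_center μ y, ← setLIntegral_const,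
              ← lintegral_indicator (s := closedBall y ρ) measurableSet_closedBall]
            refine (lintegral_mono' Measure.restrict_le_self le_rfl).trans
              (lintegral_mono fun z => ?_)
            simp only [indicator, mem_ofPred_eq, mem_closedBall, dist_comm y z, le_refl]
          · refine (setLIntegral_mono' measurableSet_closedBall (g := fun _ => 0)
              fun z hz => ?_).trans (by simp)
            rw [indicator_of_notMem]
            intro hyz
            refine hy ?_
            have h1 : dist y z ≤ ρ := hyz
            have h2 : dist z x ≤ R := hz
            have := dist_triangle y z x
            exact mem_closedBall.2 (by linarith)
      _ = (∫⁻ y in closedBall x (2 * R), f y ∂μ) * μ (closedBall (0 : E) ρ) := by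
          rw [lintegral_mul_const' _ _ hbt, lintegral_indicator measurableSet_closedBall]
      _ ≤ (2 ^ finrank ℝ E * μ (closedBall x (2 * R)) * maximal μ f x) *
            μ (closedBall (0 : E) ρ) := by
          gcongr
          exact setLIntegral_closedBall_le_maximal μ f x (by positivity)
      _ = _ := by
          rw [measure_closedBall_two_mul μ x hR0.le, h4]
          ring
  · refine (setLIntegral_mono' measurableSet_closedBall (g := fun _ =>
      4 ^ finrank ℝ E * maximal μ f x) fun z hz => ?_).trans ?_
    · rw [ENNReal.inv_mul_le_iff hb0 hbt]
      calc ∫⁻ y in closedBall z ρ, f y ∂μ ≤ ∫⁻ y in closedBall x (2 * ρ), f y ∂μ := by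
            refine lintegral_mono_set (closedBall_subset_closedBall' ?_)
            have : dist z x ≤ R := hz
            linarith
        _ ≤ _ := setLIntegral_closedBall_le_maximal μ f x (by positivity)
        _ = _ := by
            rw [measure_closedBall_two_mul μ x hρ.le, h4, Measure.addHaar_closedBall_center μ x]
            ring
    · rw [setLIntegral_const, mul_comm]

omit [NormedSpace ℝ E] [FiniteDimensional ℝ E] [BorelSpace E] [μ.IsAddHaarMeasure] in
theorem maximal_mono {f g : E → ℝ≥0∞} (h : ∀ y, f y ≤ g y) (x : E) :
    maximal μ f x ≤ maximal μ g x := by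
  refine iSup_mono fun k => ?_
  gcongr
  exact h _

omit [NormedSpace ℝ E] [FiniteDimensional ℝ E] [BorelSpace E] [μ.IsAddHaarMeasure] in
theorem maximal_const_mul {c : ℝ≥0∞} (hc : c ≠ ∞) (f : E → ℝ≥0∞) (x : E) :
    maximal μ (fun y => c * f y) x = c * maximal μ f x := by
  unfold maximal
  rw [ENNReal.mul_iSup]
  refine iSup_congr fun k => ?_
  rw [lintegral_const_mul' _ _ hc, mul_left_comm]

/-- Integrating `f` along the contraction of a ball towards its centre `x` is controlled by the
average of `f` over the smaller ball. -/
theorem setLIntegral_contract_le {f : E → ℝ≥0∞} (hf : Measurable f) (x : E) {r t : ℝ} (hr : 0 < r)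
    (ht : 0 < t) :
    ∫⁻ z in closedBall x r, f (x + t • (z - x)) ∂μ ≤
      2 ^ finrank ℝ E * μ (closedBall x r) * maximal μ f x := by
  have hmap : Measure.map (fun z => x + t • (z - x)) μ =
      ENNReal.ofReal (|(t ^ finrank ℝ E)⁻¹|) • μ := by
    have h1 : (fun z => x + t • (z - x)) = (fun z => z + (x - t • x)) ∘ (fun z => t • z) := by
      funext z; simp only [Function.comp, smul_sub]; abel
    rw [h1, ← Measure.map_map (by fun_prop) (by fun_prop), Measure.map_addHaar_smul μ ht.ne',
      Measure.map_smul, map_add_right_eq_self]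
  calc ∫⁻ z in closedBall x r, f (x + t • (z - x)) ∂μ
      = ∫⁻ z, (closedBall x (t * r)).indicator f (x + t • (z - x)) ∂μ := by
        rw [← lintegral_indicator measurableSet_closedBall]
        refine lintegral_congr fun z => ?_
        have : z ∈ closedBall x r ↔ x + t • (z - x) ∈ closedBall x (t * r) := by
          simp only [mem_closedBall, dist_eq_norm, add_sub_cancel_left, norm_smul,
            Real.norm_of_nonneg ht.le]
          exact (mul_le_mul_iff_right₀ ht).symm
        by_cases hz : z ∈ closedBall x r
        · rw [indicator_of_mem hz, indicator_of_mem (this.1 hz)]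
        · rw [indicator_of_notMem hz, indicator_of_notMem (mt this.2 hz)]
    _ = ENNReal.ofReal (|(t ^ finrank ℝ E)⁻¹|) * ∫⁻ z in closedBall x (t * r), f z ∂μ := by
        rw [← lintegral_map (hf.indicator measurableSet_closedBall) (by fun_prop), hmap,
          lintegral_smul_measure, smul_eq_mul, lintegral_indicator measurableSet_closedBall]
    _ ≤ ENNReal.ofReal (|(t ^ finrank ℝ E)⁻¹|) *
          (2 ^ finrank ℝ E * μ (closedBall x (t * r)) * maximal μ f x) := by
        gcongr
        exact setLIntegral_closedBall_le_maximal μ f x (by positivity)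
    _ = _ := by
        rw [Measure.addHaar_closedBall_mul μ x ht.le hr.le, Measure.addHaar_closedBall_center μ x,
          abs_of_nonneg (by positivity), ENNReal.ofReal_inv_of_pos (by positivity)]
        have h0 : ENNReal.ofReal (t ^ finrank ℝ E) ≠ 0 := by
          simp only [ne_eq, ENNReal.ofReal_eq_zero, not_le]; positivity
        calc _ = ((ENNReal.ofReal (t ^ finrank ℝ E))⁻¹ * ENNReal.ofReal (t ^ finrank ℝ E)) *
              (2 ^ finrank ℝ E * μ (closedBall 0 r) * maximal μ f x) := by ring
          _ = _ := by rw [ENNReal.inv_mul_cancel h0 ENNReal.ofReal_ne_top, one_mul]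

variable {F : Type*} [NormedAddCommGroup F] [NormedSpace ℝ F] [CompleteSpace F]

omit [FiniteDimensional ℝ E] [MeasurableSpace E] [BorelSpace E] in
theorem enorm_sub_le_lintegral_segment {f : E → F} (hf : ContDiff ℝ 1 f) (x z : E) :
    ‖f z - f x‖ₑ ≤ ∫⁻ t in Ioc (0 : ℝ) 1, ‖fderiv ℝ f (x + t • (z - x))‖ₑ * ‖z - x‖ₑ := by
  have hd : ∀ t ∈ uIcc (0 : ℝ) 1, HasDerivAt (fun t : ℝ => f (x + t • (z - x)))
      (fderiv ℝ f (x + t • (z - x)) (z - x)) t := by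
    intro t _
    have h1 : HasDerivAt (fun t : ℝ => x + t • (z - x)) (z - x) t := by
      simpa using ((hasDerivAt_id t).smul_const (z - x)).const_add x
    exact ((hf.differentiable one_ne_zero).differentiableAt.hasFDerivAt).comp_hasDerivAt t h1
  have hc : Continuous fun t : ℝ => fderiv ℝ f (x + t • (z - x)) (z - x) :=
    ((hf.continuous_fderiv one_ne_zero).comp (by fun_prop)).clm_apply continuous_const
  have h := intervalIntegral.integral_eq_sub_of_hasDerivAt hd (hc.intervalIntegrable 0 1)
  simp only [one_smul, zero_smul, add_zero, add_sub_cancel] at h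
  rw [← h, intervalIntegral.integral_of_le zero_le_one]
  refine (enorm_integral_le_lintegral_enorm _).trans (lintegral_mono fun t => ?_)
  exact ContinuousLinearMap.le_opENorm _ _

/-- The mean oscillation of a `C¹` function around `x`: integrate the gradient along the segments
from `x` and exchange the integrals. -/
theorem setLIntegral_enorm_sub_le_maximal {f : E → F} (hf : ContDiff ℝ 1 f) (x : E) {r : ℝ}
    (hr : 0 < r) :
    ∫⁻ z in closedBall x r, ‖f z - f x‖ₑ ∂μ ≤ ENNReal.ofReal r *
      (2 ^ finrank ℝ E * μ (closedBall x r) * maximal μ (fun y => ‖fderiv ℝ f y‖ₑ) x) := by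
  have hcd : Continuous (fderiv ℝ f) := hf.continuous_fderiv one_ne_zero
  calc ∫⁻ z in closedBall x r, ‖f z - f x‖ₑ ∂μ
      ≤ ∫⁻ z in closedBall x r, (∫⁻ t in Ioc (0 : ℝ) 1,
          ‖fderiv ℝ f (x + t • (z - x))‖ₑ * ENNReal.ofReal r) ∂μ := by
        refine setLIntegral_mono' measurableSet_closedBall fun z hz => ?_
        refine (enorm_sub_le_lintegral_segment hf x z).trans (lintegral_mono fun t => ?_)
        gcongr
        rw [← ofReal_norm, ← dist_eq_norm]
        exact ENNReal.ofReal_le_ofReal hz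
    _ = ∫⁻ t in Ioc (0 : ℝ) 1, (∫⁻ z in closedBall x r,
          ‖fderiv ℝ f (x + t • (z - x))‖ₑ * ENNReal.ofReal r ∂μ) := by
        rw [lintegral_lintegral_swap]
        refine Measurable.aemeasurable ?_
        refine Measurable.mul_const (Continuous.measurable ?_) _
        exact (hcd.comp (by fun_prop)).enorm
    _ ≤ ∫⁻ t in Ioc (0 : ℝ) 1, ENNReal.ofReal r * (2 ^ finrank ℝ E * μ (closedBall x r) *
          maximal μ (fun y => ‖fderiv ℝ f y‖ₑ) x) := by
        refine setLIntegral_mono' measurableSet_Ioc fun t ht => ?_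
        rw [lintegral_mul_const' _ _ ENNReal.ofReal_ne_top, mul_comm]
        gcongr
        exact setLIntegral_contract_le μ hcd.enorm.measurable x hr ht.1
    _ = _ := by simp

/-- The pointwise Lipschitz-type inequality for `C¹` functions. Both `f x` and `f y` are compared
with the values of `f` on the ball having `[x, y]` as a diameter. -/
theorem ContDiff.enorm_sub_le_maximal {f : E → F} (hf : ContDiff ℝ 1 f) (x y : E) :
    ‖f x - f y‖ₑ ≤ 4 ^ finrank ℝ E * ‖x - y‖ₑ *
      (maximal μ (fun y => ‖fderiv ℝ f y‖ₑ) x + maximal μ (fun y => ‖fderiv ℝ f y‖ₑ) y) := by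
  rcases eq_or_ne x y with rfl | hxy
  · simp
  have h4 : (4 : ℝ≥0∞) ^ finrank ℝ E = 2 ^ finrank ℝ E * 2 ^ finrank ℝ E := by
    rw [← mul_pow]; norm_num
  set r := ‖x - y‖ with hr
  have hr0 : 0 < r := norm_pos_iff.2 (sub_ne_zero.2 hxy)
  set m := midpoint ℝ x y
  set W := closedBall m (r / 2)
  have hmx : dist m x = r / 2 := by
    rw [dist_midpoint_left, dist_eq_norm, ← hr]; norm_num; ring
  have hmy : dist m y = r / 2 := by
    rw [dist_midpoint_right, dist_eq_norm, ← hr]; norm_num; ring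
  have hWx : W ⊆ closedBall x r := closedBall_subset_closedBall' (by linarith)
  have hWy : W ⊆ closedBall y r := closedBall_subset_closedBall' (by linarith)
  have hW0 : μ W ≠ 0 := (measure_closedBall_pos μ _ (by positivity)).ne'
  have hWt : μ W ≠ ∞ := measure_closedBall_ne_top μ _ _
  have hball : ∀ w : E, μ (closedBall w r) = 2 ^ finrank ℝ E * μ W := by
    intro w
    rw [← measure_closedBall_two_mul μ m (by positivity), mul_div_cancel₀ _ two_ne_zero,
      Measure.addHaar_closedBall_center μ w, Measure.addHaar_closedBall_center μ m]
  have hfm : Measurable fun z => ‖f z - f x‖ₑ :=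
    (hf.continuous.sub continuous_const).enorm.measurable
  rw [← ENNReal.mul_le_mul_iff_right hW0 hWt]
  calc μ W * ‖f x - f y‖ₑ = ∫⁻ z in W, ‖f x - f y‖ₑ ∂μ := by rw [setLIntegral_const, mul_comm]
    _ ≤ ∫⁻ z in W, (‖f z - f x‖ₑ + ‖f z - f y‖ₑ) ∂μ := by
        refine lintegral_mono fun z => ?_
        have : f x - f y = (f z - f y) - (f z - f x) := by abel
        rw [this, add_comm]
        exact enorm_sub_le
    _ = ∫⁻ z in W, ‖f z - f x‖ₑ ∂μ + ∫⁻ z in W, ‖f z - f y‖ₑ ∂μ := lintegral_add_left hfm _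
    _ ≤ ∫⁻ z in closedBall x r, ‖f z - f x‖ₑ ∂μ + ∫⁻ z in closedBall y r, ‖f z - f y‖ₑ ∂μ :=
        add_le_add (lintegral_mono_set hWx) (lintegral_mono_set hWy)
    _ ≤ _ := add_le_add (setLIntegral_enorm_sub_le_maximal μ hf x hr0)
        (setLIntegral_enorm_sub_le_maximal μ hf y hr0)
    _ = _ := by
        rw [hball, hball, h4, ← ofReal_norm (x - y), ← hr]
        ring

end MaximalBounds

/-! ### Mollification and weak gradients -/

section

variable {d : ℕ}

/-- The bump function at scale `2⁻ⁿ`: equal to `1` on the ball of radius `2⁻ⁿ` and supported in the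
ball of radius `2 · 2⁻ⁿ`. -/
noncomputable def bump (d n : ℕ) : ContDiffBump (0 : EuclideanSpace ℝ (Fin d)) where
  rIn := (1 / 2) ^ n
  rOut := 2 * (1 / 2) ^ n
  rIn_pos := by positivity
  rIn_lt_rOut := by linarith [show (0 : ℝ) < (1 / 2) ^ n by positivity]

/-- The standard mollifier at scale `2⁻ⁿ`: smooth, even, nonnegative, with integral `1`. -/
noncomputable def mollifier (d n : ℕ) : EuclideanSpace ℝ (Fin d) → ℝ :=
  (bump d n).normed volume

theorem bump_rOut_pos (d n : ℕ) : 0 < (bump d n).rOut := (bump d n).rOut_pos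

theorem tendsto_bump_rOut (d : ℕ) : Tendsto (fun n => (bump d n).rOut) atTop (𝓝 0) := by
  have h := (tendsto_pow_atTop_nhds_zero_of_lt_one (r := (1 / 2 : ℝ)) (by norm_num)
    (by norm_num)).const_mul 2
  rwa [mul_zero] at h

theorem mollifier_nonneg (n : ℕ) (z : EuclideanSpace ℝ (Fin d)) : 0 ≤ mollifier d n z :=
  (bump d n).nonneg_normed z

theorem mollifier_neg (n : ℕ) (z : EuclideanSpace ℝ (Fin d)) :
    mollifier d n (-z) = mollifier d n z :=
  (bump d n).normed_neg z

theorem contDiff_mollifier (n : ℕ) {m : ℕ∞} : ContDiff ℝ m (mollifier d n) :=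
  (bump d n).contDiff_normed

theorem continuous_mollifier (n : ℕ) : Continuous (mollifier d n) :=
  (bump d n).continuous_normed

theorem hasCompactSupport_mollifier (n : ℕ) : HasCompactSupport (mollifier d n) :=
  (bump d n).hasCompactSupport_normed

theorem mollifier_eq_zero {n : ℕ} {z : EuclideanSpace ℝ (Fin d)}
    (hz : z ∉ closedBall 0 (bump d n).rOut) : mollifier d n z = 0 := by
  rw [← Function.notMem_support, mollifier, (bump d n).support_normed_eq]
  exact fun h => hz (ball_subset_closedBall h)

theorem ofReal_mollifier_le (n : ℕ) (z : EuclideanSpace ℝ (Fin d)) :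
    ENNReal.ofReal (mollifier d n z) ≤
      2 ^ d * (volume (closedBall (0 : EuclideanSpace ℝ (Fin d)) (bump d n).rOut))⁻¹ := by
  have h := (bump d n).normed_le_div_measure_closedBall_rOut volume 2 (le_refl _) z
  have hpos : 0 < volume.real (closedBall (0 : EuclideanSpace ℝ (Fin d)) (bump d n).rOut) :=
    ENNReal.toReal_pos (measure_closedBall_pos _ _ (bump_rOut_pos d n)).ne'
      (measure_closedBall_ne_top _ _ _)
  refine (ENNReal.ofReal_le_ofReal h).trans (le_of_eq ?_)
  rw [ENNReal.ofReal_div_of_pos hpos, Measure.real,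
    ENNReal.ofReal_toReal (measure_closedBall_ne_top _ _ _), finrank_euclideanSpace_fin,
    ENNReal.ofReal_pow (by norm_num), div_eq_mul_inv]
  simp

theorem bump_apply (n : ℕ) (z : EuclideanSpace ℝ (Fin d)) :
    bump d n z = bump d 0 (((2 : ℝ) ^ n) • z) := by
  rw [ContDiffBump.apply, ContDiffBump.apply]
  simp [bump]

theorem exists_norm_fderiv_bump_zero_le (d : ℕ) :
    ∃ K : ℝ, 0 ≤ K ∧ ∀ z, ‖fderiv ℝ (bump d 0) z‖ ≤ K := by
  obtain ⟨K, hK⟩ := ((bump d 0).hasCompactSupport.fderiv ℝ).exists_bound_of_continuous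
    ((bump d 0).contDiff.continuous_fderiv (n := 1) one_ne_zero)
  exact ⟨K, (norm_nonneg _).trans (hK 0), hK⟩

/-- The scaling bound `|z| |∇η_n(z)| ≲ |B(0, ρ_n)|⁻¹` on the gradient of the mollifier, with a
constant independent of `n`. -/
theorem exists_norm_mul_norm_fderiv_mollifier_le (d : ℕ) :
    ∃ K : ℝ≥0, ∀ (n : ℕ) (z : EuclideanSpace ℝ (Fin d)),
      ‖fderiv ℝ (mollifier d n) z‖ₑ * ‖z‖ₑ ≤ (closedBall 0 (bump d n).rOut).indicator
        (fun _ => K * (volume (closedBall (0 : EuclideanSpace ℝ (Fin d)) (bump d n).rOut))⁻¹) z :=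
        by
  obtain ⟨K, hK0, hK⟩ := exists_norm_fderiv_bump_zero_le d
  refine ⟨(2 * K * 2 ^ d).toNNReal, fun n z => ?_⟩
  by_cases hz : z ∈ closedBall (0 : EuclideanSpace ℝ (Fin d)) (bump d n).rOut
  swap
  · have hz' : z ∉ tsupport (mollifier d n) := by
      rwa [mollifier, (bump d n).tsupport_normed_eq]
    rw [indicator_of_notMem hz, fderiv_of_notMem_tsupport (𝕜 := ℝ) hz', ← ofReal_norm, norm_zero,
      ENNReal.ofReal_zero, zero_mul]
  rw [indicator_of_mem hz]
  have hzn : ‖z‖ ≤ 2 * (1 / 2) ^ n := by simpa [bump] using hz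
  set V := volume.real (closedBall (0 : EuclideanSpace ℝ (Fin d)) (bump d n).rOut) with hV
  have hVpos : 0 < V :=
    ENNReal.toReal_pos (measure_closedBall_pos _ _ (bump_rOut_pos d n)).ne'
      (measure_closedBall_ne_top _ _ _)
  have hI : V / 2 ^ d ≤ ∫ x, bump d n x := by
    have := (bump d n).measure_closedBall_div_le_integral volume 2 (le_refl _)
    rwa [finrank_euclideanSpace_fin] at this
  have hIpos : 0 < ∫ x, bump d n x := (bump d n).integral_pos
  have hfd : fderiv ℝ (mollifier d n) z =
      ((∫ x, bump d n x)⁻¹ * 2 ^ n) • fderiv ℝ (bump d 0) ((2 : ℝ) ^ n • z) := by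
    have h0 : HasFDerivAt (bump d 0) (fderiv ℝ (bump d 0) ((2 : ℝ) ^ n • z)) ((2 : ℝ) ^ n • z) :=
      (((bump d 0).contDiff (n := 1)).differentiable one_ne_zero).differentiableAt.hasFDerivAt
    have h1 : HasFDerivAt (fun z : EuclideanSpace ℝ (Fin d) => (2 : ℝ) ^ n • z)
        ((2 : ℝ) ^ n • ContinuousLinearMap.id ℝ _) z :=
      ((2 : ℝ) ^ n • ContinuousLinearMap.id ℝ (EuclideanSpace ℝ (Fin d))).hasFDerivAt
    have h2 := (h0.comp z h1).const_mul (∫ x, bump d n x)⁻¹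
    have h3 : mollifier d n = fun z => (∫ x, bump d n x)⁻¹ * (bump d 0 ∘ fun z => (2 : ℝ) ^ n • z) z
        := by
      funext z
      rw [mollifier, ContDiffBump.normed_def, bump_apply n z, div_eq_inv_mul]
      rfl
    rw [h3, h2.fderiv]
    ext v
    simp [mul_assoc]
  have hreal : ‖fderiv ℝ (mollifier d n) z‖ * ‖z‖ ≤ (2 * K * 2 ^ d) / V := by
    rw [hfd, norm_smul, Real.norm_of_nonneg (by positivity)]
    have hinv : (∫ x, bump d n x)⁻¹ ≤ 2 ^ d / V := by
      rw [← inv_div]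
      exact inv_anti₀ (by positivity) hI
    calc (∫ x, bump d n x)⁻¹ * 2 ^ n * ‖fderiv ℝ (bump d 0) ((2 : ℝ) ^ n • z)‖ * ‖z‖
        ≤ (2 ^ d / V) * 2 ^ n * K * (2 * (1 / 2) ^ n) := by
          gcongr
          exact hK _
      _ = (2 * K * 2 ^ d) / V * (2 * (1 / 2)) ^ n := by rw [mul_pow]; ring
      _ = _ := by norm_num
  rw [← ofReal_norm, ← ofReal_norm, ← ENNReal.ofReal_mul (norm_nonneg _)]
  refine (ENNReal.ofReal_le_ofReal hreal).trans (le_of_eq ?_)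
  rw [ENNReal.ofReal_div_of_pos hVpos, hV, Measure.real,
    ENNReal.ofReal_toReal (measure_closedBall_ne_top _ _ _), div_eq_mul_inv]
  rfl

/-- The mollification of `f` at scale `2⁻ⁿ`. -/
noncomputable def mollify {F : Type*} [NormedAddCommGroup F] [NormedSpace ℝ F] (n : ℕ)
    (f : EuclideanSpace ℝ (Fin d) → F) : EuclideanSpace ℝ (Fin d) → F :=
  mollifier d n ⋆[ContinuousLinearMap.lsmul ℝ ℝ, volume] f

section Mollify

variable {F : Type*} [NormedAddCommGroup F] [NormedSpace ℝ F] {n : ℕ}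

theorem mollify_apply (f : EuclideanSpace ℝ (Fin d) → F) (x : EuclideanSpace ℝ (Fin d)) :
    mollify n f x = ∫ y, mollifier d n (x - y) • f y :=
  convolution_lsmul_swap

theorem contDiff_mollify {f : EuclideanSpace ℝ (Fin d) → F} [CompleteSpace F]
    (hf : LocallyIntegrable f volume) : ContDiff ℝ 1 (mollify n f) :=
  (hasCompactSupport_mollifier n).contDiff_convolution_left (n := 1) _ (contDiff_mollifier n) hf

theorem fderiv_mollify_apply [CompleteSpace F] {f : EuclideanSpace ℝ (Fin d) → F}
    (hf : LocallyIntegrable f volume) (x v : EuclideanSpace ℝ (Fin d)) :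
    fderiv ℝ (mollify n f) x v = ∫ y, fderiv ℝ (mollifier d n) (x - y) v • f y := by
  have hc : Continuous (fderiv ℝ (mollifier d n)) :=
    (contDiff_mollifier (m := 1) n).continuous_fderiv one_ne_zero
  have h := (hasCompactSupport_mollifier (d := d) n).hasFDerivAt_convolution_left
    (ContinuousLinearMap.lsmul ℝ ℝ) (contDiff_mollifier (m := 1) n) hf x
  have hex := ((hasCompactSupport_mollifier (d := d) n).fderiv ℝ).convolutionExists_left
    ((ContinuousLinearMap.lsmul ℝ ℝ : ℝ →L[ℝ] F →L[ℝ] F).precompL (EuclideanSpace ℝ (Fin d)))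
    hc hf x
  rw [mollify, h.fderiv, convolution_eq_swap,
    ContinuousLinearMap.integral_apply hex.integrable_swap]
  rfl

theorem ae_tendsto_mollify [CompleteSpace F] {f : EuclideanSpace ℝ (Fin d) → F}
    (hf : LocallyIntegrable f volume) :
    ∀ᵐ x, Tendsto (fun n => mollify n f x) atTop (𝓝 (f x)) :=
  ContDiffBump.ae_convolution_tendsto_right_of_locallyIntegrable (φ := bump d) (K := 2)
    (tendsto_bump_rOut d) (Eventually.of_forall fun _ => le_refl _) hf

theorem tendsto_mollify_of_continuous [CompleteSpace F] {f : EuclideanSpace ℝ (Fin d) → F}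
    (hf : Continuous f) (x : EuclideanSpace ℝ (Fin d)) :
    Tendsto (fun n => mollify n f x) atTop (𝓝 (f x)) :=
  ContDiffBump.convolution_tendsto_right_of_continuous (φ := bump d) (tendsto_bump_rOut d) hf x

end Mollify

section WeakGradient

variable {f : EuclideanSpace ℝ (Fin d) → EuclideanSpace ℝ (Fin d)}
  {G : EuclideanSpace ℝ (Fin d) → EuclideanSpace ℝ (Fin d) →L[ℝ] EuclideanSpace ℝ (Fin d)}

theorem HasWeakGradient.congr_ae {f' : EuclideanSpace ℝ (Fin d) → EuclideanSpace ℝ (Fin d)}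
    {G' : EuclideanSpace ℝ (Fin d) → EuclideanSpace ℝ (Fin d) →L[ℝ] EuclideanSpace ℝ (Fin d)}
    (h : HasWeakGradient f G) (hf : f =ᵐ[volume] f') (hG : G =ᵐ[volume] G') :
    HasWeakGradient f' G' where
  locallyIntegrable := h.locallyIntegrable.congr hf
  locallyIntegrable_grad := h.locallyIntegrable_grad.congr hG
  integral_eq φ hφ v := by
    have h1 : ∫ x, fderiv ℝ φ x v • f' x = ∫ x, fderiv ℝ φ x v • f x :=
      integral_congr_ae (hf.mono fun x hx => by simp only [hx])
    have h2 : ∫ x, φ x • G' x v = ∫ x, φ x • G x v :=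
      integral_congr_ae (hG.mono fun x hx => by simp only [hx])
    rw [h1, h2, h.integral_eq φ hφ v]

/-- Mollification commutes with the weak gradient. -/
theorem HasWeakGradient.fderiv_mollify (h : HasWeakGradient f G) (n : ℕ)
    (x v : EuclideanSpace ℝ (Fin d)) :
    fderiv ℝ (mollify n f) x v = ∫ y, mollifier d n (x - y) • G y v := by
  have hφ : IsTestFunction fun y => mollifier d n (x - y) := by
    refine ⟨(contDiff_mollifier n).comp (contDiff_const.sub contDiff_id), ?_⟩
    exact (hasCompactSupport_mollifier n).comp_homeomorph (Homeomorph.subLeft x)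
  have hd : ∀ y, fderiv ℝ (fun y => mollifier d n (x - y)) y v =
      - fderiv ℝ (mollifier d n) (x - y) v := by
    intro y
    have h0 : HasFDerivAt (mollifier d n) (fderiv ℝ (mollifier d n) (x - y)) (x - y) :=
      ((contDiff_mollifier (m := 1) n).differentiable one_ne_zero).differentiableAt.hasFDerivAt
    have h1 : HasFDerivAt (fun y : EuclideanSpace ℝ (Fin d) => x - y)
        (-ContinuousLinearMap.id ℝ _) y := (hasFDerivAt_id y).const_sub x
    have h2 := h0.comp y h1
    have h3 : fderiv ℝ (fun y => mollifier d n (x - y)) y = _ := h2.fderiv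
    rw [h3]
    simp
  have := h.integral_eq _ hφ v
  simp only [hd, neg_smul, integral_neg, neg_inj] at this
  rw [fderiv_mollify_apply h.locallyIntegrable, this]

theorem HasWeakGradient.enorm_fderiv_mollify_le (h : HasWeakGradient f G) (n : ℕ)
    (x : EuclideanSpace ℝ (Fin d)) :
    ‖fderiv ℝ (mollify n f) x‖ₑ ≤ 2 ^ d *
      ((volume (closedBall (0 : EuclideanSpace ℝ (Fin d)) (bump d n).rOut))⁻¹ *
        ∫⁻ y in closedBall x (bump d n).rOut, ‖G y‖ₑ) := by
  refine ContinuousLinearMap.opENorm_le_bound _ fun v => ?_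
  rw [h.fderiv_mollify]
  have ht : 2 ^ d * (volume (closedBall (0 : EuclideanSpace ℝ (Fin d)) (bump d n).rOut))⁻¹ ≠ ∞ :=
    ENNReal.mul_ne_top (by finiteness)
      (ENNReal.inv_ne_top.2 (measure_closedBall_pos _ _ (bump_rOut_pos d n)).ne')
  rw [← mul_assoc, ← lintegral_const_mul' _ _ ht, ← lintegral_mul_const' _ _ enorm_ne_top]
  refine (enorm_integral_le_lintegral_enorm _).trans ?_
  rw [← lintegral_indicator measurableSet_closedBall]
  refine lintegral_mono fun y => ?_
  by_cases hy : y ∈ closedBall x (bump d n).rOut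
  · rw [indicator_of_mem hy, enorm_smul, Real.enorm_of_nonneg (mollifier_nonneg _ _), mul_assoc]
    gcongr
    · exact ofReal_mollifier_le n _
    · exact ContinuousLinearMap.le_opENorm _ _
  · rw [indicator_of_notMem hy, mollifier_eq_zero]
    · simp
    · rw [mem_closedBall, dist_eq_norm, norm_sub_rev] at hy
      simpa using hy

/-- The pointwise inequality for Sobolev vector fields, valid at every pair of points at which the
mollifications converge. -/
theorem HasWeakGradient.enorm_sub_le_maximal (h : HasWeakGradient f G)
    (hG : Measurable fun y => ‖G y‖ₑ) {x y : EuclideanSpace ℝ (Fin d)}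
    (hx : Tendsto (fun n => mollify n f x) atTop (𝓝 (f x)))
    (hy : Tendsto (fun n => mollify n f y) atTop (𝓝 (f y))) :
    ‖f x - f y‖ₑ ≤ 32 ^ d * ‖x - y‖ₑ *
      (maximal volume (fun y => ‖G y‖ₑ) x + maximal volume (fun y => ‖G y‖ₑ) y) := by
  have hmax : ∀ n x, maximal volume (fun y => ‖fderiv ℝ (mollify n f) y‖ₑ) x ≤
      2 ^ d * (4 ^ d * maximal volume (fun y => ‖G y‖ₑ) x) := by
    intro n x
    refine (maximal_mono _ (h.enorm_fderiv_mollify_le n) x).trans ?_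
    rw [maximal_const_mul _ (by finiteness)]
    gcongr
    refine (maximal_average_le volume hG x (bump_rOut_pos d n)).trans (le_of_eq ?_)
    rw [finrank_euclideanSpace_fin]
  refine le_of_tendsto (hx.sub hy).enorm (Eventually.of_forall fun n => ?_)
  refine (ContDiff.enorm_sub_le_maximal volume (contDiff_mollify h.locallyIntegrable) x y).trans ?_
  rw [finrank_euclideanSpace_fin]
  calc _ ≤ 4 ^ d * ‖x - y‖ₑ * (2 ^ d * (4 ^ d * maximal volume (fun y => ‖G y‖ₑ) x) +
        2 ^ d * (4 ^ d * maximal volume (fun y => ‖G y‖ₑ) y)) := by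
        gcongr
        · exact hmax n x
        · exact hmax n y
    _ = (4 * 2 * 4) ^ d * ‖x - y‖ₑ * (maximal volume (fun y => ‖G y‖ₑ) x +
        maximal volume (fun y => ‖G y‖ₑ) y) := by rw [mul_pow, mul_pow]; ring
    _ = _ := by norm_num

end WeakGradient

end

/-! ### Curves with integrable velocity -/

theorem AbsolutelyContinuousOnInterval.of_dist_le {Y Z : Type*} [PseudoMetricSpace Y]
    [PseudoMetricSpace Z] {f : ℝ → Y} {h : ℝ → Z} {a b K : ℝ}
    (hh : AbsolutelyContinuousOnInterval h a b)
    (hfh : ∀ s ∈ uIcc a b, ∀ t ∈ uIcc a b, dist (f s) (f t) ≤ K * dist (h s) (h t)) :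
    AbsolutelyContinuousOnInterval f a b := by
  have h0 := Tendsto.const_mul K hh
  rw [mul_zero] at h0
  refine squeeze_zero' (Eventually.of_forall fun _ => Finset.sum_nonneg fun _ _ => dist_nonneg) ?_
    h0
  refine Filter.eventually_inf_principal.2 (Eventually.of_forall fun I hI => ?_)
  rw [Finset.mul_sum]
  exact Finset.sum_le_sum fun i hi => hfh _ (hI.1 i hi).1 _ (hI.1 i hi).2

/-- The chain rule, in integrated form, for a `C¹` function along an absolutely continuous curve. -/
theorem sub_eq_integral_fderiv_of_eq_integral {E : Type*} [NormedAddCommGroup E] [NormedSpace ℝ E]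
    [FiniteDimensional ℝ E] {F : E → ℝ} (hF : ContDiff ℝ 1 F) {γ v : ℝ → E} {T : ℝ} (hT : 0 ≤ T)
    (hv : IntervalIntegrable v volume 0 T)
    (hγ : ∀ t ∈ Icc 0 T, γ t = γ 0 + ∫ s in (0 : ℝ)..t, v s) :
    F (γ T) - F (γ 0) = ∫ s in (0 : ℝ)..T, fderiv ℝ F (γ s) (v s) := by
  have : CompleteSpace E := FiniteDimensional.complete ℝ E
  set c : ℝ → E := fun t => γ 0 + ∫ s in (0 : ℝ)..t, v s with hc
  have hu : uIcc 0 T = Icc 0 T := uIcc_of_le hT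
  have h0mem : (0 : ℝ) ∈ uIcc 0 T := left_mem_uIcc
  have hcont : ContinuousOn c (uIcc 0 T) :=
    continuousOn_const.add (intervalIntegral.continuousOn_primitive_interval' hv h0mem)
  have hh := hv.norm.absolutelyContinuousOnInterval_intervalIntegral h0mem
  have hint : ∀ s ∈ uIcc 0 T, ∀ t ∈ uIcc 0 T, IntervalIntegrable v volume s t := fun s hs t ht =>
    hv.mono_set (uIcc_subset_uIcc hs ht)
  have hdist : ∀ s ∈ uIcc 0 T, ∀ t ∈ uIcc 0 T, dist (c s) (c t) ≤
      dist (∫ r in (0 : ℝ)..s, ‖v r‖) (∫ r in (0 : ℝ)..t, ‖v r‖) := by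
    intro s hs t ht
    rw [dist_comm (c s), dist_comm (∫ r in (0 : ℝ)..s, ‖v r‖), dist_eq_norm, Real.dist_eq, hc]
    simp only [add_sub_add_left_eq_sub]
    rw [intervalIntegral.integral_interval_sub_left (hint 0 h0mem t ht) (hint 0 h0mem s hs),
      intervalIntegral.integral_interval_sub_left (hint 0 h0mem t ht).norm (hint 0 h0mem s hs).norm]
    exact intervalIntegral.norm_integral_le_abs_integral_norm
  obtain ⟨R, hR⟩ := (isCompact_uIcc.image_of_continuousOn hcont).isBounded.subset_closedBall 0
  obtain ⟨K, hK⟩ := (isCompact_closedBall (0 : E) R).exists_bound_of_continuousOn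
    (hF.continuous_fderiv one_ne_zero).continuousOn
  have hac : AbsolutelyContinuousOnInterval (F ∘ c) 0 T := by
    refine AbsolutelyContinuousOnInterval.of_dist_le (K := max K 0) hh fun s hs t ht => ?_
    refine le_trans ?_ (mul_le_mul_of_nonneg_left (hdist s hs t ht) (le_max_right K 0))
    rw [dist_comm, dist_comm (c s), dist_eq_norm, dist_eq_norm]
    exact (convex_closedBall (0 : E) R).norm_image_sub_le_of_norm_fderiv_le
      (fun x _ => (hF.differentiable one_ne_zero).differentiableAt)
      (fun x hx => (hK x hx).trans (le_max_left _ _)) (hR (mem_image_of_mem c hs))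
      (hR (mem_image_of_mem c ht))
  have hcγ : ∀ t ∈ Icc 0 T, c t = γ t := fun t ht => (hγ t ht).symm
  have hFTC := hac.integral_deriv_eq_sub
  simp only [Function.comp, hcγ T (right_mem_Icc.2 hT), hcγ 0 (left_mem_Icc.2 hT)] at hFTC
  rw [← hFTC]
  refine intervalIntegral.integral_congr_ae ?_
  filter_upwards [hv.ae_hasDerivAt_integral] with t ht htT
  have htu : t ∈ uIcc 0 T := uIoc_subset_uIcc htT
  have hd : HasDerivAt c (v t) t := (ht htu 0 h0mem).const_add _
  have h1 : HasFDerivAt F (fderiv ℝ F (c t)) (c t) :=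
    (hF.differentiable one_ne_zero).differentiableAt.hasFDerivAt
  rw [← hcγ t (hu ▸ htu)]
  exact (h1.comp_hasDerivAt t hd).deriv

section Log

variable {E : Type*} [NormedAddCommGroup E] [InnerProductSpace ℝ E]

theorem contDiff_log_add_norm_sq {δ : ℝ} (hδ : 0 < δ) :
    ContDiff ℝ 1 fun z : E => Real.log (δ + ‖z‖ ^ 2) :=
  (contDiff_const.add (contDiff_norm_sq ℝ)).log fun z => by positivity

theorem enorm_fderiv_log_le {δ : ℝ} (hδ : 0 < δ) {z w : E} {m : ℝ≥0∞} (h : ‖w‖ₑ ≤ m * ‖z‖ₑ) :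
    ‖fderiv ℝ (fun z : E => Real.log (δ + ‖z‖ ^ 2)) z w‖ₑ ≤ 2 * m := by
  have hpos : 0 < δ + ‖z‖ ^ 2 := by positivity
  induction m with
  | top => simp
  | coe m =>
    have hreal : ‖w‖ ≤ m * ‖z‖ := by
      rw [← ofReal_norm, ← ofReal_norm, ← ENNReal.ofReal_coe_nnreal,
        ← ENNReal.ofReal_mul m.coe_nonneg] at h
      exact (ENNReal.ofReal_le_ofReal_iff (by positivity)).1 h
    have hd : HasFDerivAt (fun z : E => Real.log (δ + ‖z‖ ^ 2))
        ((δ + ‖z‖ ^ 2)⁻¹ • (2 • (innerSL ℝ z))) z :=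
      ((hasStrictFDerivAt_norm_sq z).hasFDerivAt.const_add δ).log hpos.ne'
    have hval : ‖fderiv ℝ (fun z : E => Real.log (δ + ‖z‖ ^ 2)) z w‖ ≤ 2 * m := by
      rw [hd.fderiv]
      simp only [smul_apply, innerSL_apply_apply, smul_eq_mul, norm_mul,
        norm_inv, nsmul_eq_mul, Nat.cast_ofNat, Real.norm_ofNat]
      rw [Real.norm_of_nonneg hpos.le, inv_mul_le_iff₀ hpos]
      have h1 : ‖⟪z, w⟫_ℝ‖ ≤ ‖z‖ * (m * ‖z‖) := (norm_inner_le_norm z w).trans (by gcongr)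
      have h2 : 0 ≤ δ * m := by positivity
      nlinarith
    rw [← ofReal_norm, ← ENNReal.ofReal_coe_nnreal, ← ENNReal.ofReal_ofNat 2,
      ← ENNReal.ofReal_mul (by norm_num)]
    exact ENNReal.ofReal_le_ofReal hval

theorem le_exp_mul_of_log_le {a b A : ℝ} (hb : 0 ≤ b)
    (h : ∀ δ > 0, Real.log (δ + a ^ 2) - Real.log (δ + b ^ 2) ≤ 2 * A) : a ≤ Real.exp A * b := by
  have h1 : ∀ δ > 0, δ + a ^ 2 ≤ Real.exp (2 * A) * (δ + b ^ 2) := by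
    intro δ hδ
    have hpa : 0 < δ + a ^ 2 := by positivity
    have hpb : 0 < δ + b ^ 2 := by positivity
    have h2 := h δ hδ
    rw [← Real.log_div hpa.ne' hpb.ne', Real.log_le_iff_le_exp (by positivity),
      div_le_iff₀ hpb] at h2
    exact h2
  have h3 : a ^ 2 ≤ Real.exp (2 * A) * b ^ 2 := by
    have hl : Tendsto (fun δ : ℝ => δ + a ^ 2) (𝓝[>] 0) (𝓝 (0 + a ^ 2)) :=
      ((continuous_id.add continuous_const).tendsto 0).mono_left nhdsWithin_le_nhds
    have hr : Tendsto (fun δ : ℝ => Real.exp (2 * A) * (δ + b ^ 2)) (𝓝[>] 0)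
        (𝓝 (Real.exp (2 * A) * (0 + b ^ 2))) :=
      ((continuous_const.mul (continuous_id.add continuous_const)).tendsto 0).mono_left
        nhdsWithin_le_nhds
    have := le_of_tendsto_of_tendsto hl hr (eventually_mem_nhdsWithin.mono fun δ hδ => h1 δ hδ)
    simpa using this
  refine le_of_sq_le_sq ?_ (by positivity)
  rw [mul_pow, ← Real.exp_nat_mul]
  exact_mod_cast h3

/-- A logarithmic Grönwall inequality, two-sided: a curve whose speed is at most `m` times its
distance to the origin changes this distance by at most the factor `exp (∫ m)`. The regularisation
`log (δ + |z|²)`, with `δ → 0`, avoids the singularity of the logarithm at the origin. -/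
theorem norm_le_exp_mul_norm [FiniteDimensional ℝ E] {γ v : ℝ → E} {T : ℝ} (hT : 0 ≤ T)
    (hv : IntervalIntegrable v volume 0 T) (hγ : ∀ t ∈ Icc 0 T, γ t = γ 0 + ∫ s in (0 : ℝ)..t, v s)
    {m : ℝ → ℝ≥0∞} (hm : ∀ᵐ s ∂(volume.restrict (Icc 0 T)), ‖v s‖ₑ ≤ m s * ‖γ s‖ₑ)
    (hfin : ∫⁻ s in Icc 0 T, m s ≠ ∞) :
    ‖γ T‖ ≤ Real.exp (∫⁻ s in Icc 0 T, m s).toReal * ‖γ 0‖ ∧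
      ‖γ 0‖ ≤ Real.exp (∫⁻ s in Icc 0 T, m s).toReal * ‖γ T‖ := by
  have key : ∀ δ > 0, |Real.log (δ + ‖γ T‖ ^ 2) - Real.log (δ + ‖γ 0‖ ^ 2)| ≤
      2 * (∫⁻ s in Icc 0 T, m s).toReal := by
    intro δ hδ
    rw [sub_eq_integral_fderiv_of_eq_integral (contDiff_log_add_norm_sq hδ) hT hv hγ,
      intervalIntegral.integral_of_le hT, ← integral_Icc_eq_integral_Ioc, ← Real.norm_eq_abs,
      ← toReal_enorm, ← ENNReal.toReal_ofNat, ← ENNReal.toReal_mul]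
    refine ENNReal.toReal_mono (by finiteness) ?_
    refine (enorm_integral_le_lintegral_enorm _).trans ?_
    rw [← lintegral_const_mul' _ _ (by simp)]
    exact lintegral_mono_ae (hm.mono fun s hs => enorm_fderiv_log_le hδ hs)
  exact ⟨le_exp_mul_of_log_le (norm_nonneg _)
      fun δ hδ => (le_abs_self _).trans (key δ hδ),
    le_exp_mul_of_log_le (norm_nonneg _)
      fun δ hδ => (le_abs_self _).trans (abs_sub_comm (Real.log (δ + ‖γ T‖ ^ 2)) _ ▸ key δ hδ)⟩

end Log

/-! ### Minkowski's integral inequality -/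

section Minkowski

variable {α S : Type*} [MeasurableSpace α] [MeasurableSpace S] {μ : Measure α} {ν : Measure S}

/-- Minkowski's integral inequality for a function `H` below the integral, with finite `L^r` norm:
Hölder's inequality against `H ^ (r - 1)`, and division by `(∫ H ^ r) ^ (1 - 1 / r)`. -/
theorem lintegral_rpow_le_of_le_lintegral [SFinite μ] [SFinite ν] {F : S → α → ℝ≥0∞}
    (hF : Measurable (Function.uncurry F)) {r : ℝ} (hr : 1 < r) {H : α → ℝ≥0∞} (hH : Measurable H)
    (hHF : ∀ x, H x ≤ ∫⁻ s, F s x ∂ν) (hfin : ∫⁻ x, H x ^ r ∂μ ≠ ∞) :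
    (∫⁻ x, H x ^ r ∂μ) ^ (1 / r) ≤ ∫⁻ s, (∫⁻ x, F s x ^ r ∂μ) ^ (1 / r) ∂ν := by
  have hr0 : 0 < r := by linarith
  have hr1 : 0 < r - 1 := by linarith
  set I := ∫⁻ x, H x ^ r ∂μ with hI
  rcases eq_or_ne I 0 with h0 | h0
  · rw [h0, ENNReal.zero_rpow_of_pos (by positivity)]
    exact zero_le
  have hq : r.HolderConjugate (r / (r - 1)) := Real.HolderConjugate.conjExponent hr
  have hsplit : ∀ x, H x ^ r = H x * H x ^ (r - 1) := fun x => by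
    conv_lhs => rw [← sub_add_cancel r 1, ENNReal.rpow_add_of_nonneg _ _ hr1.le zero_le_one,
      ENNReal.rpow_one, mul_comm]
  have hle : I ≤ (∫⁻ s, (∫⁻ x, F s x ^ r ∂μ) ^ (1 / r) ∂ν) * I ^ (1 / (r / (r - 1))) := by
    calc I ≤ ∫⁻ x, (∫⁻ s, F s x ∂ν) * H x ^ (r - 1) ∂μ := by
          refine lintegral_mono fun x => ?_
          rw [hsplit]
          gcongr
          exact hHF x
      _ = ∫⁻ x, ∫⁻ s, F s x * H x ^ (r - 1) ∂ν ∂μ := by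
          refine lintegral_congr fun x => ?_
          rw [lintegral_mul_const]
          exact hF.comp measurable_prodMk_right
      _ = ∫⁻ s, ∫⁻ x, F s x * H x ^ (r - 1) ∂μ ∂ν := by
          rw [lintegral_lintegral_swap]
          exact ((hF.comp measurable_swap).mul
            ((hH.comp measurable_fst).pow_const _)).aemeasurable
      _ ≤ ∫⁻ s, (∫⁻ x, F s x ^ r ∂μ) ^ (1 / r) * I ^ (1 / (r / (r - 1))) ∂ν := by
          refine lintegral_mono fun s => ?_
          refine (ENNReal.lintegral_mul_le_Lp_mul_Lq μ hq
            (hF.comp measurable_prodMk_left).aemeasurable (hH.pow_const _).aemeasurable).trans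
            (le_of_eq ?_)
          congr 2
          refine lintegral_congr fun x => ?_
          rw [← ENNReal.rpow_mul, mul_div_cancel₀ _ hr1.ne']
      _ = _ := by
          rw [lintegral_mul_const' _ _ (ENNReal.rpow_ne_top_of_nonneg (by positivity) hfin)]
  have hexp : I = I ^ (1 / r) * I ^ (1 / (r / (r - 1))) := by
    rw [← ENNReal.rpow_add_of_nonneg _ _ (by positivity) (by positivity)]
    have : 1 / r + 1 / (r / (r - 1)) = 1 := by field_simp; ring
    rw [this, ENNReal.rpow_one]
  conv_lhs at hle => rw [hexp]
  rwa [ENNReal.mul_le_mul_iff_left] at hle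
  · rw [ne_eq, ENNReal.rpow_eq_zero_iff]
    push Not
    exact ⟨fun h => absurd h h0, fun h => absurd h hfin⟩
  · exact ENNReal.rpow_ne_top_of_nonneg (by positivity) hfin

/-- Minkowski's integral inequality, by truncating the inner integral in height and in space so that
its `L^r` norm becomes finite. -/
theorem lintegral_lintegral_rpow_le [SigmaFinite μ] [SFinite ν] {F : S → α → ℝ≥0∞}
    (hF : Measurable (Function.uncurry F)) {r : ℝ} (hr : 1 < r) :
    (∫⁻ x, (∫⁻ s, F s x ∂ν) ^ r ∂μ) ^ (1 / r) ≤ ∫⁻ s, (∫⁻ x, F s x ^ r ∂μ) ^ (1 / r) ∂ν := by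
  have hr0 : 0 < r := by linarith
  set G : α → ℝ≥0∞ := fun x => ∫⁻ s, F s x ∂ν with hG
  have hGm : Measurable G := Measurable.lintegral_prod_left' hF
  set H : ℕ → α → ℝ≥0∞ := fun n => (spanningSets μ n).indicator fun x => min (G x) n with hH
  have hHm : ∀ n, Measurable (H n) := fun n =>
    (hGm.min measurable_const).indicator (measurableSet_spanningSets μ n)
  have hmono : Monotone H := by
    intro n n' h x
    simp only [hH]
    refine (indicator_le_indicator_of_subset (monotone_spanningSets μ h) (fun _ => zero_le) x).trans
      (indicator_le_indicator ?_)
    gcongr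
  have hsup : ∀ x, ⨆ n, H n x = G x := by
    intro x
    refine le_antisymm (iSup_le fun n => (indicator_le_self _ _ x).trans (min_le_left _ _)) ?_
    refine le_of_forall_lt fun c hc => ?_
    obtain ⟨k, hk⟩ := ENNReal.exists_nat_gt hc.ne_top
    set n := max k (spanningSetsIndex μ x)
    have hx : x ∈ spanningSets μ n :=
      monotone_spanningSets μ (le_max_right _ _) (mem_spanningSetsIndex μ x)
    refine lt_of_lt_of_le ?_ (le_iSup (fun n => H n x) n)
    simp only [hH, indicator_of_mem hx]
    refine lt_min hc (hk.trans_le ?_)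
    exact_mod_cast le_max_left _ _
  have hlim : ∫⁻ x, G x ^ r ∂μ = ⨆ n, ∫⁻ x, H n x ^ r ∂μ := by
    rw [← lintegral_iSup (fun n => (hHm n).pow_const r)
      (fun n n' h x => ENNReal.rpow_le_rpow (hmono h x) hr0.le)]
    refine lintegral_congr fun x => ?_
    rw [← hsup x]
    exact (ENNReal.orderIsoRpow r hr0).map_iSup _
  rw [hlim, ← ENNReal.le_rpow_inv_iff (by positivity)]
  · rw [one_div, inv_inv]
    refine iSup_le fun n => ?_
    have hfin : ∫⁻ x, H n x ^ r ∂μ ≠ ∞ := by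
      refine ne_top_of_le_ne_top (b := ∫⁻ x in spanningSets μ n, (n : ℝ≥0∞) ^ r ∂μ) ?_ ?_
      · rw [setLIntegral_const]
        exact ENNReal.mul_ne_top (ENNReal.rpow_ne_top_of_nonneg hr0.le (by simp))
          (measure_spanningSets_lt_top μ n).ne
      · rw [← lintegral_indicator (measurableSet_spanningSets μ n)]
        refine lintegral_mono fun x => ?_
        by_cases hx : x ∈ spanningSets μ n
        · simp only [hH, indicator_of_mem hx]
          exact ENNReal.rpow_le_rpow (min_le_right _ _) hr0.le
        · simp [hH, indicator_of_notMem hx, hr0]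
    have := lintegral_rpow_le_of_le_lintegral (ν := ν) hF hr (hHm n)
      (fun x => (le_iSup (fun n => H n x) n).trans (hsup x).le) hfin
    rwa [one_div, ENNReal.rpow_inv_le_iff hr0] at this

end Minkowski

/-! ### Measurable versions of a regular Lagrangian flow -/

section

variable {d : ℕ} {T L : ℝ} {p : ℝ≥0∞}
  {b X : ℝ → EuclideanSpace ℝ (Fin d) → EuclideanSpace ℝ (Fin d)}
  {D : ℝ → EuclideanSpace ℝ (Fin d) → EuclideanSpace ℝ (Fin d) →L[ℝ] EuclideanSpace ℝ (Fin d)}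

/-- The trajectories of a regular Lagrangian flow agree, off a null set, with a jointly measurable
map. -/
theorem IsRegularLagrangianFlow.exists_measurable (hT : 0 ≤ T)
    (hX : IsRegularLagrangianFlow T b X L) :
    ∃ (Y : ℝ → EuclideanSpace ℝ (Fin d) → EuclideanSpace ℝ (Fin d))
      (N : Set (EuclideanSpace ℝ (Fin d))), Measurable (Function.uncurry Y) ∧ MeasurableSet N ∧
      volume N = 0 ∧ ∀ x ∉ N, ∀ t ∈ Icc 0 T, X t x = Y t x ∧
        IntervalIntegrable (fun s => b s (X s x)) volume 0 t ∧
          X t x = x + ∫ s in (0 : ℝ)..t, b s (X s x) := by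
  have : Nonempty (Icc 0 T) := ⟨⟨0, left_mem_Icc.2 hT⟩⟩
  set q : ℕ → Icc 0 T := TopologicalSpace.denseSeq (Icc 0 T)
  have hqm : ∀ n, AEMeasurable (X (q n)) volume := fun n => (hX.compressibility _ (q n).2).1
  have hae : ∀ᵐ x : EuclideanSpace ℝ (Fin d), (∀ t ∈ Icc 0 T,
      IntervalIntegrable (fun s => b s (X s x)) volume 0 t ∧
        X t x = x + ∫ s in (0 : ℝ)..t, b s (X s x)) ∧ ∀ n, X (q n) x = (hqm n).mk (X (q n)) x :=
    hX.integral_eq.and (ae_all_iff.2 fun n => (hqm n).ae_eq_mk)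
  obtain ⟨N, hNsub, hNm, hN0⟩ := exists_measurable_superset_of_null (ae_iff.1 hae)
  have hN : ∀ x ∉ N, (∀ t ∈ Icc 0 T, IntervalIntegrable (fun s => b s (X s x)) volume 0 t ∧
        X t x = x + ∫ s in (0 : ℝ)..t, b s (X s x)) ∧ ∀ n, X (q n) x = (hqm n).mk (X (q n)) x := by
    intro x hx
    by_contra h
    exact hx (hNsub h)
  set Z : Icc 0 T → EuclideanSpace ℝ (Fin d) → EuclideanSpace ℝ (Fin d) :=
    fun t => Nᶜ.indicator (X t) with hZ
  have hZc : ∀ x, Continuous fun t => Z t x := by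
    intro x
    by_cases hx : x ∈ N
    · simp only [hZ, indicator_of_notMem (notMem_compl_iff.2 hx)]
      exact continuous_const
    · simp only [hZ, indicator_of_mem (mem_compl hx)]
      have h1 : ContinuousOn (fun t => x + ∫ s in (0 : ℝ)..t, b s (X s x)) (uIcc 0 T) :=
        continuousOn_const.add (intervalIntegral.continuousOn_primitive_interval'
          ((hN x hx).1 T (right_mem_Icc.2 hT)).1 left_mem_uIcc)
      rw [uIcc_of_le hT] at h1
      exact (continuousOn_iff_continuous_domRestrict.1 h1).congr fun t => ((hN x hx).1 t t.2).2.symm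
  have hZq : ∀ n, Measurable (Z (q n)) := by
    intro n
    have : Z (q n) = Nᶜ.indicator ((hqm n).mk (X (q n))) := by
      refine indicator_congr fun x hx => (hN x hx).2 n
    rw [this]
    exact (hqm n).measurable_mk.indicator hNm.compl
  have hZm : ∀ t, Measurable (Z t) := by
    intro t
    obtain ⟨u, hu, hut⟩ := mem_closure_iff_seq_limit.1
      (TopologicalSpace.denseRange_denseSeq (Icc 0 T) t)
    refine measurable_of_tendsto_metrizable (f := fun n => Z (u n)) (fun n => ?_)
      (tendsto_pi_nhds.2 fun x => ((hZc x).tendsto t).comp hut)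
    obtain ⟨k, hk⟩ := hu n
    rw [← hk]
    exact hZq k
  refine ⟨fun t => Z (projIcc 0 T hT t), N, ?_, hNm, hN0, fun x hx t ht => ⟨?_, (hN x hx).1 t ht⟩⟩
  · exact measurable_uncurry_of_continuous_of_measurable
      (fun x => (hZc x).comp continuous_projIcc) fun t => hZm _
  · simp only [hZ, indicator_of_mem (mem_compl hx), projIcc_of_mem hT ht]

/-- `β`, `G`, `Y` are jointly measurable representatives of a vector field `b`, of its weak gradient
`D` and of its flow `X`, and `N` is a null set off which all the trajectories behave well: they are
those of `Y`, they solve the integral equation for `β`, and at almost all times they sit at a point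
where the mollifications of `β` converge to `β`. -/
structure IsMeasurableVersion (T L : ℝ)
    (b X : ℝ → EuclideanSpace ℝ (Fin d) → EuclideanSpace ℝ (Fin d))
    (D : ℝ → EuclideanSpace ℝ (Fin d) → EuclideanSpace ℝ (Fin d) →L[ℝ] EuclideanSpace ℝ (Fin d))
    (β Y : ℝ → EuclideanSpace ℝ (Fin d) → EuclideanSpace ℝ (Fin d))
    (G : ℝ → EuclideanSpace ℝ (Fin d) → EuclideanSpace ℝ (Fin d) →L[ℝ] EuclideanSpace ℝ (Fin d))
    (N : Set (EuclideanSpace ℝ (Fin d))) : Prop where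
  stronglyMeasurable : StronglyMeasurable (Function.uncurry β)
  stronglyMeasurable_grad : StronglyMeasurable (Function.uncurry G)
  measurable_flow : Measurable (Function.uncurry Y)
  measurableSet : MeasurableSet N
  volume_eq_zero : volume N = 0
  ae_eq : ∀ᵐ s ∂(volume.restrict (Icc 0 T)), b s =ᵐ[volume] β s
  ae_eq_grad : ∀ᵐ s ∂(volume.restrict (Icc 0 T)), D s =ᵐ[volume] G s
  hasWeakGradient : ∀ᵐ s ∂(volume.restrict (Icc 0 T)), HasWeakGradient (β s) (G s)
  map_le : ∀ t ∈ Icc 0 T, Measure.map (Y t) volume ≤ ENNReal.ofReal L • volume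
  flow_eq : ∀ x ∉ N, ∀ t ∈ Icc 0 T, X t x = Y t x
  intervalIntegrable : ∀ x ∉ N, IntervalIntegrable (fun s => β s (Y s x)) volume 0 T
  integral_eq : ∀ x ∉ N, ∀ t ∈ Icc 0 T, Y t x = x + ∫ s in (0 : ℝ)..t, β s (Y s x)
  tendsto_mollify : ∀ x ∉ N, ∀ᵐ s ∂(volume.restrict (Icc 0 T)),
    Tendsto (fun n => mollify n (β s) (Y s x)) atTop (𝓝 (β s (Y s x)))

theorem measurable_mollify_uncurry {S : Type*} [MeasurableSpace S]
    {β : S → EuclideanSpace ℝ (Fin d) → EuclideanSpace ℝ (Fin d)}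
    (hβ : StronglyMeasurable (Function.uncurry β)) (n : ℕ) :
    Measurable fun z : S × EuclideanSpace ℝ (Fin d) => mollify n (β z.1) z.2 := by
  simp_rw [mollify_apply]
  refine (StronglyMeasurable.integral_prod_right' (f := fun w : (S × EuclideanSpace ℝ (Fin d)) ×
    EuclideanSpace ℝ (Fin d) => mollifier d n (w.1.2 - w.2) • β w.1.1 w.2) ?_).measurable
  have h1 : StronglyMeasurable fun w : (S × EuclideanSpace ℝ (Fin d)) × EuclideanSpace ℝ (Fin d) =>
      mollifier d n (w.1.2 - w.2) :=
    (continuous_mollifier n).stronglyMeasurable.comp_measurable (by fun_prop)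
  have h2 : StronglyMeasurable fun w : (S × EuclideanSpace ℝ (Fin d)) × EuclideanSpace ℝ (Fin d) =>
      β w.1.1 w.2 :=
    hβ.comp_measurable
      ((measurable_fst.comp measurable_fst).prodMk measurable_snd)
  exact h1.smul h2

theorem exists_isMeasurableVersion (hT : 0 ≤ T) (hb : MemL1Sobolev T p b D)
    (hX : IsRegularLagrangianFlow T b X L) :
    ∃ β Y G N, IsMeasurableVersion T L b X D β Y G N := by
  obtain ⟨Y, N₀, hYm, hN₀m, hN₀0, hN₀⟩ := hX.exists_measurable hT
  set ν := volume.restrict (Icc 0 T) with hν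
  set β : ℝ → EuclideanSpace ℝ (Fin d) → EuclideanSpace ℝ (Fin d) :=
    fun s x => hb.aestronglyMeasurable.mk _ (s, x) with hβ
  set G : ℝ → EuclideanSpace ℝ (Fin d) → EuclideanSpace ℝ (Fin d) →L[ℝ] EuclideanSpace ℝ (Fin d) :=
    fun s x => hb.aestronglyMeasurable_grad.mk _ (s, x) with hG
  have hβm : StronglyMeasurable (Function.uncurry β) :=
    hb.aestronglyMeasurable.stronglyMeasurable_mk
  have hGm : StronglyMeasurable (Function.uncurry G) :=
    hb.aestronglyMeasurable_grad.stronglyMeasurable_mk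
  have hbβ : ∀ᵐ s ∂ν, b s =ᵐ[volume] β s :=
    Measure.ae_ae_of_ae_prod hb.aestronglyMeasurable.ae_eq_mk
  have hDG : ∀ᵐ s ∂ν, D s =ᵐ[volume] G s :=
    Measure.ae_ae_of_ae_prod hb.aestronglyMeasurable_grad.ae_eq_mk
  have hW : ∀ᵐ s ∂ν, HasWeakGradient (β s) (G s) := by
    filter_upwards [hb.hasWeakGradient, hbβ, hDG] with s h1 h2 h3 using h1.congr_ae h2 h3
  have hmap : ∀ t ∈ Icc 0 T, Measure.map (Y t) volume ≤ ENNReal.ofReal L • volume := by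
    intro t ht
    have : X t =ᵐ[volume] Y t := by
      filter_upwards [measure_eq_zero_iff_ae_notMem.1 hN₀0] with x hx using (hN₀ x hx t ht).1
    rw [← Measure.map_congr this]
    exact (hX.compressibility t ht).2
  -- A measurable set of space-time points with null sections outside which everything is fine.
  obtain ⟨P₁, hP₁sub, hP₁m, hP₁0⟩ := exists_measurable_superset_of_null
    (ae_iff.1 hb.aestronglyMeasurable.ae_eq_mk)
  set P₂ : Set (ℝ × EuclideanSpace ℝ (Fin d)) :=
    {z | Tendsto (fun n => mollify n (β z.1) z.2) atTop (𝓝 (β z.1 z.2))} with hP₂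
  have hP₂m : MeasurableSet P₂ :=
    measurableSet_tendsto_fun (measurable_mollify_uncurry hβm) hβm.measurable
  set P := P₁ ∪ P₂ᶜ with hP
  have hPm : MeasurableSet P := hP₁m.union hP₂m.compl
  have hPs : ∀ᵐ s ∂ν, volume (Prod.mk s ⁻¹' P) = 0 := by
    filter_upwards [Measure.measure_ae_null_of_prod_null hP₁0, hW] with s h1 h2
    rw [hP, preimage_union]
    exact measure_union_null h1 (ae_iff.1 (ae_tendsto_mollify h2.locallyIntegrable))
  have hYP : ∀ᵐ x : EuclideanSpace ℝ (Fin d), ∀ᵐ s ∂ν, (s, Y s x) ∉ P := by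
    have hm : MeasurableSet {z : ℝ × EuclideanSpace ℝ (Fin d) | (z.1, Y z.1 z.2) ∉ P} :=
      (measurable_fst.prodMk hYm) hPm.compl
    refine (Measure.ae_ae_comm (p := fun s x => (s, Y s x) ∉ P) hm).1 ?_
    filter_upwards [hPs, ae_restrict_mem measurableSet_Icc] with s hs hsT
    have hYs : Measurable (Y s) := hYm.comp measurable_prodMk_left
    have h1 : Measure.map (Y s) volume (Prod.mk s ⁻¹' P) = 0 := by
      refine le_antisymm ((hmap s hsT _).trans ?_) zero_le
      simp [hs]
    rw [Measure.map_apply hYs (measurable_prodMk_left hPm)] at h1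
    exact measure_eq_zero_iff_ae_notMem.1 h1
  obtain ⟨N₁, hN₁sub, hN₁m, hN₁0⟩ := exists_measurable_superset_of_null (ae_iff.1 hYP)
  have hN₁ : ∀ x ∉ N₁, ∀ᵐ s ∂ν, (s, Y s x) ∉ P := by
    intro x hx
    by_contra h
    exact hx (hN₁sub h)
  have hcongr : ∀ x ∉ N₀ ∪ N₁, ∀ᵐ s ∂ν, b s (X s x) = β s (Y s x) := by
    intro x hx
    filter_upwards [hN₁ x fun h => hx (Or.inr h), ae_restrict_mem measurableSet_Icc] with s hs hsT
    rw [(hN₀ x (fun h => hx (Or.inl h)) s hsT).1]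
    by_contra h
    exact hs (Or.inl (hP₁sub h))
  have hcongr' : ∀ x ∉ N₀ ∪ N₁, ∀ t ∈ Icc 0 T,
      (fun s => b s (X s x)) =ᵐ[volume.restrict (uIoc 0 t)] fun s => β s (Y s x) := by
    intro x hx t ht
    rw [uIoc_of_le ht.1]
    exact ae_restrict_of_ae_restrict_of_subset
      (Ioc_subset_Icc_self.trans (Icc_subset_Icc_right ht.2)) (hcongr x hx)
  refine ⟨β, Y, G, N₀ ∪ N₁, hβm, hGm, hYm, hN₀m.union hN₁m, measure_union_null hN₀0 hN₁0, hbβ, hDG,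
    hW, hmap, ?_, ?_, ?_, ?_⟩
  · exact fun x hx t ht => (hN₀ x (fun h => hx (Or.inl h)) t ht).1
  · exact fun x hx => (hN₀ x (fun h => hx (Or.inl h)) T (right_mem_Icc.2 hT)).2.1.congr_ae
      (hcongr' x hx T (right_mem_Icc.2 hT))
  · intro x hx t ht
    have h := hN₀ x (fun h => hx (Or.inl h)) t ht
    rw [← h.1, h.2.2]
    congr 1
    exact intervalIntegral.integral_congr_ae_restrict (hcongr' x hx t ht)
  · intro x hx
    filter_upwards [hN₁ x fun h => hx (Or.inr h)] with s hs
    by_contra h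
    exact hs (Or.inr h)

end

/-! ### The exponent in the two-sided bound -/

section

variable {d : ℕ} {T L : ℝ} {p : ℝ≥0∞}
  {b X β Y : ℝ → EuclideanSpace ℝ (Fin d) → EuclideanSpace ℝ (Fin d)}
  {D G : ℝ → EuclideanSpace ℝ (Fin d) → EuclideanSpace ℝ (Fin d) →L[ℝ] EuclideanSpace ℝ (Fin d)}
  {N : Set (EuclideanSpace ℝ (Fin d))}

open Classical in
/-- The function `g_t(x)` of the theorem: the maximal function of the gradient integrated along the
trajectory of `x` up to time `t`, and `∞` for the exceptional starting points `x ∈ N`. -/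
noncomputable def growth
    (G : ℝ → EuclideanSpace ℝ (Fin d) → EuclideanSpace ℝ (Fin d) →L[ℝ] EuclideanSpace ℝ (Fin d))
    (Y : ℝ → EuclideanSpace ℝ (Fin d) → EuclideanSpace ℝ (Fin d))
    (N : Set (EuclideanSpace ℝ (Fin d))) (t : ℝ) (x : EuclideanSpace ℝ (Fin d)) : ℝ≥0∞ :=
  if x ∈ N then ∞
  else 32 ^ d * ∫⁻ s in Icc 0 t, maximal volume (fun y => ‖G s y‖ₑ) (Y s x)

section

variable (h : IsMeasurableVersion T L b X D β Y G N)

include h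

theorem IsMeasurableVersion.measurable_enorm_grad (s : ℝ) : Measurable fun y => ‖G s y‖ₑ :=
  (h.stronglyMeasurable_grad.comp_measurable measurable_prodMk_left).enorm

theorem IsMeasurableVersion.measurable_maximal_flow :
    Measurable fun z : ℝ × EuclideanSpace ℝ (Fin d) =>
      maximal volume (fun y => ‖G z.1 y‖ₑ) (Y z.1 z.2) := by
  have h1 : Measurable (Function.uncurry fun s y => ‖G s y‖ₑ) := h.stronglyMeasurable_grad.enorm
  have h2 := measurable_maximal_uncurry volume h1
  have h3 : Measurable fun z : ℝ × EuclideanSpace ℝ (Fin d) => (z.1, Y z.1 z.2) :=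
    measurable_fst.prodMk h.measurable_flow
  simpa only [Function.comp_def] using h2.comp h3

theorem IsMeasurableVersion.measurable_maximal_trajectory (x : EuclideanSpace ℝ (Fin d)) :
    Measurable fun s => maximal volume (fun y => ‖G s y‖ₑ) (Y s x) := by
  have h1 := h.measurable_maximal_flow
  have h2 : Measurable fun s : ℝ => (s, x) := measurable_prodMk_right
  simpa only [Function.comp_def] using h1.comp h2

theorem IsMeasurableVersion.measurable_growth :
    Measurable fun z : ℝ × EuclideanSpace ℝ (Fin d) => growth G Y N z.1 z.2 := by
  unfold growth
  refine Measurable.ite (measurable_snd h.measurableSet) measurable_const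
    (Measurable.const_mul ?_ _)
  have h1 : (fun z : ℝ × EuclideanSpace ℝ (Fin d) => ∫⁻ s in Icc 0 z.1,
      maximal volume (fun y => ‖G s y‖ₑ) (Y s z.2)) = fun z => ∫⁻ s,
      {w : (ℝ × EuclideanSpace ℝ (Fin d)) × ℝ | 0 ≤ w.2 ∧ w.2 ≤ w.1.1}.indicator
        (fun w => maximal volume (fun y => ‖G w.2 y‖ₑ) (Y w.2 w.1.2)) (z, s) := by
    funext z
    rw [← lintegral_indicator measurableSet_Icc]
    rfl
  rw [h1]
  refine Measurable.lintegral_prod_right' (Measurable.indicator ?_ ?_)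
  · have h1 := h.measurable_maximal_flow
    have h2 : Measurable fun w : (ℝ × EuclideanSpace ℝ (Fin d)) × ℝ => (w.2, w.1.2) :=
      measurable_snd.prodMk (measurable_snd.comp measurable_fst)
    simpa only [Function.comp_def] using h1.comp h2
  · exact (measurableSet_le measurable_const measurable_snd).inter
      (measurableSet_le measurable_snd (measurable_fst.comp measurable_fst))

/-- Two trajectories separate at a rate controlled by the maximal function at both of them. -/
theorem IsMeasurableVersion.ae_enorm_sub_le {x y : EuclideanSpace ℝ (Fin d)} (hx : x ∉ N)
    (hy : y ∉ N) : ∀ᵐ s ∂(volume.restrict (Icc 0 T)), ‖β s (Y s x) - β s (Y s y)‖ₑ ≤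
      32 ^ d * (maximal volume (fun y => ‖G s y‖ₑ) (Y s x) +
        maximal volume (fun y => ‖G s y‖ₑ) (Y s y)) * ‖Y s x - Y s y‖ₑ := by
  filter_upwards [h.hasWeakGradient, h.tendsto_mollify x hx, h.tendsto_mollify y hy]
    with s h1 h2 h3
  refine (h1.enorm_sub_le_maximal (h.measurable_enorm_grad s) h2 h3).trans (le_of_eq ?_)
  ring

theorem IsMeasurableVersion.flow_zero (hT : 0 ≤ T) {x : EuclideanSpace ℝ (Fin d)} (hx : x ∉ N) :
    Y 0 x = x := by
  rw [h.integral_eq x hx 0 (left_mem_Icc.2 hT)]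
  simp

theorem IsMeasurableVersion.norm_sub_le {x y : EuclideanSpace ℝ (Fin d)} (hx : x ∉ N)
    (hy : y ∉ N) {t : ℝ} (ht : t ∈ Icc 0 T) (hfin : growth G Y N t x + growth G Y N t y ≠ ∞) :
    ‖Y t x - Y t y‖ ≤ Real.exp (growth G Y N t x + growth G Y N t y).toReal * ‖x - y‖ ∧
      ‖x - y‖ ≤ Real.exp (growth G Y N t x + growth G Y N t y).toReal * ‖Y t x - Y t y‖ := by
  have hT : 0 ≤ T := ht.1.trans ht.2
  have hsub : Icc 0 t ⊆ Icc 0 T := Icc_subset_Icc_right ht.2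
  have hix : ∀ x ∉ N, ∀ s ∈ Icc 0 T, IntervalIntegrable (fun s => β s (Y s x)) volume 0 s :=
    fun x hx s hs => (h.intervalIntegrable x hx).mono_set
      (by rw [uIcc_of_le hs.1, uIcc_of_le hT]; exact Icc_subset_Icc_right hs.2)
  have hgr : growth G Y N t x + growth G Y N t y = ∫⁻ s in Icc 0 t,
      32 ^ d * (maximal volume (fun y => ‖G s y‖ₑ) (Y s x) +
        maximal volume (fun y => ‖G s y‖ₑ) (Y s y)) := by
    simp only [growth, if_neg hx, if_neg hy]
    rw [lintegral_const_mul' _ _ (by finiteness),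
      lintegral_add_left (h.measurable_maximal_trajectory x), mul_add]
  have key := norm_le_exp_mul_norm (γ := fun s => Y s x - Y s y)
    (v := fun s => β s (Y s x) - β s (Y s y)) ht.1 ((hix x hx t ht).sub (hix y hy t ht))
    (fun s hs => ?_) (ae_restrict_of_ae_restrict_of_subset hsub (h.ae_enorm_sub_le hx hy))
    (hgr ▸ hfin)
  · rw [hgr]
    simpa only [h.flow_zero hT hx, h.flow_zero hT hy] using key
  · rw [intervalIntegral.integral_sub (hix x hx s (hsub hs)) (hix y hy s (hsub hs)),
      h.integral_eq x hx s (hsub hs), h.integral_eq y hy s (hsub hs), h.flow_zero hT hx,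
      h.flow_zero hT hy]
    abel

/-- The two-sided exponential bound on the separation of trajectories. -/
theorem IsMeasurableVersion.exp_growth_bounds {t : ℝ} (ht : t ∈ Icc 0 T)
    {x y : EuclideanSpace ℝ (Fin d)} (hxy : x ≠ y) :
    EReal.exp (-(growth G Y N t x : EReal) - (growth G Y N t y : EReal)) ≤
        ‖X t x - X t y‖ₑ / ‖x - y‖ₑ ∧
      ‖X t x - X t y‖ₑ / ‖x - y‖ₑ ≤
        EReal.exp ((growth G Y N t x : EReal) + (growth G Y N t y : EReal)) := by
  by_cases hfx : growth G Y N t x = ∞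
  · rw [hfx]
    refine ⟨?_, ?_⟩
    · rw [EReal.coe_ennreal_top, EReal.neg_top, EReal.bot_sub, EReal.exp_bot]
      exact zero_le
    · rw [EReal.coe_ennreal_top, EReal.top_add_of_ne_bot (EReal.coe_ennreal_ne_bot _),
        EReal.exp_top]
      exact le_top
  by_cases hfy : growth G Y N t y = ∞
  · rw [hfy]
    refine ⟨?_, ?_⟩
    · rw [EReal.coe_ennreal_top, EReal.sub_top, EReal.exp_bot]
      exact zero_le
    · rw [EReal.coe_ennreal_top, EReal.add_top_of_ne_bot (EReal.coe_ennreal_ne_bot _),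
        EReal.exp_top]
      exact le_top
  have hx : x ∉ N := fun hx => hfx (by simp [growth, hx])
  have hy : y ∉ N := fun hy => hfy (by simp [growth, hy])
  have hb := h.norm_sub_le hx hy ht (ENNReal.add_ne_top.2 ⟨hfx, hfy⟩)
  rw [h.flow_eq x hx t ht, h.flow_eq y hy t ht]
  set A := growth G Y N t x with hA
  set B := growth G Y N t y with hB
  rw [ENNReal.toReal_add hfx hfy] at hb
  have hpos : 0 < ‖x - y‖ := norm_pos_iff.2 (sub_ne_zero.2 hxy)
  have e1 : (A : EReal) = ((A.toReal : ℝ) : EReal) := (EReal.coe_ennreal_toReal hfx).symm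
  have e2 : (B : EReal) = ((B.toReal : ℝ) : EReal) := (EReal.coe_ennreal_toReal hfy).symm
  rw [e1, e2, ← ofReal_norm, ← ofReal_norm, ← ENNReal.ofReal_div_of_pos hpos, ← EReal.coe_add,
    ← EReal.coe_neg, ← EReal.coe_sub, EReal.exp_coe, EReal.exp_coe]
  refine ⟨ENNReal.ofReal_le_ofReal ?_, ENNReal.ofReal_le_ofReal ?_⟩
  · rw [le_div_iff₀ hpos, show -A.toReal - B.toReal = -(A.toReal + B.toReal) by ring, Real.exp_neg,
      inv_mul_le_iff₀ (Real.exp_pos _)]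
    exact hb.2
  · rw [div_le_iff₀ hpos]
    exact hb.1

theorem IsMeasurableVersion.lintegral_comp_flow_le {K : ℝ≥0∞} {t : ℝ}
    (hK : Measure.map (Y t) volume ≤ K • volume) {f : EuclideanSpace ℝ (Fin d) → ℝ≥0∞}
    (hf : Measurable f) : ∫⁻ x, f (Y t x) ≤ K * ∫⁻ x, f x := by
  have hY : Measurable (Y t) := h.measurable_flow.comp measurable_prodMk_left
  rw [← lintegral_map hf hY]
  refine (lintegral_mono' hK le_rfl).trans (le_of_eq ?_)
  rw [lintegral_smul_measure, smul_eq_mul]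

theorem IsMeasurableVersion.lintegral_growth_rpow_le {K : ℝ≥0∞} {r t : ℝ} (hr : 1 < r)
    {C : ℝ≥0} (hC : ∀ f : EuclideanSpace ℝ (Fin d) → ℝ≥0∞, Measurable f →
      ∫⁻ x, maximal volume f x ^ r ≤ C * ∫⁻ x, f x ^ r)
    (hK : ∀ s ∈ Icc 0 t, Measure.map (Y s) volume ≤ K • volume) :
    (∫⁻ x, growth G Y N t x ^ r) ^ (1 / r) ≤ 32 ^ d * (C ^ (1 / r) * K ^ (1 / r)) *
      ∫⁻ s in Icc 0 t, (∫⁻ x, ‖G s x‖ₑ ^ r) ^ (1 / r) := by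
  have hr0 : 0 < r := by linarith
  have hgr : ∫⁻ x, growth G Y N t x ^ r = (32 ^ d) ^ r * ∫⁻ x, (∫⁻ s in Icc 0 t,
      maximal volume (fun y => ‖G s y‖ₑ) (Y s x)) ^ r := by
    rw [← lintegral_const_mul' _ _ (ENNReal.rpow_ne_top_of_nonneg hr0.le (by finiteness))]
    refine lintegral_congr_ae ?_
    filter_upwards [measure_eq_zero_iff_ae_notMem.1 h.volume_eq_zero] with x hx
    rw [growth, if_neg hx, ENNReal.mul_rpow_of_nonneg _ _ hr0.le]
  rw [hgr, ENNReal.mul_rpow_of_nonneg _ _ (by positivity), ← ENNReal.rpow_mul,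
    mul_one_div_cancel hr0.ne', ENNReal.rpow_one, mul_assoc]
  gcongr
  refine (lintegral_lintegral_rpow_le h.measurable_maximal_flow hr).trans ?_
  have hfin : (C : ℝ≥0∞) ^ (1 / r) ≠ ∞ := ENNReal.rpow_ne_top_of_nonneg (by positivity) (by simp)
  rw [← lintegral_const_mul]
  · refine setLIntegral_mono' measurableSet_Icc fun s hs => ?_
    rw [← ENNReal.mul_rpow_of_nonneg _ _ (by positivity),
      ← ENNReal.mul_rpow_of_nonneg _ _ (by positivity)]
    refine ENNReal.rpow_le_rpow ?_ (by positivity)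
    have hG := h.measurable_enorm_grad s
    refine (h.lintegral_comp_flow_le (hK s hs)
      ((measurable_maximal volume hG).pow_const r)).trans ?_
    rw [mul_comm (C : ℝ≥0∞), mul_assoc]
    gcongr
    exact hC _ hG
  · exact (Measurable.lintegral_prod_right' (f := fun z : ℝ × EuclideanSpace ℝ (Fin d) =>
      ‖G z.1 z.2‖ₑ ^ r) (h.stronglyMeasurable_grad.enorm.pow_const r)).pow_const _

theorem IsMeasurableVersion.lintegral_eLpNorm_grad_eq {t : ℝ} (ht : t ≤ T) :
    ∫⁻ s in Icc 0 t, eLpNorm (D s) p volume = ∫⁻ s in Icc 0 t, eLpNorm (G s) p volume := by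
  refine lintegral_congr_ae (ae_restrict_of_ae_restrict_of_subset (Icc_subset_Icc_right ht) ?_)
  filter_upwards [h.ae_eq_grad] with s hs using eLpNorm_congr_ae hs

end

/-- The `L^p` bound on `growth`, for any compressibility constant `K ≥ 1` of the flow, which need
not be the constant `L` of the given structure. -/
theorem exists_eLpNorm_growth_le (d : ℕ) {p : ℝ≥0∞} (hp : 1 < p) (hp' : p ≠ ∞) :
    ∃ C : ℝ≥0, ∀ {T L : ℝ}
      {b X β Y : ℝ → EuclideanSpace ℝ (Fin d) → EuclideanSpace ℝ (Fin d)}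
      {D G : ℝ → EuclideanSpace ℝ (Fin d) →
        EuclideanSpace ℝ (Fin d) →L[ℝ] EuclideanSpace ℝ (Fin d)}
      {N : Set (EuclideanSpace ℝ (Fin d))}, IsMeasurableVersion T L b X D β Y G N →
      ∀ {K : ℝ≥0∞}, 1 ≤ K → (∀ s ∈ Icc 0 T, Measure.map (Y s) volume ≤ K • volume) →
      ∀ t ∈ Icc 0 T, eLpNorm (growth G Y N t) p volume ≤
        C * K * ∫⁻ s in Icc 0 t, eLpNorm (D s) p volume := by
  have hr : 1 < p.toReal := by
    rw [← ENNReal.toReal_one]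
    exact (ENNReal.toReal_lt_toReal ENNReal.one_ne_top hp').2 hp
  have hr0 : 0 < p.toReal := by linarith
  have hp0 : p ≠ 0 := (zero_lt_one.trans hp).ne'
  obtain ⟨C, hC⟩ := exists_lintegral_maximal_rpow_le
    (volume : Measure (EuclideanSpace ℝ (Fin d))) hr
  refine ⟨32 ^ d * C ^ (1 / p.toReal), fun h K hK1 hK t ht => ?_⟩
  rw [h.lintegral_eLpNorm_grad_eq ht.2]
  simp only [eLpNorm_eq_lintegral_rpow_enorm_toReal hp0 hp', enorm_eq_self]
  refine (h.lintegral_growth_rpow_le hr hC fun s hs => hK s ⟨hs.1, hs.2.trans ht.2⟩).trans ?_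
  rw [ENNReal.coe_mul, ENNReal.coe_pow, ENNReal.coe_rpow_of_nonneg _ (by positivity),
    mul_assoc _ _ K]
  gcongr
  · exact le_refl _
  -- The estimate gives the power `K ^ (1 / p)`, which is at most `K` because `K ≥ 1`.
  · conv_rhs => rw [← ENNReal.rpow_one K]
    exact ENNReal.rpow_le_rpow_of_exponent_le hK1 ((div_le_one hr0).2 hr.le)

/-- At time `0` the flow is the identity, so its compressibility constant is at least `1`. -/
theorem IsMeasurableVersion.one_le_compressibility (h : IsMeasurableVersion T L b X D β Y G N)
    (hT : 0 ≤ T) : 1 ≤ ENNReal.ofReal L := by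
  have h0 : Measure.map (Y 0) volume = volume := by
    have : Y 0 =ᵐ[volume] id := by
      filter_upwards [measure_eq_zero_iff_ae_notMem.1 h.volume_eq_zero] with x hx
      exact h.flow_zero hT hx
    rw [Measure.map_congr this, Measure.map_id]
  have h1 := h.map_le 0 (left_mem_Icc.2 hT) (closedBall 0 1)
  rw [h0, Measure.smul_apply, smul_eq_mul] at h1
  by_contra hlt
  have h2 := ENNReal.mul_lt_mul_left (measure_closedBall_pos volume
    (0 : EuclideanSpace ℝ (Fin d)) one_pos).ne' (measure_closedBall_ne_top volume _ 1)
    (not_le.1 hlt)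
  rw [one_mul] at h2
  exact absurd h1 (not_le.2 h2)

end

/-! ### The commutator of mollification and transport -/

section

section Average

variable {E : Type*} [NormedAddCommGroup E] [NormedSpace ℝ E] [FiniteDimensional ℝ E]
  [MeasurableSpace E] [BorelSpace E] (μ : Measure E) [μ.IsAddHaarMeasure]

/-- The normalised indicator of the ball of radius `ρ`, a convolution kernel of mass one. -/
noncomputable def ballKernel (ρ : ℝ) (z : E) : ℝ≥0∞ :=
  (closedBall (0 : E) ρ).indicator (fun _ => (μ (closedBall (0 : E) ρ))⁻¹) z

omit [NormedSpace ℝ E] [FiniteDimensional ℝ E] [μ.IsAddHaarMeasure] in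
theorem measurable_ballKernel (ρ : ℝ) : Measurable (ballKernel μ ρ) :=
  measurable_const.indicator measurableSet_closedBall

omit [NormedSpace ℝ E] [FiniteDimensional ℝ E] [BorelSpace E] [μ.IsAddHaarMeasure] in
theorem ballKernel_neg (ρ : ℝ) (z : E) : ballKernel μ ρ (-z) = ballKernel μ ρ z := by
  simp [ballKernel, indicator]

theorem lintegral_ballKernel {ρ : ℝ} (hρ : 0 < ρ) : ∫⁻ z, ballKernel μ ρ z ∂μ = 1 := by
  unfold ballKernel
  rw [lintegral_indicator_const measurableSet_closedBall,
    ENNReal.inv_mul_cancel (measure_closedBall_pos μ _ hρ).ne' (measure_closedBall_ne_top μ _ _)]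

theorem lintegral_ballKernel_sub {ρ : ℝ} (hρ : 0 < ρ) (u : E) :
    ∫⁻ v, ballKernel μ ρ (u - v) ∂μ = 1 := by
  rw [lintegral_sub_left_eq_self (fun z => ballKernel μ ρ z) u, lintegral_ballKernel μ hρ]

/-- Averaging over balls is a contraction of `L^q`. -/
theorem lintegral_ballKernel_mul_rpow_le {R : E → ℝ≥0∞} (hR : Measurable R) {q : ℝ} (hq : 1 < q)
    {ρ : ℝ} (hρ : 0 < ρ) :
    (∫⁻ u, (∫⁻ v, ballKernel μ ρ (u - v) * R v ∂μ) ^ q ∂μ) ^ (1 / q) ≤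
      (∫⁻ v, R v ^ q ∂μ) ^ (1 / q) := by
  have h1 : ∀ u, ∫⁻ v, ballKernel μ ρ (u - v) * R v ∂μ =
      ∫⁻ z, R (u - z) ∂(μ.withDensity (ballKernel μ ρ)) := by
    intro u
    have hm : Measurable fun z => R (u - z) := hR.comp (by fun_prop)
    rw [lintegral_withDensity_eq_lintegral_mul _ (measurable_ballKernel μ ρ) hm,
      ← lintegral_sub_left_eq_self (fun z => ballKernel μ ρ (u - z) * R z) u]
    simp
  simp_rw [h1]
  refine (lintegral_lintegral_rpow_le (F := fun z u => R (u - z))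
    (hR.comp (measurable_snd.sub measurable_fst)) hq).trans ?_
  have h2 : ∀ z, ∫⁻ u, R (u - z) ^ q ∂μ = ∫⁻ u, R u ^ q ∂μ := fun z =>
    lintegral_sub_right_eq_self (fun u => R u ^ q) z
  simp_rw [h2]
  rw [lintegral_const, withDensity_apply _ MeasurableSet.univ, Measure.restrict_univ,
    lintegral_ballKernel μ hρ, mul_one]

/-- A trilinear estimate for averages over balls. -/
theorem lintegral_ballKernel_mul_le {M R₁ R₂ : E → ℝ≥0∞} (hM : Measurable M)
    (hR₂ : Measurable R₂) {c : ℝ≥0∞} (hc : ∀ u, R₁ u ≤ c) {r q : ℝ}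
    (hrq : r.HolderConjugate q) {ρ : ℝ} (hρ : 0 < ρ) :
    ∫⁻ z, ballKernel μ ρ (z.1 - z.2) * (M z.1 + M z.2) * (R₁ z.1 * R₂ z.2) ∂(μ.prod μ) ≤
      2 * c * (∫⁻ u, M u ^ r ∂μ) ^ (1 / r) * (∫⁻ v, R₂ v ^ q ∂μ) ^ (1 / q) := by
  have hk : Measurable fun z : E × E => ballKernel μ ρ (z.1 - z.2) :=
    (measurable_ballKernel μ ρ).comp (measurable_fst.sub measurable_snd)
  have hm1 : Measurable fun z : E × E => M z.1 * (ballKernel μ ρ (z.1 - z.2) * R₂ z.2) :=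
    (hM.comp measurable_fst).mul (hk.mul (hR₂.comp measurable_snd))
  have hm2 : Measurable fun z : E × E => (M z.2 * R₂ z.2) * ballKernel μ ρ (z.2 - z.1) :=
    ((hM.mul hR₂).comp measurable_snd).mul
      ((measurable_ballKernel μ ρ).comp (measurable_snd.sub measurable_fst))
  have hsplit : ∀ z : E × E, ballKernel μ ρ (z.1 - z.2) * (M z.1 + M z.2) * (R₁ z.1 * R₂ z.2) ≤
      c * (M z.1 * (ballKernel μ ρ (z.1 - z.2) * R₂ z.2)) +
        c * ((M z.2 * R₂ z.2) * ballKernel μ ρ (z.2 - z.1)) := by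
    intro z
    rw [← neg_sub z.1 z.2, ballKernel_neg]
    calc _ ≤ ballKernel μ ρ (z.1 - z.2) * (M z.1 + M z.2) * (c * R₂ z.2) := by
          gcongr
          exact hc _
      _ = _ := by ring
  have e1 : ∫⁻ z, M z.1 * (ballKernel μ ρ (z.1 - z.2) * R₂ z.2) ∂(μ.prod μ) ≤
      (∫⁻ u, M u ^ r ∂μ) ^ (1 / r) * (∫⁻ v, R₂ v ^ q ∂μ) ^ (1 / q) := by
    have hm : Measurable fun z : E × E => ballKernel μ ρ (z.1 - z.2) * R₂ z.2 :=
      hk.mul (hR₂.comp measurable_snd)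
    rw [lintegral_prod _ hm1.aemeasurable]
    calc _ = ∫⁻ u, M u * ∫⁻ v, ballKernel μ ρ (u - v) * R₂ v ∂μ ∂μ := by
          refine lintegral_congr fun u => ?_
          exact lintegral_const_mul (M u) (hm.comp measurable_prodMk_left)
      _ ≤ _ := ENNReal.lintegral_mul_le_Lp_mul_Lq μ hrq hM.aemeasurable
          (Measurable.lintegral_prod_right' hm).aemeasurable
      _ ≤ _ := by
          gcongr _ * ?_
          exact lintegral_ballKernel_mul_rpow_le μ hR₂ hrq.symm.lt hρ
  have e2 : ∫⁻ z, (M z.2 * R₂ z.2) * ballKernel μ ρ (z.2 - z.1) ∂(μ.prod μ) ≤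
      (∫⁻ u, M u ^ r ∂μ) ^ (1 / r) * (∫⁻ v, R₂ v ^ q ∂μ) ^ (1 / q) := by
    rw [lintegral_prod_symm _ hm2.aemeasurable]
    calc _ = ∫⁻ v, M v * R₂ v ∂μ := by
          refine lintegral_congr fun v => ?_
          have hm : Measurable fun u => ballKernel μ ρ (v - u) :=
            (measurable_ballKernel μ ρ).comp (by fun_prop)
          simp only
          rw [lintegral_const_mul _ hm, lintegral_ballKernel_sub μ hρ, mul_one]
      _ ≤ _ := ENNReal.lintegral_mul_le_Lp_mul_Lq μ hrq hM.aemeasurable hR₂.aemeasurable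
  calc _ ≤ ∫⁻ z, (c * (M z.1 * (ballKernel μ ρ (z.1 - z.2) * R₂ z.2)) +
        c * ((M z.2 * R₂ z.2) * ballKernel μ ρ (z.2 - z.1))) ∂(μ.prod μ) := lintegral_mono hsplit
    _ = c * ∫⁻ z, M z.1 * (ballKernel μ ρ (z.1 - z.2) * R₂ z.2) ∂(μ.prod μ) +
        c * ∫⁻ z, (M z.2 * R₂ z.2) * ballKernel μ ρ (z.2 - z.1) ∂(μ.prod μ) := by
        rw [lintegral_add_left (hm1.const_mul c), lintegral_const_mul _ hm1,
          lintegral_const_mul _ hm2]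
    _ ≤ c * ((∫⁻ u, M u ^ r ∂μ) ^ (1 / r) * (∫⁻ v, R₂ v ^ q ∂μ) ^ (1 / q)) +
        c * ((∫⁻ u, M u ^ r ∂μ) ^ (1 / r) * (∫⁻ v, R₂ v ^ q ∂μ) ^ (1 / q)) := by
        gcongr c * ?_ + c * ?_
    _ = _ := by ring

end Average

variable {d : ℕ}

section Commutator

/-- The commutator kernel `∇η_n(u - v) · (f u - f v)` of the vector field `f` with the mollifier. -/
noncomputable def commutator (n : ℕ) (f : EuclideanSpace ℝ (Fin d) → EuclideanSpace ℝ (Fin d))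
    (z : EuclideanSpace ℝ (Fin d) × EuclideanSpace ℝ (Fin d)) : ℝ :=
  fderiv ℝ (mollifier d n) (z.1 - z.2) (f z.1 - f z.2)

theorem continuous_fderiv_mollifier (n : ℕ) : Continuous (fderiv ℝ (mollifier d n)) :=
  (contDiff_mollifier (m := 1) n).continuous_fderiv one_ne_zero

theorem fderiv_mollifier_neg (n : ℕ) (z : EuclideanSpace ℝ (Fin d)) :
    fderiv ℝ (mollifier d n) (-z) = -fderiv ℝ (mollifier d n) z := by
  have h0 : HasFDerivAt (mollifier d n) (fderiv ℝ (mollifier d n) (-z)) (-z) :=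
    ((contDiff_mollifier (m := 1) n).differentiable one_ne_zero).differentiableAt.hasFDerivAt
  have h1 : HasFDerivAt (fun z : EuclideanSpace ℝ (Fin d) => -z)
      (-ContinuousLinearMap.id ℝ _) z := (hasFDerivAt_id z).neg
  have h2 := (h0.comp z h1).fderiv
  have h3 : mollifier d n ∘ (fun z => -z) = mollifier d n := funext fun z => mollifier_neg n z
  rw [h3] at h2
  rw [h2]
  ext v
  simp

theorem commutator_swap (n : ℕ) (f : EuclideanSpace ℝ (Fin d) → EuclideanSpace ℝ (Fin d))
    (z : EuclideanSpace ℝ (Fin d) × EuclideanSpace ℝ (Fin d)) :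
    commutator n f z.swap = commutator n f z := by
  simp only [commutator, Prod.fst_swap, Prod.snd_swap]
  rw [← neg_sub z.1 z.2, fderiv_mollifier_neg, ← neg_sub (f z.1) (f z.2)]
  simp

theorem measurable_commutator {S : Type*} [MeasurableSpace S]
    {f : S → EuclideanSpace ℝ (Fin d) → EuclideanSpace ℝ (Fin d)}
    (hf : StronglyMeasurable (Function.uncurry f)) (n : ℕ) :
    Measurable fun w : S × EuclideanSpace ℝ (Fin d) × EuclideanSpace ℝ (Fin d) =>
      commutator n (f w.1) w.2 := by
  have h1 : Measurable fun w : S × EuclideanSpace ℝ (Fin d) × EuclideanSpace ℝ (Fin d) =>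
      (w.2.1 - w.2.2, f w.1 w.2.1 - f w.1 w.2.2) := by
    refine Measurable.prodMk (by fun_prop) (Measurable.sub ?_ ?_)
    · exact hf.measurable.comp (measurable_fst.prodMk (measurable_fst.comp measurable_snd))
    · exact hf.measurable.comp (measurable_fst.prodMk (measurable_snd.comp measurable_snd))
  have h2 : Continuous fun w : EuclideanSpace ℝ (Fin d) × EuclideanSpace ℝ (Fin d) =>
      fderiv ℝ (mollifier d n) w.1 w.2 :=
    ((continuous_fderiv_mollifier n).comp continuous_fst).clm_apply continuous_snd
  simpa only [Function.comp_def] using! h2.measurable.comp h1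

/-- The key commutator bound: up to a constant independent of the scale, the commutator kernel is
dominated by averages of the maximal function of the gradient over balls. -/
theorem exists_enorm_commutator_le (d : ℕ) : ∃ K : ℝ≥0, ∀ (n : ℕ)
    {f : EuclideanSpace ℝ (Fin d) → EuclideanSpace ℝ (Fin d)}
    {G : EuclideanSpace ℝ (Fin d) → EuclideanSpace ℝ (Fin d) →L[ℝ] EuclideanSpace ℝ (Fin d)},
    HasWeakGradient f G → Measurable (fun y => ‖G y‖ₑ) →
    ∀ᵐ z ∂((volume : Measure (EuclideanSpace ℝ (Fin d))).prod volume), ‖commutator n f z‖ₑ ≤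
      K * (ballKernel volume (bump d n).rOut (z.1 - z.2) *
        (maximal volume (fun y => ‖G y‖ₑ) z.1 + maximal volume (fun y => ‖G y‖ₑ) z.2)) := by
  obtain ⟨K, hK⟩ := exists_norm_mul_norm_fderiv_mollifier_le d
  refine ⟨K * 32 ^ d, fun n f G h hG => ?_⟩
  have hae := ae_tendsto_mollify h.locallyIntegrable
  filter_upwards [Measure.quasiMeasurePreserving_fst.ae hae,
    Measure.quasiMeasurePreserving_snd.ae hae] with z h1 h2
  have h3 := h.enorm_sub_le_maximal hG h1 h2
  calc ‖commutator n f z‖ₑ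
      ≤ ‖fderiv ℝ (mollifier d n) (z.1 - z.2)‖ₑ * ‖f z.1 - f z.2‖ₑ :=
        ContinuousLinearMap.le_opENorm _ _
    _ ≤ ‖fderiv ℝ (mollifier d n) (z.1 - z.2)‖ₑ * (32 ^ d * ‖z.1 - z.2‖ₑ *
        (maximal volume (fun y => ‖G y‖ₑ) z.1 + maximal volume (fun y => ‖G y‖ₑ) z.2)) := by gcongr
    _ = 32 ^ d * (‖fderiv ℝ (mollifier d n) (z.1 - z.2)‖ₑ * ‖z.1 - z.2‖ₑ) *
        (maximal volume (fun y => ‖G y‖ₑ) z.1 + maximal volume (fun y => ‖G y‖ₑ) z.2) := by ring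
    _ ≤ 32 ^ d * (K * ballKernel volume (bump d n).rOut (z.1 - z.2)) *
        (maximal volume (fun y => ‖G y‖ₑ) z.1 + maximal volume (fun y => ‖G y‖ₑ) z.2) := by
        gcongr 32 ^ d * ?_ * _
        refine (hK n (z.1 - z.2)).trans (le_of_eq ?_)
        by_cases hz : z.1 - z.2 ∈ closedBall (0 : EuclideanSpace ℝ (Fin d)) (bump d n).rOut
        · simp [ballKernel, indicator_of_mem hz]
        · simp [ballKernel, indicator_of_notMem hz]
    _ = _ := by
        rw [ENNReal.coe_mul, ENNReal.coe_pow, ENNReal.coe_ofNat]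
        ring

/-- The commutator as a bounded bilinear form, uniformly in the scale: one weight in `L^∞`, the
other in `L^q`. -/
theorem exists_lintegral_enorm_commutator_le (d : ℕ) {r q : ℝ} (hrq : r.HolderConjugate q) :
    ∃ K : ℝ≥0, ∀ (n : ℕ) {f : EuclideanSpace ℝ (Fin d) → EuclideanSpace ℝ (Fin d)}
    {G : EuclideanSpace ℝ (Fin d) → EuclideanSpace ℝ (Fin d) →L[ℝ] EuclideanSpace ℝ (Fin d)},
    HasWeakGradient f G → Measurable (fun y => ‖G y‖ₑ) →
    ∀ {R₁ R₂ : EuclideanSpace ℝ (Fin d) → ℝ≥0∞}, Measurable R₂ →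
    ∀ {c : ℝ≥0∞}, (∀ u, R₁ u ≤ c) →
    ∫⁻ z, ‖commutator n f z‖ₑ * (R₁ z.1 * R₂ z.2) ∂(volume.prod volume) ≤
      K * c * (∫⁻ u, ‖G u‖ₑ ^ r) ^ (1 / r) * (∫⁻ v, R₂ v ^ q) ^ (1 / q) := by
  obtain ⟨K, hK⟩ := exists_enorm_commutator_le d
  obtain ⟨C, hC⟩ := exists_lintegral_maximal_rpow_le
    (volume : Measure (EuclideanSpace ℝ (Fin d))) hrq.lt
  have hr0 : 0 < r := hrq.pos
  refine ⟨K * (2 * C ^ (1 / r)), fun n f G h hG R₁ R₂ hR₂ c hc => ?_⟩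
  have hM := measurable_maximal volume hG
  calc ∫⁻ z, ‖commutator n f z‖ₑ * (R₁ z.1 * R₂ z.2) ∂(volume.prod volume)
      ≤ ∫⁻ z, K * (ballKernel volume (bump d n).rOut (z.1 - z.2) *
        (maximal volume (fun y => ‖G y‖ₑ) z.1 + maximal volume (fun y => ‖G y‖ₑ) z.2) *
          (R₁ z.1 * R₂ z.2)) ∂(volume.prod volume) := by
        refine lintegral_mono_ae ((hK n h hG).mono fun z hz => ?_)
        rw [← mul_assoc (K : ℝ≥0∞)]
        gcongr
    _ ≤ K * (2 * c * (∫⁻ u, maximal volume (fun y => ‖G y‖ₑ) u ^ r) ^ (1 / r) *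
          (∫⁻ v, R₂ v ^ q) ^ (1 / q)) := by
        rw [lintegral_const_mul' _ _ ENNReal.coe_ne_top]
        gcongr
        exact lintegral_ballKernel_mul_le volume hM hR₂ hc hrq (bump_rOut_pos d n)
    _ ≤ K * (2 * c * (C * ∫⁻ u, ‖G u‖ₑ ^ r) ^ (1 / r) * (∫⁻ v, R₂ v ^ q) ^ (1 / q)) := by
        gcongr
        exact hC _ hG
    _ = _ := by
        rw [ENNReal.mul_rpow_of_nonneg _ _ (by positivity), ENNReal.coe_mul, ENNReal.coe_mul,
          ENNReal.coe_rpow_of_nonneg _ (by positivity), ENNReal.coe_ofNat]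
        ring

end Commutator

end

/-! ### The commutator form of a divergence-free field -/

section

variable {d : ℕ} {f : EuclideanSpace ℝ (Fin d) → EuclideanSpace ℝ (Fin d)}

/-- The bilinear form `(R₁, R₂) ↦ ∬ ∇η_n(u - v) · (f u - f v) R₁(u) R₂(v) du dv`. -/
noncomputable def commutatorForm (n : ℕ) (f : EuclideanSpace ℝ (Fin d) → EuclideanSpace ℝ (Fin d))
    (R₁ R₂ : EuclideanSpace ℝ (Fin d) → ℝ) : ℝ :=
  ∫ z, commutator n f z * (R₁ z.1 * R₂ z.2) ∂(volume.prod volume)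

section Smooth

variable {φ ψ : EuclideanSpace ℝ (Fin d) → ℝ}

theorem IsTestFunction.contDiff_one (hφ : IsTestFunction φ) : ContDiff ℝ 1 φ :=
  hφ.1.of_le (by exact_mod_cast le_top)

theorem IsTestFunction.continuous_fderiv (hφ : IsTestFunction φ) : Continuous (fderiv ℝ φ) :=
  hφ.contDiff_one.continuous_fderiv one_ne_zero

theorem IsTestFunction.mul (hφ : IsTestFunction φ) (hψ : IsTestFunction ψ) :
    IsTestFunction fun x => φ x * ψ x :=
  ⟨hφ.1.mul hψ.1, hφ.2.mul_right⟩

theorem integrable_fderiv_mollifier_mul (n : ℕ) (hf : LocallyIntegrable f volume)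
    (hφ : IsTestFunction φ) (hψ : IsTestFunction ψ) :
    Integrable (fun z : EuclideanSpace ℝ (Fin d) × EuclideanSpace ℝ (Fin d) =>
      fderiv ℝ (mollifier d n) (z.1 - z.2) (f z.1) * (φ z.1 * ψ z.2))
      (volume.prod volume) := by
  obtain ⟨K, hK⟩ := ((hasCompactSupport_mollifier (d := d) n).fderiv ℝ).exists_bound_of_continuous
    (continuous_fderiv_mollifier n)
  have hφf : Integrable (fun u => φ u • f u) volume :=
    hf.integrable_smul_left_of_hasCompactSupport hφ.1.continuous hφ.2
  have hψi : Integrable ψ volume := hψ.1.continuous.integrable_of_hasCompactSupport hψ.2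
  refine ((hφf.norm.mul_prod hψi.norm).const_mul K).mono' ?_ (Eventually.of_forall fun z => ?_)
  · refine AEStronglyMeasurable.mul ?_ ?_
    · exact (show Continuous fun w : EuclideanSpace ℝ (Fin d) × EuclideanSpace ℝ (Fin d) =>
          fderiv ℝ (mollifier d n) w.1 w.2 from
        ((continuous_fderiv_mollifier n).comp continuous_fst).clm_apply
          continuous_snd).comp_aestronglyMeasurable
        ((continuous_fst.sub continuous_snd).aestronglyMeasurable.prodMk
          hf.aestronglyMeasurable.comp_fst)
    · exact ((hφ.1.continuous.comp continuous_fst).mul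
        (hψ.1.continuous.comp continuous_snd)).aestronglyMeasurable
  · rw [norm_mul, norm_mul, norm_smul]
    calc _ ≤ (K * ‖f z.1‖) * (‖φ z.1‖ * ‖ψ z.2‖) := by
          gcongr
          exact (fderiv ℝ (mollifier d n) (z.1 - z.2)).le_of_opNorm_le (hK _) _
      _ = _ := by ring

theorem integral_fderiv_mollifier_mul (n : ℕ) (hf : LocallyIntegrable f volume)
    (hφ : IsTestFunction φ) (hψ : IsTestFunction ψ) :
    ∫ z, fderiv ℝ (mollifier d n) (z.1 - z.2) (f z.1) * (φ z.1 * ψ z.2) ∂(volume.prod volume) =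
      ∫ u, φ u * fderiv ℝ (mollify n ψ) u (f u) := by
  rw [integral_prod _ (integrable_fderiv_mollifier_mul n hf hφ hψ)]
  refine integral_congr_ae (Eventually.of_forall fun u => ?_)
  simp only
  rw [fderiv_mollify_apply hψ.1.continuous.locallyIntegrable, ← integral_const_mul]
  refine integral_congr_ae (Eventually.of_forall fun v => ?_)
  simp only [smul_eq_mul]
  ring

/-- For test functions the commutator form splits, since `∇η_n` is odd, into two terms in which the
derivative falls on the mollified test functions. -/
theorem commutatorForm_eq (n : ℕ) (hf : LocallyIntegrable f volume)
    (hφ : IsTestFunction φ) (hψ : IsTestFunction ψ) :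
    commutatorForm n f φ ψ = (∫ u, φ u * fderiv ℝ (mollify n ψ) u (f u)) +
      ∫ u, ψ u * fderiv ℝ (mollify n φ) u (f u) := by
  have h1 := integrable_fderiv_mollifier_mul n hf hφ hψ
  have h2 := integrable_fderiv_mollifier_mul n hf hψ hφ
  have h3 : Integrable (fun z : EuclideanSpace ℝ (Fin d) × EuclideanSpace ℝ (Fin d) =>
      fderiv ℝ (mollifier d n) (z.swap.1 - z.swap.2) (f z.swap.1) * (ψ z.swap.1 * φ z.swap.2))
      (volume.prod volume) := h2.swap
  rw [← integral_fderiv_mollifier_mul n hf hφ hψ, ← integral_fderiv_mollifier_mul n hf hψ hφ,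
    ← integral_prod_swap (fun z : EuclideanSpace ℝ (Fin d) × EuclideanSpace ℝ (Fin d) =>
      fderiv ℝ (mollifier d n) (z.1 - z.2) (f z.1) * (ψ z.1 * φ z.2)),
    ← integral_add h1 h3, commutatorForm]
  refine integral_congr_ae (Eventually.of_forall fun z => ?_)
  simp only [commutator, Prod.fst_swap, Prod.snd_swap, map_sub]
  rw [← neg_sub z.1 z.2, fderiv_mollifier_neg, _root_.neg_apply]
  ring

theorem fderiv_mollify_apply_of_isTestFunction (n : ℕ) (hψ : IsTestFunction ψ)
    (u w : EuclideanSpace ℝ (Fin d)) :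
    fderiv ℝ (mollify n ψ) u w = mollify n (fun a => fderiv ℝ ψ a w) u := by
  have h := hψ.2.hasFDerivAt_convolution_right (ContinuousLinearMap.lsmul ℝ ℝ)
    ((continuous_mollifier (d := d) n).locallyIntegrable (μ := volume)) hψ.contDiff_one u
  rw [mollify, h.fderiv, convolution_precompR_apply _ (continuous_mollifier n).locallyIntegrable
    (hψ.2.fderiv ℝ) hψ.continuous_fderiv]
  rfl

theorem norm_mollify_le (n : ℕ) {h : EuclideanSpace ℝ (Fin d) → ℝ} {C : ℝ} (hC : ∀ y, ‖h y‖ ≤ C)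
    (u : EuclideanSpace ℝ (Fin d)) : ‖mollify n h u‖ ≤ C := by
  have hη : Integrable (fun y => mollifier d n (u - y)) volume :=
    ((bump d n).integrable_normed).comp_sub_left u
  have h1 : ∫ y, mollifier d n (u - y) = 1 := by
    rw [integral_sub_left_eq_self (mollifier d n) volume u]
    exact (bump d n).integral_normed
  rw [mollify_apply]
  refine (norm_integral_le_of_norm_le (hη.mul_const C) (Eventually.of_forall fun y => ?_)).trans ?_
  · rw [norm_smul, Real.norm_of_nonneg (mollifier_nonneg _ _)]
    exact mul_le_mul_of_nonneg_left (hC y) (mollifier_nonneg _ _)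
  · rw [integral_mul_const, h1, one_mul]

theorem integrable_mul_fderiv_apply (hf : LocallyIntegrable f volume) (hφ : IsTestFunction φ)
    (hψ : IsTestFunction ψ) : Integrable (fun u => φ u * fderiv ℝ ψ u (f u)) volume := by
  obtain ⟨K, hK⟩ := (hψ.2.fderiv ℝ).exists_bound_of_continuous hψ.continuous_fderiv
  have hφf : Integrable (fun u => φ u • f u) volume :=
    hf.integrable_smul_left_of_hasCompactSupport hφ.1.continuous hφ.2
  refine (hφf.norm.const_mul K).mono' ?_ (Eventually.of_forall fun u => ?_)
  · refine hφ.1.continuous.aestronglyMeasurable.mul ?_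
    exact (show Continuous fun w : (EuclideanSpace ℝ (Fin d) →L[ℝ] ℝ) × EuclideanSpace ℝ (Fin d) =>
        w.1 w.2 from continuous_fst.clm_apply continuous_snd).comp_aestronglyMeasurable
      (hψ.continuous_fderiv.aestronglyMeasurable.prodMk hf.aestronglyMeasurable)
  · rw [norm_mul, norm_smul]
    calc _ ≤ ‖φ u‖ * (K * ‖f u‖) := by
          gcongr
          exact (fderiv ℝ ψ u).le_of_opNorm_le (hK _) _
      _ = _ := by ring

theorem tendsto_integral_mul_fderiv_mollify (hf : LocallyIntegrable f volume)
    (hφ : IsTestFunction φ) (hψ : IsTestFunction ψ) :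
    Tendsto (fun n => ∫ u, φ u * fderiv ℝ (mollify n ψ) u (f u)) atTop
      (𝓝 (∫ u, φ u * fderiv ℝ ψ u (f u))) := by
  obtain ⟨K, hK⟩ := (hψ.2.fderiv ℝ).exists_bound_of_continuous hψ.continuous_fderiv
  have hφf : Integrable (fun u => φ u • f u) volume :=
    hf.integrable_smul_left_of_hasCompactSupport hφ.1.continuous hφ.2
  refine tendsto_integral_of_dominated_convergence (fun u => K * ‖φ u • f u‖) (fun n => ?_)
    (hφf.norm.const_mul K) (fun n => Eventually.of_forall fun u => ?_)
    (Eventually.of_forall fun u => ?_)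
  · refine hφ.1.continuous.aestronglyMeasurable.mul ?_
    exact (show Continuous fun w : (EuclideanSpace ℝ (Fin d) →L[ℝ] ℝ) × EuclideanSpace ℝ (Fin d) =>
        w.1 w.2 from continuous_fst.clm_apply continuous_snd).comp_aestronglyMeasurable
      (((contDiff_mollify hψ.1.continuous.locallyIntegrable).continuous_fderiv
        one_ne_zero).aestronglyMeasurable.prodMk hf.aestronglyMeasurable)
  · rw [norm_mul, norm_smul, fderiv_mollify_apply_of_isTestFunction n hψ]
    calc _ ≤ ‖φ u‖ * (K * ‖f u‖) := by
          gcongr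
          exact norm_mollify_le n (fun y => (fderiv ℝ ψ y).le_of_opNorm_le (hK _) _) u
      _ = _ := by ring
  · simp_rw [fderiv_mollify_apply_of_isTestFunction _ hψ]
    exact (tendsto_mollify_of_continuous
      (hψ.continuous_fderiv.clm_apply continuous_const) u).const_mul _

/-- For test functions the commutator form tends to `∫ ∇(φψ) · f`, which vanishes when `f` is
divergence-free. -/
theorem tendsto_commutatorForm_of_isTestFunction (hf : IsDivergenceFree f)
    (hφ : IsTestFunction φ) (hψ : IsTestFunction ψ) :
    Tendsto (fun n => commutatorForm n f φ ψ) atTop (𝓝 0) := by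
  have hlim : (∫ u, φ u * fderiv ℝ ψ u (f u)) + ∫ u, ψ u * fderiv ℝ φ u (f u) = 0 := by
    rw [← integral_add (integrable_mul_fderiv_apply hf.1 hφ hψ)
      (integrable_mul_fderiv_apply hf.1 hψ hφ), ← hf.2 _ (hφ.mul hψ)]
    refine integral_congr_ae (Eventually.of_forall fun u => ?_)
    have h1 : HasFDerivAt φ (fderiv ℝ φ u) u :=
      (hφ.contDiff_one.differentiable one_ne_zero).differentiableAt.hasFDerivAt
    have h2 : HasFDerivAt ψ (fderiv ℝ ψ u) u :=
      (hψ.contDiff_one.differentiable one_ne_zero).differentiableAt.hasFDerivAt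
    have h3 : fderiv ℝ (fun x => φ x * ψ x) u = _ := (h1.mul h2).fderiv
    simp only [h3]
    simp
  simp_rw [fun n => commutatorForm_eq n hf.1 hφ hψ]
  rw [← hlim]
  exact (tendsto_integral_mul_fderiv_mollify hf.1 hφ hψ).add
    (tendsto_integral_mul_fderiv_mollify hf.1 hψ hφ)

end Smooth

/-! ### The limit of the commutator form for general weights -/

section General

theorem eLpNorm_ofReal_eq {α : Type*} [MeasurableSpace α] {μ : Measure α} (R : α → ℝ) {q : ℝ}
    (hq : 0 < q) : eLpNorm R (ENNReal.ofReal q) μ = (∫⁻ v, ‖R v‖ₑ ^ q ∂μ) ^ (1 / q) := by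
  rw [eLpNorm_eq_lintegral_rpow_enorm_toReal (by simpa using hq) ENNReal.ofReal_ne_top,
    ENNReal.toReal_ofReal hq.le]

theorem commutatorForm_swap (n : ℕ) (R₁ R₂ : EuclideanSpace ℝ (Fin d) → ℝ) :
    commutatorForm n f R₁ R₂ = commutatorForm n f R₂ R₁ := by
  rw [commutatorForm, ← integral_prod_swap]
  refine integral_congr_ae (Eventually.of_forall fun z => ?_)
  simp only [commutator_swap, Prod.fst_swap, Prod.snd_swap, mul_comm (R₁ z.2)]

theorem enorm_commutatorForm_le (n : ℕ) (R₁ R₂ : EuclideanSpace ℝ (Fin d) → ℝ) :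
    ‖commutatorForm n f R₁ R₂‖ₑ ≤
      ∫⁻ z, ‖commutator n f z‖ₑ * (‖R₁ z.1‖ₑ * ‖R₂ z.2‖ₑ) ∂(volume.prod volume) := by
  refine (enorm_integral_le_lintegral_enorm _).trans (le_of_eq (lintegral_congr fun z => ?_))
  rw [enorm_mul, enorm_mul]

/-- The commutator form of a divergence-free Sobolev field vanishes in the limit, on bounded weights
in `L^q`: by density and the uniform bound, this reduces to test functions. -/
theorem tendsto_commutatorForm {r q : ℝ} (hrq : r.HolderConjugate q)
    {G : EuclideanSpace ℝ (Fin d) → EuclideanSpace ℝ (Fin d) →L[ℝ] EuclideanSpace ℝ (Fin d)}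
    (hf : IsDivergenceFree f) (hfm : StronglyMeasurable f) (h : HasWeakGradient f G)
    (hG : Measurable fun y => ‖G y‖ₑ) (hGr : ∫⁻ u, ‖G u‖ₑ ^ r ≠ ∞)
    {R₁ R₂ : EuclideanSpace ℝ (Fin d) → ℝ} (hm₁ : Measurable R₁) (hm₂ : Measurable R₂)
    (hR₁ : MemLp R₁ (ENNReal.ofReal q) volume) (hR₂ : MemLp R₂ (ENNReal.ofReal q) volume)
    {c : ℝ≥0} (hc : ∀ u, ‖R₁ u‖ₑ ≤ c) :
    Tendsto (fun n => commutatorForm n f R₁ R₂) atTop (𝓝 0) := by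
  obtain ⟨K, hK⟩ := exists_lintegral_enorm_commutator_le d hrq
  have hq0 : 0 < q := hrq.symm.pos
  have hq1 : 1 ≤ ENNReal.ofReal q := by
    rw [← ENNReal.ofReal_one]; exact ENNReal.ofReal_le_ofReal hrq.symm.lt.le
  set A : ℝ≥0∞ := K * (∫⁻ u, ‖G u‖ₑ ^ r) ^ (1 / r) with hA
  have hAt : A ≠ ∞ := ENNReal.mul_ne_top ENNReal.coe_ne_top
    (ENNReal.rpow_ne_top_of_nonneg (by have := hrq.pos; positivity) hGr)
  have hbound : ∀ n {S₁ S₂ : EuclideanSpace ℝ (Fin d) → ℝ} {c : ℝ≥0∞}, Measurable S₂ →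
      (∀ u, ‖S₁ u‖ₑ ≤ c) →
      ∫⁻ z, ‖commutator n f z‖ₑ * (‖S₁ z.1‖ₑ * ‖S₂ z.2‖ₑ) ∂(volume.prod volume) ≤
        A * c * eLpNorm S₂ (ENNReal.ofReal q) volume := by
    intro n S₁ S₂ c hS₂ hc
    refine (hK n h hG hS₂.enorm hc).trans (le_of_eq ?_)
    rw [eLpNorm_ofReal_eq _ hq0, hA]
    ring
  have hcm : ∀ n, Measurable (commutator n f) := fun n => by
    have h1 := measurable_commutator (S := Unit) (f := fun _ => f)
      (hfm.comp_measurable measurable_snd) n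
    exact h1.comp (measurable_prodMk_left (x := ()))
  have hint : ∀ n {S₁ S₂ : EuclideanSpace ℝ (Fin d) → ℝ} {c : ℝ≥0}, Measurable S₁ →
      Measurable S₂ → (∀ u, ‖S₁ u‖ₑ ≤ c) → MemLp S₂ (ENNReal.ofReal q) volume →
      Integrable (fun z => commutator n f z * (S₁ z.1 * S₂ z.2)) (volume.prod volume) := by
    intro n S₁ S₂ c hS₁ hS₂ hc hL
    refine ⟨((hcm n).mul ((hS₁.comp measurable_fst).mul
      (hS₂.comp measurable_snd))).aestronglyMeasurable, ?_⟩
    refine lt_of_le_of_lt (le_of_eq (lintegral_congr fun z => by rw [enorm_mul, enorm_mul]))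
      ((hbound n hS₂ hc).trans_lt ?_)
    exact ENNReal.mul_lt_top (ENNReal.mul_lt_top hAt.lt_top ENNReal.coe_lt_top) hL.2
  -- Approximation of the second weight, then of the first one, by test functions.
  have happrox : ∀ {S : EuclideanSpace ℝ (Fin d) → ℝ}, MemLp S (ENNReal.ofReal q) volume →
      ∀ c : ℝ≥0, ∀ ε > 0, ∃ φ, IsTestFunction φ ∧
        A * c * eLpNorm (S - φ) (ENNReal.ofReal q) volume ≤ ENNReal.ofReal ε := by
    intro S hS c ε hε
    have hB : A * c ≠ ∞ := ENNReal.mul_ne_top hAt ENNReal.coe_ne_top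
    obtain ⟨φ, h1, h2, h3⟩ := hS.exist_eLpNorm_sub_le ENNReal.ofReal_ne_top hq1
      (show 0 < ε / ((A * c).toReal + 1) by positivity)
    refine ⟨φ, ⟨h2, h1⟩, ?_⟩
    calc A * c * eLpNorm (S - φ) (ENNReal.ofReal q) volume
        ≤ ENNReal.ofReal (A * c).toReal * ENNReal.ofReal (ε / ((A * c).toReal + 1)) := by
          rw [ENNReal.ofReal_toReal hB]
          gcongr
      _ ≤ ENNReal.ofReal ε := by
          rw [← ENNReal.ofReal_mul ENNReal.toReal_nonneg]
          refine ENNReal.ofReal_le_ofReal ?_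
          rw [mul_div_assoc', div_le_iff₀ (by positivity)]
          nlinarith [ENNReal.toReal_nonneg (a := A * c)]
  rw [Metric.tendsto_atTop]
  intro ε hε
  obtain ⟨ψ, hψ, hψε⟩ := happrox hR₂ c (ε / 4) (by positivity)
  obtain ⟨c', hc'⟩ := hψ.2.exists_bound_of_continuous hψ.1.continuous
  have hc'' : ∀ u, ‖ψ u‖ₑ ≤ (c'.toNNReal : ℝ≥0∞) := fun u => by
    rw [← ofReal_norm]
    exact ENNReal.ofReal_le_ofReal (hc' u)
  obtain ⟨φ, hφ, hφε⟩ := happrox hR₁ c'.toNNReal (ε / 4) (by positivity)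
  have hφm := hφ.1.continuous.measurable
  have hψm := hψ.1.continuous.measurable
  have hφL : MemLp φ (ENNReal.ofReal q) volume :=
    hφ.1.continuous.memLp_of_hasCompactSupport hφ.2
  have hψL : MemLp ψ (ENNReal.ofReal q) volume :=
    hψ.1.continuous.memLp_of_hasCompactSupport hψ.2
  obtain ⟨n₀, hn₀⟩ := Metric.tendsto_atTop.1
    (tendsto_commutatorForm_of_isTestFunction hf hφ hψ) (ε / 4) (by positivity)
  refine ⟨n₀, fun n hn => ?_⟩
  have e1 : commutatorForm n f R₁ R₂ =
      commutatorForm n f R₁ (R₂ - ψ) + commutatorForm n f R₁ ψ := by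
    rw [commutatorForm, commutatorForm, commutatorForm,
      ← integral_add (hint n hm₁ (hm₂.sub hψm) hc (hR₂.sub hψL)) (hint n hm₁ hψm hc hψL)]
    refine integral_congr_ae (Eventually.of_forall fun z => ?_)
    simp only [Pi.sub_apply]
    ring
  have e2 : commutatorForm n f R₁ ψ =
      commutatorForm n f (R₁ - φ) ψ + commutatorForm n f φ ψ := by
    rw [commutatorForm_swap n R₁, commutatorForm_swap n (R₁ - φ), commutatorForm_swap n φ,
      commutatorForm, commutatorForm, commutatorForm,
      ← integral_add (hint n hψm (hm₁.sub hφm) hc'' (hR₁.sub hφL)) (hint n hψm hφm hc'' hφL)]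
    refine integral_congr_ae (Eventually.of_forall fun z => ?_)
    simp only [Pi.sub_apply]
    ring
  have b1 : ‖commutatorForm n f R₁ (R₂ - ψ)‖ ≤ ε / 4 := by
    have := (enorm_commutatorForm_le n R₁ (R₂ - ψ)).trans
      ((hbound n (hm₂.sub hψm) hc).trans hψε)
    rwa [← ofReal_norm, ENNReal.ofReal_le_ofReal_iff (by positivity)] at this
  have b2 : ‖commutatorForm n f (R₁ - φ) ψ‖ ≤ ε / 4 := by
    rw [commutatorForm_swap]
    have := (enorm_commutatorForm_le n ψ (R₁ - φ)).trans
      ((hbound n (hm₁.sub hφm) hc'').trans hφε)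
    rwa [← ofReal_norm, ENNReal.ofReal_le_ofReal_iff (by positivity)] at this
  have b3 := hn₀ n hn
  rw [dist_zero_right] at b3 ⊢
  rw [e1, e2]
  calc _ ≤ ‖commutatorForm n f R₁ (R₂ - ψ)‖ + (‖commutatorForm n f (R₁ - φ) ψ‖ +
        ‖commutatorForm n f φ ψ‖) :=
        (norm_add_le _ _).trans (add_le_add le_rfl (norm_add_le _ _))
    _ < ε := by linarith

end General

end

/-! ### Measures with bounded density -/

section

variable {d : ℕ}

section Density

variable {μ μ₁ μ₂ : Measure (EuclideanSpace ℝ (Fin d))} {ρ ρ₁ ρ₂ : EuclideanSpace ℝ (Fin d) → ℝ≥0}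
  {c : ℝ≥0}

/-- The measure `μ` has the density `ρ`, which is everywhere, not just almost everywhere, at most
`c`. -/
structure HasBoundedDensity (μ : Measure (EuclideanSpace ℝ (Fin d)))
    (ρ : EuclideanSpace ℝ (Fin d) → ℝ≥0) (c : ℝ≥0) : Prop where
  measurable : Measurable ρ
  le : ∀ x, ρ x ≤ c
  eq_withDensity : μ = volume.withDensity fun x => (ρ x : ℝ≥0∞)

theorem exists_hasBoundedDensity [IsFiniteMeasure μ] (h : μ ≤ (c : ℝ≥0∞) • volume) :
    ∃ ρ, HasBoundedDensity μ ρ c := by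
  have hac : μ ≪ volume := Measure.absolutelyContinuous_of_le_smul h
  have hm := Measure.measurable_rnDeriv μ (volume : Measure (EuclideanSpace ℝ (Fin d)))
  have hle : μ.rnDeriv volume ≤ᵐ[volume] fun _ => (c : ℝ≥0∞) := by
    refine ae_le_of_forall_setLIntegral_le_of_sigmaFinite hm fun s _ _ => ?_
    refine (Measure.setLIntegral_rnDeriv_le s).trans ((h s).trans (le_of_eq ?_))
    rw [setLIntegral_const, Measure.smul_apply, smul_eq_mul]
  refine ⟨fun x => (min (μ.rnDeriv volume x) c).toNNReal,
    (hm.min measurable_const).ennreal_toNNReal,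
    fun x => ENNReal.coe_le_coe.1 (ENNReal.coe_toNNReal_le_self.trans (min_le_right _ _)), ?_⟩
  conv_lhs => rw [← Measure.withDensity_rnDeriv_eq μ volume hac]
  refine withDensity_congr_ae ?_
  filter_upwards [hle] with x hx
  rw [min_eq_left hx, ENNReal.coe_toNNReal (hx.trans_lt ENNReal.coe_lt_top).ne]

theorem hasBoundedDensity_restrict {s : Set (EuclideanSpace ℝ (Fin d))} (hs : MeasurableSet s) :
    HasBoundedDensity (volume.restrict s) (s.indicator 1) 1 where
  measurable := measurable_one.indicator hs
  le x := indicator_le_self' (fun _ _ => zero_le) x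
  eq_withDensity := by
    rw [← withDensity_indicator_one hs]
    congr 1
    funext x
    by_cases hx : x ∈ s <;> simp [hx]

theorem HasBoundedDensity.lintegral_eq (h : HasBoundedDensity μ ρ c) :
    ∫⁻ x, (ρ x : ℝ≥0∞) = μ univ := by
  rw [h.eq_withDensity, withDensity_apply _ MeasurableSet.univ, Measure.restrict_univ]

theorem HasBoundedDensity.lintegral_rpow_le (h : HasBoundedDensity μ ρ c) {q : ℝ} (hq : 1 < q) :
    ∫⁻ x, (ρ x : ℝ≥0∞) ^ q ≤ (c : ℝ≥0∞) ^ (q - 1) * μ univ := by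
  rw [← h.lintegral_eq, ← lintegral_const_mul _ h.measurable.coe_nnreal_ennreal]
  refine lintegral_mono fun x => ?_
  have hx : (ρ x : ℝ≥0∞) ^ q = (ρ x : ℝ≥0∞) ^ (q - 1) * ρ x := by
    conv_lhs => rw [← sub_add_cancel q 1]
    rw [ENNReal.rpow_add_of_nonneg _ _ (by linarith) zero_le_one, ENNReal.rpow_one]
  rw [hx]
  gcongr
  exact h.le x

theorem enorm_coe_nnreal (x : ℝ≥0) : ‖(x : ℝ)‖ₑ = x := by
  rw [Real.enorm_of_nonneg x.coe_nonneg, ENNReal.ofReal_coe_nnreal]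

theorem HasBoundedDensity.memLp [IsFiniteMeasure μ] (h : HasBoundedDensity μ ρ c) {q : ℝ}
    (hq : 1 < q) : MemLp (fun x => (ρ x : ℝ)) (ENNReal.ofReal q) volume := by
  refine ⟨h.measurable.coe_nnreal_real.aestronglyMeasurable, ?_⟩
  rw [eLpNorm_ofReal_eq _ (by linarith)]
  simp_rw [enorm_coe_nnreal]
  refine ENNReal.rpow_lt_top_of_nonneg (by positivity) ((h.lintegral_rpow_le hq).trans_lt ?_).ne
  exact ENNReal.mul_lt_top (ENNReal.rpow_lt_top_of_nonneg (by linarith) ENNReal.coe_ne_top)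
    (measure_lt_top _ _)

theorem HasBoundedDensity.prod_eq (h₁ : HasBoundedDensity μ₁ ρ₁ c)
    (h₂ : HasBoundedDensity μ₂ ρ₂ c) : μ₁.prod μ₂ = (volume.prod volume).withDensity
      fun z => ((ρ₁ z.1 * ρ₂ z.2 : ℝ≥0) : ℝ≥0∞) := by
  rw [h₁.eq_withDensity, h₂.eq_withDensity, prod_withDensity h₁.measurable.coe_nnreal_ennreal
    h₂.measurable.coe_nnreal_ennreal]
  simp only [ENNReal.coe_mul]

theorem HasBoundedDensity.measurable_mul (h₁ : HasBoundedDensity μ₁ ρ₁ c)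
    (h₂ : HasBoundedDensity μ₂ ρ₂ c) :
    Measurable fun z : EuclideanSpace ℝ (Fin d) × EuclideanSpace ℝ (Fin d) => ρ₁ z.1 * ρ₂ z.2 :=
  (h₁.measurable.comp measurable_fst).mul (h₂.measurable.comp measurable_snd)

theorem HasBoundedDensity.integral_commutator (h₁ : HasBoundedDensity μ₁ ρ₁ c)
    (h₂ : HasBoundedDensity μ₂ ρ₂ c) (n : ℕ)
    (f : EuclideanSpace ℝ (Fin d) → EuclideanSpace ℝ (Fin d)) :
    ∫ z, commutator n f z ∂(μ₁.prod μ₂) =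
      commutatorForm n f (fun x => ρ₁ x) (fun x => ρ₂ x) := by
  rw [h₁.prod_eq h₂, integral_withDensity_eq_integral_smul (h₁.measurable_mul h₂), commutatorForm]
  refine integral_congr_ae (Eventually.of_forall fun z => ?_)
  simp only [NNReal.smul_def, smul_eq_mul, NNReal.coe_mul]
  ring

theorem HasBoundedDensity.lintegral_commutator (h₁ : HasBoundedDensity μ₁ ρ₁ c)
    (h₂ : HasBoundedDensity μ₂ ρ₂ c) (n : ℕ)
    {f : EuclideanSpace ℝ (Fin d) → EuclideanSpace ℝ (Fin d)} (hf : Measurable (commutator n f)) :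
    ∫⁻ z, ‖commutator n f z‖ₑ ∂(μ₁.prod μ₂) =
      ∫⁻ z, ‖commutator n f z‖ₑ * ((ρ₁ z.1 : ℝ≥0∞) * ρ₂ z.2) ∂(volume.prod volume) := by
  rw [h₁.prod_eq h₂, lintegral_withDensity_eq_lintegral_mul _
    (h₁.measurable_mul h₂).coe_nnreal_ennreal hf.enorm]
  refine lintegral_congr fun z => ?_
  simp only [Pi.mul_apply, ENNReal.coe_mul]
  ring

theorem integrable_mollifier_sub [IsFiniteMeasure μ₁] [IsFiniteMeasure μ₂] (n : ℕ) :
    Integrable (fun z : EuclideanSpace ℝ (Fin d) × EuclideanSpace ℝ (Fin d) =>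
      mollifier d n (z.1 - z.2)) (μ₁.prod μ₂) := by
  obtain ⟨K, hK⟩ := (hasCompactSupport_mollifier (d := d) n).exists_bound_of_continuous
    (continuous_mollifier n)
  exact Integrable.of_bound ((continuous_mollifier n).comp
    (continuous_fst.sub continuous_snd)).aestronglyMeasurable K (Eventually.of_forall fun z => hK _)

/-- The mollified pairing `∬ η_n(u - v) dμ₁(u) dμ₂(v)` tends to the integral with respect to `μ₁` of
the bounded density of `μ₂`. -/
theorem HasBoundedDensity.tendsto_integral_mollifier [IsFiniteMeasure μ₁] [IsFiniteMeasure μ₂]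
    (hμ : μ₁ ≪ volume) (h₂ : HasBoundedDensity μ₂ ρ₂ c) :
    Tendsto (fun n => ∫ z, mollifier d n (z.1 - z.2) ∂(μ₁.prod μ₂)) atTop
      (𝓝 (∫ u, (ρ₂ u : ℝ) ∂μ₁)) := by
  have hint : Integrable (fun x => (ρ₂ x : ℝ)) volume := by
    refine ⟨h₂.measurable.coe_nnreal_real.aestronglyMeasurable, ?_⟩
    simp_rw [HasFiniteIntegral, enorm_coe_nnreal]
    rw [h₂.lintegral_eq]
    exact measure_lt_top _ _
  have hE : ∀ n, ∫ z, mollifier d n (z.1 - z.2) ∂(μ₁.prod μ₂) =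
      ∫ u, mollify n (fun x => (ρ₂ x : ℝ)) u ∂μ₁ := by
    intro n
    rw [integral_prod _ (integrable_mollifier_sub n)]
    refine integral_congr_ae (Eventually.of_forall fun u => ?_)
    simp only
    rw [h₂.eq_withDensity, integral_withDensity_eq_integral_smul h₂.measurable, mollify_apply]
    refine integral_congr_ae (Eventually.of_forall fun v => ?_)
    simp only [NNReal.smul_def, smul_eq_mul]
    ring
  simp_rw [hE]
  refine tendsto_integral_of_dominated_convergence (fun _ => (c : ℝ)) (fun n => ?_)
    (integrable_const _) (fun n => Eventually.of_forall fun u => ?_) ?_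
  · exact (contDiff_mollify hint.locallyIntegrable).continuous.aestronglyMeasurable
  · refine norm_mollify_le n (fun y => ?_) u
    rw [Real.norm_of_nonneg (NNReal.coe_nonneg _)]
    exact_mod_cast h₂.le y
  · exact hμ.ae_le (ae_tendsto_mollify hint.locallyIntegrable)

/-- A measure whose density equals `1` almost everywhere for the measure itself is dominated by
Lebesgue measure. -/
theorem HasBoundedDensity.le_volume (h : HasBoundedDensity μ ρ c) (h1 : ∀ᵐ x ∂μ, ρ x = 1) :
    μ ≤ volume := by
  refine Measure.le_iff.2 fun s hs => ?_
  have hS : MeasurableSet {x | ρ x = 1} := h.measurable (measurableSet_singleton 1)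
  calc μ s = μ (s ∩ {x | ρ x = 1}) := (measure_inter_conull
        (ae_iff.1 h1)).symm
    _ = ∫⁻ x in s ∩ {x | ρ x = 1}, (ρ x : ℝ≥0∞) := by
        conv_lhs => rw [h.eq_withDensity]
        rw [withDensity_apply _ (hs.inter hS)]
    _ = ∫⁻ x in s ∩ {x | ρ x = 1}, 1 :=
        setLIntegral_congr_fun (hs.inter hS) fun x hx => by simp [hx.2.out]
    _ ≤ volume s := by
        rw [setLIntegral_one]
        exact measure_mono inter_subset_left

end Density

end

/-! ### Flows of divergence-free fields -/

section

variable {d : ℕ} {T L : ℝ} {p : ℝ≥0∞}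
  {b X β Y : ℝ → EuclideanSpace ℝ (Fin d) → EuclideanSpace ℝ (Fin d)}
  {D G : ℝ → EuclideanSpace ℝ (Fin d) → EuclideanSpace ℝ (Fin d) →L[ℝ] EuclideanSpace ℝ (Fin d)}
  {N : Set (EuclideanSpace ℝ (Fin d))} {μ μ₁ μ₂ : Measure (EuclideanSpace ℝ (Fin d))}

theorem IsDivergenceFree.congr_ae {f g : EuclideanSpace ℝ (Fin d) → EuclideanSpace ℝ (Fin d)}
    (hf : IsDivergenceFree f) (hfg : f =ᵐ[volume] g) : IsDivergenceFree g := by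
  refine ⟨hf.1.congr hfg, fun φ hφ => ?_⟩
  rw [← hf.2 φ hφ]
  exact integral_congr_ae (hfg.mono fun x hx => by simp only [hx])

theorem IsMeasurableVersion.measurable_flow_apply (h : IsMeasurableVersion T L b X D β Y G N)
    (s : ℝ) : Measurable (Y s) :=
  h.measurable_flow.comp measurable_prodMk_left

theorem IsMeasurableVersion.map_le_smul (h : IsMeasurableVersion T L b X D β Y G N)
    (hμ : μ ≤ volume) {s : ℝ} (hs : s ∈ Icc 0 T) :
    Measure.map (Y s) μ ≤ (L.toNNReal : ℝ≥0∞) • volume :=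
  (Measure.map_mono hμ (h.measurable_flow_apply s)).trans (h.map_le s hs)

theorem IsMeasurableVersion.measurable_commutator_flow
    (h : IsMeasurableVersion T L b X D β Y G N) (n : ℕ) :
    Measurable fun w : ℝ × EuclideanSpace ℝ (Fin d) × EuclideanSpace ℝ (Fin d) =>
      commutator n (β w.1) (Y w.1 w.2.1, Y w.1 w.2.2) := by
  have h1 := measurable_commutator h.stronglyMeasurable n
  have h2 : Measurable fun w : ℝ × EuclideanSpace ℝ (Fin d) × EuclideanSpace ℝ (Fin d) =>
      (w.1, Y w.1 w.2.1, Y w.1 w.2.2) :=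
    measurable_fst.prodMk ((h.measurable_flow.comp (measurable_fst.prodMk
      (measurable_fst.comp measurable_snd))).prodMk (h.measurable_flow.comp (measurable_fst.prodMk
      (measurable_snd.comp measurable_snd))))
  simpa only [Function.comp_def] using h1.comp h2

theorem IsMeasurableVersion.measurable_commutator_apply
    (h : IsMeasurableVersion T L b X D β Y G N) (n : ℕ) (s : ℝ) :
    Measurable (commutator n (β s)) :=
  (measurable_commutator h.stronglyMeasurable n).comp measurable_prodMk_left

/-- The integrated commutator along the flow is bounded, uniformly in the mollification scale, by
the `L^r` norm of the gradient. -/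
theorem IsMeasurableVersion.exists_lintegral_commutator_flow_le
    (h : IsMeasurableVersion T L b X D β Y G N) [IsFiniteMeasure μ₁] [IsFiniteMeasure μ₂]
    (hμ₁ : μ₁ ≤ volume) (hμ₂ : μ₂ ≤ volume) {r q : ℝ} (hrq : r.HolderConjugate q) :
    ∃ K : ℝ≥0, ∀ n, ∀ᵐ s ∂(volume.restrict (Icc 0 T)),
      ∫⁻ z, ‖commutator n (β s) (Y s z.1, Y s z.2)‖ₑ ∂(μ₁.prod μ₂) ≤
        K * (∫⁻ u, ‖G s u‖ₑ ^ r) ^ (1 / r) := by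
  obtain ⟨K, hK⟩ := exists_lintegral_enorm_commutator_le d hrq
  have hq : 1 < q := hrq.symm.lt
  set c : ℝ≥0 := L.toNNReal
  set M : ℝ≥0∞ := ((c : ℝ≥0∞) ^ (q - 1) * μ₂ univ) ^ (1 / q) with hM
  have hMt : M ≠ ∞ := ENNReal.rpow_ne_top_of_nonneg (by positivity) (ENNReal.mul_ne_top
    (ENNReal.rpow_ne_top_of_nonneg (by linarith) ENNReal.coe_ne_top) (measure_ne_top _ _))
  refine ⟨K * c * M.toNNReal, fun n => ?_⟩
  filter_upwards [h.hasWeakGradient, ae_restrict_mem measurableSet_Icc] with s hW hs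
  have hY := h.measurable_flow_apply s
  obtain ⟨ρ₁, hρ₁⟩ := exists_hasBoundedDensity (h.map_le_smul hμ₁ hs)
  obtain ⟨ρ₂, hρ₂⟩ := exists_hasBoundedDensity (h.map_le_smul hμ₂ hs)
  have hm := h.measurable_commutator_apply n s
  calc ∫⁻ z, ‖commutator n (β s) (Y s z.1, Y s z.2)‖ₑ ∂(μ₁.prod μ₂)
      = ∫⁻ z, ‖commutator n (β s) z‖ₑ ∂((μ₁.map (Y s)).prod (μ₂.map (Y s))) := by
        rw [Measure.map_prod_map _ _ hY hY, lintegral_map hm.enorm (hY.prodMap hY)]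
        rfl
    _ = ∫⁻ z, ‖commutator n (β s) z‖ₑ * ((ρ₁ z.1 : ℝ≥0∞) * ρ₂ z.2) ∂(volume.prod volume) :=
        hρ₁.lintegral_commutator hρ₂ n hm
    _ ≤ K * c * (∫⁻ u, ‖G s u‖ₑ ^ r) ^ (1 / r) * (∫⁻ v, (ρ₂ v : ℝ≥0∞) ^ q) ^ (1 / q) :=
        hK n hW (h.measurable_enorm_grad s) hρ₂.measurable.coe_nnreal_ennreal
          (R₁ := fun u => ρ₁ u) fun u => ENNReal.coe_le_coe.2 (hρ₁.le u)
    _ ≤ K * c * (∫⁻ u, ‖G s u‖ₑ ^ r) ^ (1 / r) * M := by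
        gcongr
        refine ENNReal.rpow_le_rpow ((hρ₂.lintegral_rpow_le hq).trans (le_of_eq ?_))
          (by positivity)
        rw [Measure.map_apply hY MeasurableSet.univ, preimage_univ]
    _ = _ := by
        rw [ENNReal.coe_mul, ENNReal.coe_mul, ENNReal.coe_toNNReal hMt]
        ring

/-- The commutator identity: transporting the mollified pairing of `μ₁` and `μ₂` by the flow changes
it by the time integral of the commutator. -/
theorem IsMeasurableVersion.integral_mollifier_flow_sub
    (h : IsMeasurableVersion T L b X D β Y G N) [IsFiniteMeasure μ₁] [IsFiniteMeasure μ₂]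
    (hμ₁ : μ₁ ≤ volume) (hμ₂ : μ₂ ≤ volume) {t : ℝ} (ht : t ∈ Icc 0 T) (n : ℕ)
    (hfin : ∫⁻ s in Icc 0 T, ∫⁻ z, ‖commutator n (β s) (Y s z.1, Y s z.2)‖ₑ ∂(μ₁.prod μ₂) ≠ ∞) :
    (∫ z, mollifier d n (Y t z.1 - Y t z.2) ∂(μ₁.prod μ₂)) -
        ∫ z, mollifier d n (z.1 - z.2) ∂(μ₁.prod μ₂) =
      ∫ s in Ioc 0 t, ∫ z, commutator n (β s) (Y s z.1, Y s z.2) ∂(μ₁.prod μ₂) := by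
  have hT : 0 ≤ T := ht.1.trans ht.2
  have hY := h.measurable_flow_apply t
  have hN : ∀ᵐ x ∂(volume : Measure (EuclideanSpace ℝ (Fin d))), x ∉ N :=
    measure_eq_zero_iff_ae_notMem.1 h.volume_eq_zero
  have hN₁ : ∀ᵐ z ∂(μ₁.prod μ₂), z.1 ∉ N :=
    Measure.quasiMeasurePreserving_fst.ae ((Measure.absolutelyContinuous_of_le hμ₁).ae_le hN)
  have hN₂ : ∀ᵐ z ∂(μ₁.prod μ₂), z.2 ∉ N :=
    Measure.quasiMeasurePreserving_snd.ae ((Measure.absolutelyContinuous_of_le hμ₂).ae_le hN)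
  have hmeas := h.measurable_commutator_flow n
  have hint : Integrable (Function.uncurry
      fun (s : ℝ) (z : EuclideanSpace ℝ (Fin d) × EuclideanSpace ℝ (Fin d)) =>
        commutator n (β s) (Y s z.1, Y s z.2))
      ((volume.restrict (Ioc 0 t)).prod (μ₁.prod μ₂)) := by
    refine ⟨hmeas.aestronglyMeasurable, ?_⟩
    change ∫⁻ w, ‖commutator n (β w.1) (Y w.1 w.2.1, Y w.1 w.2.2)‖ₑ
      ∂((volume.restrict (Ioc 0 t)).prod (μ₁.prod μ₂)) < ∞
    rw [lintegral_prod _ hmeas.enorm.aemeasurable]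
    exact (lintegral_mono_set (Ioc_subset_Icc_self.trans (Icc_subset_Icc_right ht.2))).trans_lt
      hfin.lt_top
  have hmt : Integrable (fun z => mollifier d n (Y t z.1 - Y t z.2)) (μ₁.prod μ₂) := by
    have := integrable_mollifier_sub (μ₁ := μ₁.map (Y t)) (μ₂ := μ₂.map (Y t)) n
    rw [Measure.map_prod_map _ _ hY hY] at this
    exact this.comp_measurable (hY.prodMap hY)
  rw [integral_integral_swap hint, ← integral_sub hmt (integrable_mollifier_sub n)]
  refine integral_congr_ae ?_
  filter_upwards [hN₁, hN₂] with z h₁ h₂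
  have hi : ∀ x ∉ N, ∀ s ∈ Icc 0 t, IntervalIntegrable (fun s => β s (Y s x)) volume 0 s :=
    fun x hx s hs => (h.intervalIntegrable x hx).mono_set
      (by rw [uIcc_of_le hs.1, uIcc_of_le hT]; exact Icc_subset_Icc_right (hs.2.trans ht.2))
  have ht' : t ∈ Icc 0 t := ⟨ht.1, le_rfl⟩
  have key := sub_eq_integral_fderiv_of_eq_integral (contDiff_mollifier (d := d) (m := 1) n) ht.1
    (γ := fun s => Y s z.1 - Y s z.2) (v := fun s => β s (Y s z.1) - β s (Y s z.2))
    ((hi _ h₁ t ht').sub (hi _ h₂ t ht')) fun s hs => by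
      have hsT : s ∈ Icc 0 T := ⟨hs.1, hs.2.trans ht.2⟩
      rw [intervalIntegral.integral_sub (hi _ h₁ s hs) (hi _ h₂ s hs), h.flow_zero hT h₁,
        h.flow_zero hT h₂, h.integral_eq _ h₁ s hsT, h.integral_eq _ h₂ s hsT]
      abel
  rw [h.flow_zero hT h₁, h.flow_zero hT h₂, intervalIntegral.integral_of_le ht.1] at key
  exact key

/-- For a divergence-free field the mollified pairings are conserved in the limit: the commutators
tend to `0` at almost every time, and are dominated by the gradient norm. -/
theorem IsMeasurableVersion.tendsto_integral_commutator_flow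
    (h : IsMeasurableVersion T L b X D β Y G N) [IsFiniteMeasure μ₁] [IsFiniteMeasure μ₂]
    (hμ₁ : μ₁ ≤ volume) (hμ₂ : μ₂ ≤ volume) {r q : ℝ} (hrq : r.HolderConjugate q)
    (hG : ∫⁻ s in Icc 0 T, (∫⁻ u, ‖G s u‖ₑ ^ r) ^ (1 / r) ≠ ∞)
    (hdiv : ∀ᵐ s ∂(volume.restrict (Icc 0 T)), IsDivergenceFree (b s)) {t : ℝ}
    (ht : t ∈ Icc 0 T) :
    Tendsto (fun n => (∫ z, mollifier d n (Y t z.1 - Y t z.2) ∂(μ₁.prod μ₂)) -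
        ∫ z, mollifier d n (z.1 - z.2) ∂(μ₁.prod μ₂)) atTop (𝓝 0) := by
  obtain ⟨K, hK⟩ := h.exists_lintegral_commutator_flow_le hμ₁ hμ₂ hrq
  have hr0 := hrq.pos
  have hGm : Measurable fun s => (∫⁻ u, ‖G s u‖ₑ ^ r) ^ (1 / r) :=
    (Measurable.lintegral_prod_right' (f := fun z : ℝ × EuclideanSpace ℝ (Fin d) =>
      ‖G z.1 z.2‖ₑ ^ r) (h.stronglyMeasurable_grad.enorm.pow_const r)).pow_const _
  have hKG : ∫⁻ s in Icc 0 T, K * (∫⁻ u, ‖G s u‖ₑ ^ r) ^ (1 / r) ≠ ∞ := by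
    rw [lintegral_const_mul _ hGm]
    exact ENNReal.mul_ne_top ENNReal.coe_ne_top hG
  have hsub : Ioc 0 t ⊆ Icc 0 T := Ioc_subset_Icc_self.trans (Icc_subset_Icc_right ht.2)
  have hfin : ∀ n, ∫⁻ s in Icc 0 T,
      ∫⁻ z, ‖commutator n (β s) (Y s z.1, Y s z.2)‖ₑ ∂(μ₁.prod μ₂) ≠ ∞ := fun n =>
    ((lintegral_mono_ae (hK n)).trans_lt hKG.lt_top).ne
  simp_rw [fun n => h.integral_mollifier_flow_sub hμ₁ hμ₂ ht n (hfin n)]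
  have hKGt : ∫⁻ s in Ioc 0 t, K * (∫⁻ u, ‖G s u‖ₑ ^ r) ^ (1 / r) ≠ ∞ :=
    ((lintegral_mono_set hsub).trans_lt hKG.lt_top).ne
  suffices hlim : Tendsto (fun n => ∫ s in Ioc 0 t,
      ∫ z, commutator n (β s) (Y s z.1, Y s z.2) ∂(μ₁.prod μ₂)) atTop
      (𝓝 (∫ _ in Ioc 0 t, (0 : ℝ))) by
    simpa only [integral_zero] using hlim
  refine tendsto_integral_of_dominated_convergence
    (fun s => (K * (∫⁻ u, ‖G s u‖ₑ ^ r) ^ (1 / r)).toReal) (fun n => ?_) ?_ (fun n => ?_) ?_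
  · have hm : StronglyMeasurable fun s =>
        ∫ z, commutator n (β s) (Y s z.1, Y s z.2) ∂(μ₁.prod μ₂) :=
      StronglyMeasurable.integral_prod_right' (f := fun w : ℝ × EuclideanSpace ℝ (Fin d) ×
        EuclideanSpace ℝ (Fin d) => commutator n (β w.1) (Y w.1 w.2.1, Y w.1 w.2.2))
        (h.measurable_commutator_flow n).stronglyMeasurable
    exact hm.aestronglyMeasurable
  · exact integrable_toReal_of_lintegral_ne_top (hGm.const_mul _).aemeasurable hKGt
  · filter_upwards [ae_restrict_of_ae_restrict_of_subset hsub (hK n),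
      ae_lt_top (hGm.const_mul _) hKGt] with s h1 h2
    rw [← ENNReal.ofReal_le_iff_le_toReal h2.ne, ofReal_norm]
    exact (enorm_integral_le_lintegral_enorm _).trans h1
  · have hlt := ae_lt_top (hGm.const_mul (K : ℝ≥0∞)) hKGt
    have hlt' := ae_lt_top hGm ((lintegral_mono_set hsub).trans_lt hG.lt_top).ne
    filter_upwards [hlt', ae_restrict_of_ae_restrict_of_subset hsub hdiv,
      ae_restrict_of_ae_restrict_of_subset hsub h.ae_eq,
      ae_restrict_of_ae_restrict_of_subset hsub h.hasWeakGradient,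
      ae_restrict_mem measurableSet_Ioc] with s h1 h2 h3 h4 h5
    have hY := h.measurable_flow_apply s
    obtain ⟨ρ₁, hρ₁⟩ := exists_hasBoundedDensity (h.map_le_smul hμ₁ (hsub h5))
    obtain ⟨ρ₂, hρ₂⟩ := exists_hasBoundedDensity (h.map_le_smul hμ₂ (hsub h5))
    have hE : ∀ n, ∫ z, commutator n (β s) (Y s z.1, Y s z.2) ∂(μ₁.prod μ₂) =
        commutatorForm n (β s) (fun x => ρ₁ x) (fun x => ρ₂ x) := by
      intro n
      rw [← hρ₁.integral_commutator hρ₂, Measure.map_prod_map _ _ hY hY,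
        integral_map (hY.prodMap hY).aemeasurable
          (h.measurable_commutator_apply n s).aestronglyMeasurable]
      rfl
    simp_rw [hE]
    refine tendsto_commutatorForm hrq (h2.congr_ae h3)
      (h.stronglyMeasurable.comp_measurable measurable_prodMk_left) h4 (h.measurable_enorm_grad s)
      ?_ hρ₁.measurable.coe_nnreal_real hρ₂.measurable.coe_nnreal_real (hρ₁.memLp hrq.symm.lt)
      (hρ₂.memLp hrq.symm.lt) (c := L.toNNReal) fun u => ?_
    · intro htop
      rw [htop, ENNReal.top_rpow_of_pos (by positivity)] at h1
      exact lt_irrefl _ h1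
    · rw [enorm_coe_nnreal]
      exact ENNReal.coe_le_coe.2 (hρ₁.le u)

/-- The flow of a divergence-free field maps Lebesgue measure on a set of finite measure to a
measure below Lebesgue measure: its density is `1` at almost every point that it charges, because
the pairing with the image of every measurable subset is conserved. -/
theorem IsMeasurableVersion.map_restrict_le
    (h : IsMeasurableVersion T L b X D β Y G N) {r q : ℝ} (hrq : r.HolderConjugate q)
    (hG : ∫⁻ s in Icc 0 T, (∫⁻ u, ‖G s u‖ₑ ^ r) ^ (1 / r) ≠ ∞)
    (hdiv : ∀ᵐ s ∂(volume.restrict (Icc 0 T)), IsDivergenceFree (b s)) {t : ℝ}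
    (ht : t ∈ Icc 0 T) {B : Set (EuclideanSpace ℝ (Fin d))} (hB : MeasurableSet B)
    (hBfin : volume B ≠ ∞) : Measure.map (Y t) (volume.restrict B) ≤ volume := by
  have hY := h.measurable_flow_apply t
  have hBf : IsFiniteMeasure (volume.restrict B) := isFiniteMeasure_restrict.2 hBfin
  obtain ⟨ρ, hρ⟩ := exists_hasBoundedDensity
    (h.map_le_smul (Measure.restrict_le_self (s := B)) ht)
  refine hρ.le_volume ((ae_map_iff hY.aemeasurable
    (hρ.measurable (measurableSet_singleton 1))).2 ?_)
  have hint : Integrable (fun x => (ρ (Y t x) : ℝ)) (volume.restrict B) := by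
    refine Integrable.of_bound (hρ.measurable.coe_nnreal_real.comp hY).aestronglyMeasurable
      (L.toNNReal : ℝ) (Eventually.of_forall fun x => ?_)
    rw [Real.norm_of_nonneg (NNReal.coe_nonneg _)]
    exact_mod_cast hρ.le _
  have hae := Integrable.ae_eq_of_forall_setIntegral_eq _ (fun _ => (1 : ℝ)) hint
    (integrable_const _) fun s hs _ => ?_
  · filter_upwards [hae] with x hx
    exact_mod_cast hx
  rw [Measure.restrict_restrict hs]
  set A := s ∩ B
  have hA : MeasurableSet A := hs.inter hB
  have hAf : IsFiniteMeasure (volume.restrict A) :=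
    isFiniteMeasure_restrict.2 (measure_ne_top_of_subset inter_subset_right hBfin)
  -- The mollified pairing of `1_A` and `1_B`, at time `t` and at time `0`.
  have hlim := h.tendsto_integral_commutator_flow (Measure.restrict_le_self (s := A))
    (Measure.restrict_le_self (s := B)) hrq hG hdiv ht
  have hlim_t : Tendsto (fun n => ∫ z, mollifier d n (Y t z.1 - Y t z.2)
      ∂((volume.restrict A).prod (volume.restrict B))) atTop (𝓝 (∫ x in A, (ρ (Y t x) : ℝ))) := by
    have hac : (volume.restrict A).map (Y t) ≪ volume := Measure.absolutelyContinuous_of_le_smul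
      (h.map_le_smul (Measure.restrict_le_self (s := A)) ht)
    have := hρ.tendsto_integral_mollifier hac
    rw [integral_map hY.aemeasurable hρ.measurable.coe_nnreal_real.aestronglyMeasurable,
      Measure.map_prod_map _ _ hY hY] at this
    refine this.congr fun n => ?_
    exact integral_map (hY.prodMap hY).aemeasurable (f := fun z => mollifier d n (z.1 - z.2))
      ((continuous_mollifier n).comp (continuous_fst.sub continuous_snd)).aestronglyMeasurable
  have hlim_0 : Tendsto (fun n => ∫ z, mollifier d n (z.1 - z.2)
      ∂((volume.restrict A).prod (volume.restrict B))) atTop (𝓝 (∫ x in A, (1 : ℝ))) := by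
    have := (hasBoundedDensity_restrict hB).tendsto_integral_mollifier
      (Measure.absolutelyContinuous_of_le (Measure.restrict_le_self (μ := volume) (s := A)))
    convert this using 2
    refine setIntegral_congr_fun hA fun x hx => ?_
    simp [indicator_of_mem hx.2]
  have := tendsto_nhds_unique hlim (hlim_t.sub hlim_0)
  linarith

/-- The flow of a divergence-free field does not compress Lebesgue measure. -/
theorem IsMeasurableVersion.map_le_volume
    (h : IsMeasurableVersion T L b X D β Y G N) {r q : ℝ} (hrq : r.HolderConjugate q)
    (hG : ∫⁻ s in Icc 0 T, (∫⁻ u, ‖G s u‖ₑ ^ r) ^ (1 / r) ≠ ∞)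
    (hdiv : ∀ᵐ s ∂(volume.restrict (Icc 0 T)), IsDivergenceFree (b s)) {t : ℝ}
    (ht : t ∈ Icc 0 T) : Measure.map (Y t) volume ≤ volume := by
  have hY := h.measurable_flow_apply t
  refine Measure.le_iff.2 fun s hs => ?_
  rw [Measure.map_apply hY hs, ← Measure.iSup_restrict_spanningSets (μ := volume) (Y t ⁻¹' s)]
  refine iSup_le fun i => ?_
  rw [← Measure.map_apply hY hs]
  exact h.map_restrict_le hrq hG hdiv ht (measurableSet_spanningSets _ i)
    (measure_spanningSets_lt_top _ i).ne s

end

end LagrangianFlow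

/-! ### The two-sided bound for regular Lagrangian flows -/

open LagrangianFlow in
theorem proposition2p6 (d : ℕ) (p : ℝ≥0∞) (hp : 1 < p) (hp' : p ≠ ∞) :
    ∃ C : ℝ≥0, ∀ (T : ℝ) (_ : 0 ≤ T)
      (b : ℝ → EuclideanSpace ℝ (Fin d) → EuclideanSpace ℝ (Fin d))
      (D : ℝ → EuclideanSpace ℝ (Fin d) →
        EuclideanSpace ℝ (Fin d) →L[ℝ] EuclideanSpace ℝ (Fin d))
      (_ : LagrangianFlow.MemL1Sobolev T p b D)
      (X : ℝ → EuclideanSpace ℝ (Fin d) → EuclideanSpace ℝ (Fin d)) (L : ℝ)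
      (_ : LagrangianFlow.IsRegularLagrangianFlow T b X L),
      (∃ g : ℝ → EuclideanSpace ℝ (Fin d) → ℝ≥0∞,
        Measurable (fun z : ℝ × EuclideanSpace ℝ (Fin d) => g z.1 z.2) ∧
        (∀ t ∈ Icc 0 T, ∀ x y : EuclideanSpace ℝ (Fin d), x ≠ y →
          EReal.exp (-(g t x : EReal) - (g t y : EReal)) ≤ ‖X t x - X t y‖ₑ / ‖x - y‖ₑ ∧
          ‖X t x - X t y‖ₑ / ‖x - y‖ₑ ≤ EReal.exp ((g t x : EReal) + (g t y : EReal))) ∧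
        (∀ t ∈ Icc 0 T, eLpNorm (g t) p volume ≤
          C * ENNReal.ofReal L * ∫⁻ s in Icc 0 t, eLpNorm (D s) p volume) ∧
        ((∀ᵐ t ∂(volume.restrict (Icc 0 T)), LagrangianFlow.IsDivergenceFree (b t)) →
          ∀ t ∈ Icc 0 T, eLpNorm (g t) p volume ≤
            C * ∫⁻ s in Icc 0 t, eLpNorm (D s) p volume)) ∧
      ((∀ᵐ t ∂(volume.restrict (Icc 0 T)), LagrangianFlow.IsDivergenceFree (b t)) →
        LagrangianFlow.HasCompressibility T X 1) := by
  obtain ⟨C, hC⟩ := exists_eLpNorm_growth_le d hp hp'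
  refine ⟨C, fun T hT b D hb X L hX => ?_⟩
  obtain ⟨β, Y, G, N, h⟩ := exists_isMeasurableVersion hT hb hX
  have hp0 : p ≠ 0 := (zero_lt_one.trans hp).ne'
  have hr : 1 < p.toReal := by
    rw [← ENNReal.toReal_one]
    exact (ENNReal.toReal_lt_toReal ENNReal.one_ne_top hp').2 hp
  have hG : ∫⁻ s in Icc 0 T, (∫⁻ u, ‖G s u‖ₑ ^ p.toReal) ^ (1 / p.toReal) ≠ ∞ := by
    simp only [← eLpNorm_eq_lintegral_rpow_enorm_toReal hp0 hp']
    rw [← h.lintegral_eLpNorm_grad_eq le_rfl]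
    exact ((lintegral_mono fun s => le_add_self).trans_lt hb.lintegral_norm_lt_top).ne
  have hvol : (∀ᵐ t ∂(volume.restrict (Icc 0 T)), IsDivergenceFree (b t)) →
      ∀ t ∈ Icc 0 T, Measure.map (Y t) volume ≤ (1 : ℝ≥0∞) • volume := by
    intro hdiv t ht
    rw [one_smul]
    exact h.map_le_volume (Real.HolderConjugate.conjExponent hr) hG hdiv ht
  refine ⟨⟨growth G Y N, h.measurable_growth, fun t ht x y hxy => h.exp_growth_bounds ht hxy,
    hC h (h.one_le_compressibility hT) h.map_le, fun hdiv t ht => ?_⟩, fun hdiv t ht => ?_⟩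
  · simpa only [mul_one] using hC h le_rfl (hvol hdiv) t ht
  · refine ⟨(hX.compressibility t ht).1, ?_⟩
    have hXY : X t =ᵐ[volume] Y t := by
      filter_upwards [measure_eq_zero_iff_ae_notMem.1 h.volume_eq_zero] with x hx
        using h.flow_eq x hx t ht
    rw [Measure.map_congr hXY, ENNReal.ofReal_one]
    exact hvol hdiv t ht
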